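/- Let $d\ge 1$ and let $\Gamma\subset\mathbb{R}^d$ be a finite union of compact subsets of embedded $C^{1,1}$ hypersurfaces (a $C^{1,1}$ hypersurface is a set which near each of its points is, after a rotation, the graph of a differentiable function with Lipschitz gradient on an open subset of $\mathbb{R}^{d-1}$), equipped with the induced surface measure $\sigma$ (the $(d-1)$-dimensional Hausdorff measure restricted to $\Gamma$). For $\operatorname{Im}\lambda>0$ let $G_0(\lambda,x,y)$ be the integral kernel of the free resolvent $R_0(\lambda)=(-\Delta-\lambda^2)^{-1}$ on $\mathbb{R}^d$, and let $$G(\lambda)f(x)=\int_\Gamma G_0(\lambda,x,y)\,f(y)\,d\sigma(y),\qquad f\in L^2(\Gamma),$$ be the operator obtained by restricting this kernel to $\Gamma$. Write $\langle t\rangle=(2+|t|^2)^{1/2}$. Then $G(\lambda)$ is a well-defined bounded operator on $L^2(\Gamma)$ (the integral converges absolutely for $\sigma$-almost every $x\in\Gamma$), and: (i) if $d\ge 3$, there is a constant $C>0$, depending only on $\Gamma$, such that for all $\lambda\in\mathbb{C}$ with $\operatorname{Im}\lambda>0$, $$\|G(\lambda)\|_{L^2(\Gamma)\to L^2(\Gamma)}\le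 C\,\langle\operatorname{Im}\lambda\rangle^{-1};$$ (ii) in every dimension $d\ge1$, for each $r>0$ there is a constant $C>0$, depending only on $\Gamma$ and $r$, such that the same bound holds for all $\lambda\in\mathbb{C}$ with $\operatorname{Im}\lambda>0$ and $|\lambda|\ge r$. -/

import Mathlib

open MeasureTheory Set Complex FourierTransform

noncomputable section

/-- `M ⊆ ℝ^{n+1}` is an embedded hypersurface of class `C^{1,1}`: near each of its points, and after
a linear isometry `ℝ^{n+1} ≃ ℝ^n × ℝ`, it coincides with the graph of a function that is
differentiable with Lipschitz derivative on an open subset of `ℝ^n`. -/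
def IsC11Hypersurface (n : ℕ) (M : Set (EuclideanSpace ℝ (Fin (n + 1)))) : Prop :=
  ∀ p ∈ M, ∃ (W : Set (EuclideanSpace ℝ (Fin (n + 1))))
    (e : EuclideanSpace ℝ (Fin (n + 1)) ≃ₗᵢ[ℝ] WithLp 2 (EuclideanSpace ℝ (Fin n) × ℝ))
    (U : Set (EuclideanSpace ℝ (Fin n))) (F : EuclideanSpace ℝ (Fin n) → ℝ) (K : NNReal),
    IsOpen W ∧ p ∈ W ∧ IsOpen U ∧ DifferentiableOn ℝ F U ∧ LipschitzOnWith K (fderiv ℝ F) U ∧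
      M ∩ W = {x | (e x).fst ∈ U ∧ (e x).snd = F (e x).fst} ∩ W

/-- `Γ` is a finite union of compact subsets of embedded `C^{1,1}` hypersurfaces of `ℝ^{n+1}`. -/
def IsFiniteUnionOfCompactC11Pieces (n : ℕ) (Γ : Set (EuclideanSpace ℝ (Fin (n + 1)))) : Prop :=
  ∃ (m : ℕ) (P M : Fin m → Set (EuclideanSpace ℝ (Fin (n + 1)))),
    (∀ j, IsC11Hypersurface n (M j) ∧ IsCompact (P j) ∧ P j ⊆ M j) ∧ Γ = ⋃ j, P j

/-- Surface measure on `Γ ⊆ ℝ^{n+1}`: the `n`-dimensional Hausdorff measure, normalized so as to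
agree with Lebesgue measure on `ℝ^n`, restricted to `Γ`. -/
def surfaceMeasure (n : ℕ) (Γ : Set (EuclideanSpace ℝ (Fin (n + 1)))) :
    Measure (EuclideanSpace ℝ (Fin (n + 1))) :=
  (Measure.euclideanHausdorffMeasure n).restrict Γ

/-- The heat kernel `(4πt)^{-d/2} exp(-r²/(4t))` of `ℝ^d` at distance `r` and complex time `t`,
`Re t > 0` (principal branch). -/
def heatKernel (d : ℕ) (t : ℂ) (r : ℝ) : ℂ :=
  (1 / (4 * Real.pi * t)) ^ ((d : ℂ) / 2) * cexp (-(r : ℂ) ^ 2 / (4 * t))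

/-- The free outgoing Green's function `G₀(λ, x, y)` on `ℝ^d` for `Im λ > 0`, that is, the integral
kernel of `(-Δ - λ²)⁻¹`, as the Laplace transform `∫ e^{λ² t} e^{tΔ} dt` of the heat kernel along
the ray `t = i s / λ`, `s > 0` (absolutely convergent for `x ≠ y`). For `x ≠ y` it equals
`(i/4) (λ / (2π|x-y|))^{d/2-1} H^{(1)}_{d/2-1}(λ|x-y|)`. -/
def greenFunction (d : ℕ) (l : ℂ) (x y : EuclideanSpace ℝ (Fin d)) : ℂ :=
  ∫ s in Ioi (0 : ℝ), (I / l) * cexp (I * l * s) * heatKernel d (I * s / l) ‖x - y‖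

/-- The free resolvent `R₀(λ) = (-Δ - λ²)⁻¹`, `Im λ > 0`: the operator with Fourier multiplier
`(|ξ|² - λ²)⁻¹`. (The Fourier transform is `∫ e^{-2πi⟨x,ξ⟩} φ(x) dx`, so `-Δ` becomes
multiplication by `(2π|ξ|)²`.) -/
def freeResolvent (d : ℕ) (l : ℂ) (φ : EuclideanSpace ℝ (Fin d) → ℂ) :
    EuclideanSpace ℝ (Fin d) → ℂ :=
  𝓕⁻ (fun ξ => (((2 * Real.pi * ‖ξ‖ : ℝ) : ℂ) ^ 2 - l ^ 2)⁻¹ * 𝓕 φ ξ)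

lemma greenFunction_ray_re {l : ℂ} (hl : 0 < l.im) {s : ℝ} (hs : 0 < s) : 0 < (I * s / l).re := by
  have h : l ≠ 0 := by rintro rfl; simp at hl
  have h2 : 0 < normSq l := normSq_pos.mpr h
  have : (I * s / l).re = s * l.im / normSq l := by
    simp [div_re]
  rw [this]; positivity

lemma heatKernel_conv {d : ℕ} {t : ℂ} (ht : 0 < t.re)
    (φ : SchwartzMap (EuclideanSpace ℝ (Fin d)) ℂ) (x : EuclideanSpace ℝ (Fin d)) :
    ∫ y, heatKernel d t ‖x - y‖ * φ y =
      ∫ ξ, cexp (-(4 * Real.pi ^ 2 * t) * ‖ξ‖ ^ 2 + 2 * Real.pi * I * inner ℝ x ξ) * 𝓕 φ ξ := by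
  have hb : 0 < (4 * Real.pi ^ 2 * t : ℂ).re := by
    have : (4 * Real.pi ^ 2 * t : ℂ) = ((4 * Real.pi ^ 2 : ℝ) : ℂ) * t := by push_cast; ring
    rw [this, re_ofReal_mul]; positivity
  have ht0 : t ≠ 0 := by rintro rfl; simp at ht
  have hpi : (Real.pi : ℂ) ≠ 0 := by exact_mod_cast Real.pi_ne_zero
  have J : Integrable (fun w : EuclideanSpace ℝ (Fin d) =>
      cexp (-(4 * Real.pi ^ 2 * t) * ‖w‖ ^ 2 + 2 * Real.pi * I * inner ℝ x w)) :=
    GaussianFourier.integrable_cexp_neg_mul_sq_norm_add hb _ _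
  have B : ∫ w, 𝓕 (fun w : EuclideanSpace ℝ (Fin d) =>
      cexp (-(4 * Real.pi ^ 2 * t) * ‖w‖ ^ 2 + 2 * Real.pi * I * inner ℝ x w)) w * φ w =
      ∫ ξ, cexp (-(4 * Real.pi ^ 2 * t) * ‖ξ‖ ^ 2 + 2 * Real.pi * I * inner ℝ x ξ) *
        𝓕 (φ : EuclideanSpace ℝ (Fin d) → ℂ) ξ := by
    simpa using! (VectorFourier.integral_fourierIntegral_smul_eq_flip
      (L := innerₗ (EuclideanSpace ℝ (Fin d)))
      Real.continuous_fourierChar continuous_inner J φ.integrable)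
  rw [SchwartzMap.fourier_coe, ← B]
  congr with w
  rw [fourier_gaussian_innerProductSpace' hb, heatKernel, finrank_euclideanSpace, Fintype.card_fin]
  congr 3
  · field_simp
  · field_simp

lemma greenFunction_integrable_prod {d : ℕ} {l : ℂ} (hl : 0 < l.im)
    (φ : SchwartzMap (EuclideanSpace ℝ (Fin d)) ℂ) (x : EuclideanSpace ℝ (Fin d)) :
    Integrable (fun p : ℝ × EuclideanSpace ℝ (Fin d) =>
      (I / l) * cexp (I * l * p.1) * heatKernel d (I * p.1 / l) ‖x - p.2‖ * φ p.2)
      ((volume.restrict (Ioi 0)).prod volume) := by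
  have h0 : l ≠ 0 := by rintro rfl; simp at hl
  have hm : Measurable (fun p : ℝ × EuclideanSpace ℝ (Fin d) =>
      (I / l) * cexp (I * l * p.1) * heatKernel d (I * p.1 / l) ‖x - p.2‖ * φ p.2) := by
    have := φ.continuous.measurable
    unfold heatKernel
    fun_prop
  set D : ℝ := ‖φ.toBoundedContinuousFunction‖
  have hD' : ∀ y, ‖φ y‖ ≤ D := fun y => φ.toBoundedContinuousFunction.norm_coe_le_norm y
  set A : ℝ := ‖(1 / (4 * Real.pi * I / l) : ℂ) ^ ((d : ℂ) / 2)‖ with hA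
  -- pointwise norm of the heat kernel on the ray
  have hk : ∀ s : ℝ, 0 < s → ∀ y, ‖heatKernel d (I * s / l) ‖x - y‖‖ =
      (s⁻¹) ^ ((d : ℝ) / 2) * A * Real.exp (-(l.im / (4 * s)) * ‖x - y‖ ^ 2) := by
    intro s hs y
    have e1 : (1 / (4 * Real.pi * (I * s / l)) : ℂ) =
        ((s⁻¹ : ℝ) : ℂ) * (1 / (4 * Real.pi * I / l)) := by
      push_cast
      have : (s : ℂ) ≠ 0 := by exact_mod_cast hs.ne'
      have : (Real.pi : ℂ) ≠ 0 := by exact_mod_cast Real.pi_ne_zero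
      field_simp
    have hne : (1 / (4 * Real.pi * I / l) : ℂ) ≠ 0 := by
      have : (Real.pi : ℂ) ≠ 0 := by exact_mod_cast Real.pi_ne_zero
      simp [h0]
    have e3 : (((s⁻¹ : ℝ) : ℂ) * (1 / (4 * Real.pi * I / l))) ^ ((d : ℂ) / 2) =
        ((s⁻¹ : ℝ) : ℂ) ^ ((d : ℂ) / 2) * (1 / (4 * Real.pi * I / l)) ^ ((d : ℂ) / 2) := by
      have hs' : ((s⁻¹ : ℝ) : ℂ) ≠ 0 := by exact_mod_cast (inv_pos.mpr hs).ne'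
      rw [cpow_def_of_ne_zero (mul_ne_zero hs' hne), cpow_def_of_ne_zero hs',
        cpow_def_of_ne_zero hne, log_ofReal_mul (inv_pos.mpr hs) hne, ← Complex.exp_add,
        ofReal_log (inv_pos.mpr hs).le]
      ring_nf
    rw [heatKernel, norm_mul, e1, e3, norm_mul, ← hA, norm_exp]
    congr 2
    · rw [← ofReal_natCast, show ((d : ℝ) : ℂ) / 2 = (((d : ℝ) / 2 : ℝ) : ℂ) by push_cast; rfl,
        ← ofReal_cpow (by positivity), norm_real, Real.norm_of_nonneg (by positivity)]
    · have e2 : (-((‖x - y‖ : ℝ) : ℂ) ^ 2 / (4 * (I * s / l))) =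
          ((‖x - y‖ ^ 2 / (4 * s) : ℝ) : ℂ) * (l * I) := by
        have : (s : ℂ) ≠ 0 := by exact_mod_cast hs.ne'
        push_cast
        field_simp
        simp
      rw [e2, re_ofReal_mul]
      simp
      ring
  have hn : ∀ s : ℝ, 0 < s → ∀ y,
      ‖(I / l) * cexp (I * l * s) * heatKernel d (I * s / l) ‖x - y‖ * φ y‖ =
      ‖I / l‖ * Real.exp (-l.im * s) * (s⁻¹) ^ ((d : ℝ) / 2) * A *
        (Real.exp (-(l.im / (4 * s)) * ‖x - y‖ ^ 2) * ‖φ y‖) := by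
    intro s hs y
    rw [norm_mul, norm_mul, norm_mul, hk s hs y, norm_exp, re_mul_ofReal]
    simp
    ring
  have hA0 : 0 ≤ A := norm_nonneg _
  have hG : ∀ s : ℝ, 0 < s → Integrable (fun y : EuclideanSpace ℝ (Fin d) =>
      Real.exp (-(l.im / (4 * s)) * ‖x - y‖ ^ 2) * ‖φ y‖) := by
    intro s hs
    have hc := φ.continuous
    refine φ.integrable.norm.mono' (by apply Continuous.aestronglyMeasurable; fun_prop) ?_
    filter_upwards with y
    rw [norm_mul, norm_norm, Real.norm_of_nonneg (Real.exp_pos _).le]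
    refine mul_le_of_le_one_left (norm_nonneg _) (Real.exp_le_one_iff.mpr ?_)
    have : 0 ≤ l.im / (4 * s) * ‖x - y‖ ^ 2 := by positivity
    linarith
  rw [integrable_prod_iff hm.aestronglyMeasurable]
  constructor
  · filter_upwards [ae_restrict_mem measurableSet_Ioi] with s hs
    refine (((hG s hs).const_mul _).congr (Filter.Eventually.of_forall fun y =>
      (hn s hs y).symm)).mono ?_ (Filter.Eventually.of_forall fun y => by simp)
    exact (hm.comp measurable_prodMk_left).aestronglyMeasurable
  · have hb : Integrable (fun s : ℝ => ‖I / l‖ * A * D * (4 * Real.pi / l.im) ^ ((d : ℝ) / 2) *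
        Real.exp (-l.im * s)) (volume.restrict (Ioi 0)) :=
      (integrableOn_exp_mul_Ioi (by linarith) 0).const_mul _
    refine hb.mono' hm.aestronglyMeasurable.norm.integral_prod_right' ?_
    filter_upwards [ae_restrict_mem measurableSet_Ioi] with s hs
    have hs : 0 < s := hs
    rw [Real.norm_of_nonneg (integral_nonneg fun _ => norm_nonneg _)]
    simp only [hn s hs]
    rw [integral_const_mul]
    have hpos : 0 < l.im / (4 * s) := by positivity
    have h1 : ∫ y, Real.exp (-(l.im / (4 * s)) * ‖x - y‖ ^ 2) * ‖φ y‖ ≤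
        D * (Real.pi / (l.im / (4 * s))) ^ ((d : ℝ) / 2) := by
      have hg := GaussianFourier.integral_rexp_neg_mul_sq_norm (V := EuclideanSpace ℝ (Fin d)) hpos
      rw [finrank_euclideanSpace, Fintype.card_fin] at hg
      have hi : Integrable (fun y : EuclideanSpace ℝ (Fin d) =>
          Real.exp (-(l.im / (4 * s)) * ‖y‖ ^ 2)) := by
        refine Integrable.of_integral_ne_zero ?_
        rw [hg]; positivity
      rw [← hg, ← integral_sub_left_eq_self (fun y => Real.exp (-(l.im / (4 * s)) * ‖y‖ ^ 2)) volume x,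
        ← integral_const_mul]
      refine integral_mono (hG s hs) ((hi.comp_sub_left x).const_mul D) fun y => ?_
      simp only
      rw [mul_comm]
      gcongr
      exact hD' y
    have h2 : (s⁻¹) ^ ((d : ℝ) / 2) * (Real.pi / (l.im / (4 * s))) ^ ((d : ℝ) / 2) =
        (4 * Real.pi / l.im) ^ ((d : ℝ) / 2) := by
      rw [← Real.mul_rpow (by positivity) (by positivity)]
      congr 1
      field_simp
    calc _ ≤ ‖I / l‖ * Real.exp (-l.im * s) * (s⁻¹) ^ ((d : ℝ) / 2) * A *
          (D * (Real.pi / (l.im / (4 * s))) ^ ((d : ℝ) / 2)) := by gcongr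
      _ = ‖I / l‖ * A * D * ((s⁻¹) ^ ((d : ℝ) / 2) *
          (Real.pi / (l.im / (4 * s))) ^ ((d : ℝ) / 2)) * Real.exp (-l.im * s) := by ring
      _ = _ := by rw [h2]

/-- `greenFunction` is the integral kernel of `(-Δ - λ²)⁻¹`. -/
theorem greenFunction_isKernel {d : ℕ} {l : ℂ} (hl : 0 < l.im)
    (φ : SchwartzMap (EuclideanSpace ℝ (Fin d)) ℂ) (x : EuclideanSpace ℝ (Fin d)) :
    Integrable (fun y => greenFunction d l x y * φ y) ∧
      ∫ y, greenFunction d l x y * φ y = freeResolvent d l φ x := by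
  have hI := greenFunction_integrable_prod hl φ x
  have e1 : (fun y => greenFunction d l x y * φ y) = fun y => ∫ s in Ioi (0 : ℝ),
      (I / l) * cexp (I * l * s) * heatKernel d (I * s / l) ‖x - y‖ * φ y := by
    ext y; rw [greenFunction, integral_mul_const]
  rw [e1]
  refine ⟨hI.integral_prod_right, ?_⟩
  have h0 : l ≠ 0 := by rintro rfl; simp at hl
  rw [← integral_integral_swap hI]
  have hre : ∀ ξ : EuclideanSpace ℝ (Fin d), ∀ s : ℝ, (I / l) * cexp (I * l * s) *
      cexp (-(4 * Real.pi ^ 2 * (I * s / l)) * ‖ξ‖ ^ 2 + 2 * Real.pi * I * inner ℝ x ξ)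
      = (I / l) * cexp (2 * Real.pi * I * inner ℝ x ξ) *
        cexp ((I * l - (4 * Real.pi ^ 2 * ‖ξ‖ ^ 2) * (I / l)) * s) := by
    intro ξ s
    rw [mul_assoc (I / l), mul_assoc (I / l), ← Complex.exp_add, ← Complex.exp_add]
    congr 2; ring
  have hneg : ∀ ξ : EuclideanSpace ℝ (Fin d),
      (I * l - (4 * Real.pi ^ 2 * ‖ξ‖ ^ 2) * (I / l)).re ≤ - l.im := by
    intro ξ
    have h1 : 0 < (I / l).re := by simpa using greenFunction_ray_re hl one_pos
    have : (4 * Real.pi ^ 2 * ‖ξ‖ ^ 2 : ℂ) = ((4 * Real.pi ^ 2 * ‖ξ‖ ^ 2 : ℝ) : ℂ) := by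
      push_cast; ring
    rw [this, sub_re, re_ofReal_mul]
    have : 0 ≤ 4 * Real.pi ^ 2 * ‖ξ‖ ^ 2 * (I / l).re := by positivity
    simp; simpa using this
  calc _ = ∫ s in Ioi (0 : ℝ), ∫ ξ : EuclideanSpace ℝ (Fin d),
        (I / l) * cexp (2 * Real.pi * I * inner ℝ x ξ) *
        cexp ((I * l - (4 * Real.pi ^ 2 * ‖ξ‖ ^ 2) * (I / l)) * s) * 𝓕 φ ξ := by
        refine setIntegral_congr_fun measurableSet_Ioi fun s hs => ?_
        simp only [← hre]
        simp only [mul_assoc (I / l * cexp (I * l * s))]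
        rw [integral_const_mul, integral_const_mul, heatKernel_conv (greenFunction_ray_re hl hs) φ x]
    _ = ∫ ξ : EuclideanSpace ℝ (Fin d), ∫ s in Ioi (0 : ℝ),
        (I / l) * cexp (2 * Real.pi * I * inner ℝ x ξ) *
        cexp ((I * l - (4 * Real.pi ^ 2 * ‖ξ‖ ^ 2) * (I / l)) * s) * 𝓕 φ ξ := by
        apply integral_integral_swap
        have hb : Integrable (fun p : ℝ × EuclideanSpace ℝ (Fin d) =>
            ‖I / l‖ * Real.exp (-l.im * p.1) * ‖𝓕 φ p.2‖)
            ((volume.restrict (Ioi 0)).prod volume) := by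
          refine Integrable.mul_prod (f := fun s : ℝ => ‖I / l‖ * Real.exp (-l.im * s))
            (g := fun ξ => ‖𝓕 φ ξ‖) ?_ (𝓕 φ).integrable.norm
          exact (integrableOn_exp_mul_Ioi (by linarith) 0).const_mul _
        refine hb.mono' ?_ ?_
        · have := (𝓕 φ).continuous
          apply Continuous.aestronglyMeasurable
          unfold Function.uncurry
          fun_prop
        · have : ∀ᵐ p : ℝ × EuclideanSpace ℝ (Fin d) ∂((volume.restrict (Ioi 0)).prod volume),
              0 < p.1 := by
            refine (Measure.quasiMeasurePreserving_fst (μ := volume.restrict (Ioi (0 : ℝ)))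
              (ν := (volume : Measure (EuclideanSpace ℝ (Fin d))))).ae ?_
            exact ae_restrict_mem measurableSet_Ioi
          filter_upwards [this] with p hp
          simp only [Function.uncurry, norm_mul]
          have : ‖cexp (2 * Real.pi * I * inner ℝ x p.2)‖ = 1 := by
            rw [show (2 * Real.pi * I * inner ℝ x p.2 : ℂ) =
              ((2 * Real.pi * inner ℝ x p.2 : ℝ) : ℂ) * I by push_cast; ring, norm_exp_ofReal_mul_I]
          rw [this, mul_one, norm_exp (_ * (p.1 : ℂ)), re_mul_ofReal]
          gcongr
          exact hneg _
    _ = _ := by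
        rw [freeResolvent, Real.fourierInv_eq']
        congr with ξ
        rw [integral_mul_const, integral_const_mul,
          integral_exp_mul_complex_Ioi (by linarith [hneg ξ])]
        have hz : (I * l - (4 * Real.pi ^ 2 * ‖ξ‖ ^ 2) * (I / l)) ≠ 0 := by
          intro h; have := hneg ξ; rw [h] at this; simp at this; linarith
        have hz2 : (((2 * Real.pi * ‖ξ‖ : ℝ) : ℂ) ^ 2 - l ^ 2) ≠ 0 := by
          intro h
          apply hz
          push_cast at h
          field_simp
          linear_combination -I * h
        rw [SchwartzMap.fourier_coe, real_inner_comm x ξ, smul_eq_mul]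
        have key : I / l * (-1 / (I * l - (4 * Real.pi ^ 2 * ‖ξ‖ ^ 2) * (I / l))) =
            (((2 * Real.pi * ‖ξ‖ : ℝ) : ℂ) ^ 2 - l ^ 2)⁻¹ := by
          rw [← mul_div_assoc, div_eq_iff hz, inv_mul_eq_div, eq_div_iff hz2]
          push_cast
          field_simp
          ring
        rw [← key]
        simp
        ring_nf

/-- The bounded operator `T` on `L²(Γ)` is `G(λ)`: it is given by restricting the kernel
`G₀(λ, x, y)` to `Γ`, the integral being absolutely convergent for almost every `x ∈ Γ`. -/
def IsRestrictedResolvent (n : ℕ) (Γ : Set (EuclideanSpace ℝ (Fin (n + 1)))) (l : ℂ)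
    (T : Lp ℂ 2 (surfaceMeasure n Γ) →L[ℂ] Lp ℂ 2 (surfaceMeasure n Γ)) : Prop :=
  ∀ f : Lp ℂ 2 (surfaceMeasure n Γ), ∀ᵐ x ∂(surfaceMeasure n Γ),
    Integrable (fun y => greenFunction (n + 1) l x y * f y) (surfaceMeasure n Γ) ∧
      T f x = ∫ y, greenFunction (n + 1) l x y * f y ∂(surfaceMeasure n Γ)

/-- `⟨t⟩ = (2 + |t|²)^{1/2}`. -/
def japaneseBracket (t : ℝ) : ℝ := Real.sqrt (2 + t ^ 2)

end

/-! Formally the pairing of `G(λ)f` with `g` is the integral of `(|ξ|² - λ²)⁻¹` against a product of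
Fourier transforms of the densities `gσ` and `fσ`. Two facts control it: a restriction estimate for
these transforms, and a version of the multiplier smoothed at unit scale.

Restriction estimate. A piece of `Γ` is a Lipschitz graph over a hyperplane, so its surface measure
projects to a measure with bounded density. On each hyperplane at height `s` in the dual variable,
the transform of `fσ` is the transform of a density on that projection, and a Bessel inequality
(`lintegral_oscInt_sq_le`) bounds its `L²` norm by that of `f`, uniformly in `s`. Integrating in
`s`, a radial weight dominated by `W(s)` whenever `|s| ≤ |ξ|` costs only `∫ W`
(`IsGraphSum.exists_lintegral_oscInt_le`).

Smoothed multiplier. The multiplier itself is too singular near `|ξ| = |Re λ|` for small `Im λ`.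
Since `Γ` is bounded, the kernel may be multiplied by `exp(-|x-y|²/4)`. In the heat representation
of the Green function this replaces the complex time `t` by `t/(1+t)` and adds a factor
`(1+t)^{-d/2}`, so the damped multiplier is an explicit integral in `t`. It is of size
`1/((1+|λ|)(1+Im λ))` for `|ξ| ≲ |λ|` and decays like `|ξ|⁻²` beyond (`head_le_symbolWeight`,
`tail_le_symbolWeight`). The one-dimensional integral of this majorant is `O(1/(1+Im λ))`, the
claimed bound. Large times are harmless uniformly in `λ` when `t^{-d/2}` is integrable at infinity,
that is `d ≥ 3`; otherwise an integration by parts gains `|λ|⁻²`, hence the restriction `|λ| ≥ r`.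

The damping is removed by expanding a Schwartz extension of `exp(|v|²/4)` in plane waves, which only
modulate `f` and `g` (`IsGraphSum.exists_enorm_green_le`). A crude `λ`-dependent Schur test makes
`G(λ)` a well-defined operator, and its norm is then read off the bilinear bound
(`exists_clm_of_schur`). -/

open scoped NNReal ENNReal Topology

/-! ### Surface measure as a finite sum of graphs with bounded projection. -/

/-- Orthonormal coordinates of `ℝ^{n+1}`, split into `n` horizontal ones and a vertical one. -/
abbrev GraphFrame (n : ℕ) :=
  EuclideanSpace ℝ (Fin (n + 1)) ≃ₗᵢ[ℝ] WithLp 2 (EuclideanSpace ℝ (Fin n) × ℝ)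

/-- `ν` projects, along the vertical direction of some frame, to a measure with bounded density. -/
def HasBoundedProjection (n : ℕ) (ν : Measure (EuclideanSpace ℝ (Fin (n + 1)))) : Prop :=
  ∃ (e : GraphFrame n) (C : ℝ≥0), ν.map (fun x => (e x).fst) ≤ C • volume

/-- Finite sums of measures with bounded projection. -/
inductive IsGraphSum (n : ℕ) : Measure (EuclideanSpace ℝ (Fin (n + 1))) → Prop
  | zero : IsGraphSum n 0
  | add {ν ρ : Measure (EuclideanSpace ℝ (Fin (n + 1)))} :
      HasBoundedProjection n ν → IsGraphSum n ρ → IsGraphSum n (ν + ρ)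

lemma GraphFrame.continuous_fst {n : ℕ} (e : GraphFrame n) : Continuous fun x => (e x).fst := by
  have := (WithLp.prod_continuous_ofLp 2 (EuclideanSpace ℝ (Fin n)) ℝ).comp e.continuous
  exact this.fst

lemma GraphFrame.continuous_snd {n : ℕ} (e : GraphFrame n) : Continuous fun x => (e x).snd := by
  have := (WithLp.prod_continuous_ofLp 2 (EuclideanSpace ℝ (Fin n)) ℝ).comp e.continuous
  exact this.snd

lemma GraphFrame.norm_fst_le {n : ℕ} (e : GraphFrame n) (x : EuclideanSpace ℝ (Fin (n + 1))) :
    ‖(e x).fst‖ ≤ ‖x‖ := by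
  have h := WithLp.prod_norm_sq_eq_of_L2 (e x)
  rw [e.norm_map] at h
  exact (sq_le_sq₀ (norm_nonneg _) (norm_nonneg _)).1 (by nlinarith [sq_nonneg ‖(e x).snd‖])

lemma GraphFrame.abs_snd_le {n : ℕ} (e : GraphFrame n) (x : EuclideanSpace ℝ (Fin (n + 1))) :
    |(e x).snd| ≤ ‖x‖ := by
  have h := WithLp.prod_norm_sq_eq_of_L2 (e x)
  rw [e.norm_map] at h
  exact (sq_le_sq₀ (abs_nonneg _) (norm_nonneg _)).1
    (by rw [← Real.norm_eq_abs]; nlinarith [sq_nonneg ‖(e x).fst‖])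

/-- The graph of a Lipschitz function, in a frame. -/
lemma euclideanHausdorffMeasure_image_graph_le {n : ℕ} (e : GraphFrame n)
    {F : EuclideanSpace ℝ (Fin n) → ℝ} {L : ℝ≥0} {B : Set (EuclideanSpace ℝ (Fin n))}
    (hF : LipschitzOnWith L F B) {A : Set (EuclideanSpace ℝ (Fin n))} (hA : A ⊆ B) :
    Measure.euclideanHausdorffMeasure n ((fun y => e.symm (WithLp.toLp 2 (y, F y))) '' A) ≤
      ((1 + L) ^ n : ℝ≥0) * volume A := by
  have hl : LipschitzOnWith (1 + L) (fun y => e.symm (WithLp.toLp 2 (y, F y))) A := by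
    refine LipschitzOnWith.of_dist_le_mul fun y hy z hz => ?_
    rw [e.symm.dist_map, dist_eq_norm, ← WithLp.toLp_sub, WithLp.prod_norm_eq_of_L2]
    have h1 := hF.dist_le_mul y (hA hy) z (hA hz)
    rw [dist_eq_norm] at h1 ⊢
    refine Real.sqrt_le_iff.2 ⟨by positivity, ?_⟩
    rw [dist_eq_norm] at h1
    have h2 : ‖F y - F z‖ ^ 2 ≤ (L * ‖y - z‖) ^ 2 := by gcongr
    simp only [Prod.mk_sub_mk, WithLp.toLp_fst, WithLp.toLp_snd]
    push_cast
    nlinarith [mul_nonneg L.2 (sq_nonneg ‖y - z‖)]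
  have h := hl.hausdorffMeasure_image_le (d := n) (by positivity)
  have hv : (volume : Measure (EuclideanSpace ℝ (Fin n))) A =
      Measure.euclideanHausdorffMeasure n A := by
    rw [EuclideanSpace.euclideanHausdorffMeasure_eq_volume]
  rw [hv, Measure.euclideanHausdorffMeasure_def, Measure.euclideanHausdorffMeasure_def,
    Measure.smul_apply, Measure.smul_apply]
  rw [ENNReal.rpow_natCast] at h
  simp only [ENNReal.smul_def, smul_eq_mul]
  refine (mul_le_mul_right h _).trans (le_of_eq ?_)
  push_cast
  ring

/-- A set whose surface measure projects to a measure with bounded density. -/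
def IsGraphPatch (n : ℕ) (S : Set (EuclideanSpace ℝ (Fin (n + 1)))) : Prop :=
  ∃ (e : GraphFrame n) (C : ℝ≥0), ∀ A : Set (EuclideanSpace ℝ (Fin n)),
    Measure.euclideanHausdorffMeasure n (S ∩ (fun x => (e x).fst) ⁻¹' A) ≤ C * volume A

/-- A Lipschitz gradient is bounded on a ball, and a ball is convex, so the mean value inequality
makes `F` Lipschitz there. The graph map is then Lipschitz and inflates `n`-dimensional measure by a
bounded factor only. -/
lemma IsC11Hypersurface.exists_patch {n : ℕ} {M : Set (EuclideanSpace ℝ (Fin (n + 1)))}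
    (hM : IsC11Hypersurface n M) {p : EuclideanSpace ℝ (Fin (n + 1))} (hp : p ∈ M) :
    ∃ V, IsOpen V ∧ p ∈ V ∧ IsGraphPatch n (M ∩ V) := by
  obtain ⟨W, e, U, F, K, hW, hpW, hU, hF, hK, hMW⟩ := hM p hp
  have hpg : p ∈ {x | (e x).fst ∈ U ∧ (e x).snd = F (e x).fst} ∩ W := hMW ▸ ⟨hp, hpW⟩
  obtain ⟨δ, hδ, hball⟩ := Metric.isOpen_iff.1 hU _ hpg.1.1
  set y₀ := (e p).fst
  set B := Metric.ball y₀ δ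
  -- Gradient at the centre plus its largest variation over a ball of radius `δ`.
  set L : ℝ≥0 := ‖fderiv ℝ F y₀‖₊ + K * δ.toNNReal with hLdef
  have hL : LipschitzOnWith L F B := by
    refine (convex_ball y₀ δ).lipschitzOnWith_of_nnnorm_fderiv_le (𝕜 := ℝ)
      (fun x hx => (hF x (hball hx)).differentiableAt (hU.mem_nhds (hball hx))) fun x hx => ?_
    rw [← NNReal.coe_le_coe]
    have h1 := hK.dist_le_mul x (hball hx) y₀ hpg.1.1
    rw [dist_eq_norm] at h1
    have h2 : dist x y₀ < δ := hx
    have h3 := norm_le_norm_add_norm_sub' (fderiv ℝ F x) (fderiv ℝ F y₀)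
    have h4 : K * dist x y₀ ≤ K * δ := by gcongr
    simp only [hLdef, NNReal.coe_add, NNReal.coe_mul, coe_nnnorm,
      Real.coe_toNNReal δ hδ.le]
    linarith
  refine ⟨W ∩ (fun x => (e x).fst) ⁻¹' B, hW.inter (Metric.isOpen_ball.preimage (GraphFrame.continuous_fst e)),
    ⟨hpW, Metric.mem_ball_self hδ⟩, e, (1 + L) ^ n, fun A => ?_⟩
  calc _ ≤ Measure.euclideanHausdorffMeasure n
        ((fun y => e.symm (WithLp.toLp 2 (y, F y))) '' (A ∩ B)) := by
        apply measure_mono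
        rintro x ⟨⟨hxM, hxW, hxB⟩, hxA⟩
        have hx : x ∈ {x | (e x).fst ∈ U ∧ (e x).snd = F (e x).fst} ∩ W := hMW ▸ ⟨hxM, hxW⟩
        refine ⟨(e x).fst, ⟨hxA, hxB⟩, ?_⟩
        simp only [← hx.1.2]
        exact e.symm_apply_apply x
    _ ≤ ((1 + L) ^ n : ℝ≥0) * volume (A ∩ B) :=
        euclideanHausdorffMeasure_image_graph_le e hL inter_subset_right
    _ ≤ _ := by gcongr; exact inter_subset_left

lemma IsGraphPatch.mono {n : ℕ} {S S' : Set (EuclideanSpace ℝ (Fin (n + 1)))}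
    (h : IsGraphPatch n S) (hS : S' ⊆ S) : IsGraphPatch n S' := by
  obtain ⟨e, C, hC⟩ := h
  exact ⟨e, C, fun A => (measure_mono (by gcongr)).trans (hC A)⟩

lemma IsGraphPatch.hasBoundedProjection {n : ℕ} {S : Set (EuclideanSpace ℝ (Fin (n + 1)))}
    (h : IsGraphPatch n S) :
    HasBoundedProjection n ((Measure.euclideanHausdorffMeasure n).restrict S) := by
  obtain ⟨e, C, hC⟩ := h
  refine ⟨e, C, Measure.le_iff.2 fun A hA => ?_⟩
  have hm := e.continuous_fst.measurable
  rw [Measure.map_apply hm hA, Measure.restrict_apply (hm hA), inter_comm]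
  exact hC A

/-- Cover by finitely many relatively open patches. -/
lemma IsC11Hypersurface.exists_finite_cover {n : ℕ} {P M : Set (EuclideanSpace ℝ (Fin (n + 1)))}
    (hM : IsC11Hypersurface n M) (hP : IsCompact P) (hPM : P ⊆ M) :
    ∃ 𝒯 : Set (Set (EuclideanSpace ℝ (Fin (n + 1)))), 𝒯.Finite ∧ P ⊆ ⋃₀ 𝒯 ∧
      ∀ T ∈ 𝒯, IsOpen T ∧ IsGraphPatch n (P ∩ T) := by
  choose! V hVo hVm hV using fun p (hp : p ∈ P) => hM.exists_patch (hPM hp)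
  obtain ⟨t, ht, hcov⟩ := hP.elim_nhds_subcover V fun p hp => (hVo p hp).mem_nhds (hVm p hp)
  refine ⟨V '' t, t.finite_toSet.image V, by simpa [sUnion_image] using hcov, ?_⟩
  rintro _ ⟨p, hp, rfl⟩
  exact ⟨hVo p (ht p hp), (hV p (ht p hp)).mono (by gcongr)⟩

/-- The patches may overlap, so they are peeled off one at a time: the part of `A` inside `T` is one
summand, and the rest of `A` is covered by the remaining sets. -/
lemma isGraphSum_restrict {n : ℕ} {𝒯 : Set (Set (EuclideanSpace ℝ (Fin (n + 1))))}
    (hfin : 𝒯.Finite) (h𝒯 : ∀ T ∈ 𝒯, MeasurableSet T ∧ IsGraphPatch n T) :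
    ∀ A, MeasurableSet A → A ⊆ ⋃₀ 𝒯 →
      IsGraphSum n ((Measure.euclideanHausdorffMeasure n).restrict A) := by
  induction 𝒯, hfin using Set.Finite.induction_on with
  | empty =>
    intro A _ hA
    rw [sUnion_empty, subset_empty_iff] at hA
    rw [hA, Measure.restrict_empty]
    exact .zero
  | @insert T 𝒯 _ _ ih =>
    intro A hAm hA
    have hT := h𝒯 T (mem_insert _ _)
    rw [← Measure.restrict_inter_add_sdiff A hT.1]
    refine .add (hT.2.mono inter_subset_right).hasBoundedProjection
      (ih (fun T' h' => h𝒯 T' (mem_insert_of_mem _ h')) _ (hAm.diff hT.1) ?_)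
    rw [sUnion_insert] at hA
    exact sdiff_subset_iff.2 hA

lemma IsFiniteUnionOfCompactC11Pieces.isCompact {n : ℕ} {Γ : Set (EuclideanSpace ℝ (Fin (n + 1)))}
    (hΓ : IsFiniteUnionOfCompactC11Pieces n Γ) : IsCompact Γ := by
  obtain ⟨m, P, M, h, rfl⟩ := hΓ
  exact isCompact_iUnion fun j => (h j).2.1

lemma IsFiniteUnionOfCompactC11Pieces.isGraphSum {n : ℕ}
    {Γ : Set (EuclideanSpace ℝ (Fin (n + 1)))}
    (hΓ : IsFiniteUnionOfCompactC11Pieces n Γ) : IsGraphSum n (surfaceMeasure n Γ) := by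
  have hm := hΓ.isCompact.measurableSet
  obtain ⟨m, P, M, h, rfl⟩ := hΓ
  choose 𝒯 hfin hcov h𝒯 using fun j => (h j).1.exists_finite_cover (h j).2.1 (h j).2.2
  refine isGraphSum_restrict (𝒯 := ⋃ j, (fun T => P j ∩ T) '' 𝒯 j)
    (finite_iUnion fun j => (hfin j).image _) ?_ _ hm ?_
  · intro S hS
    obtain ⟨j, T, hT, rfl⟩ := mem_iUnion.1 hS
    exact ⟨(h j).2.1.measurableSet.inter (h𝒯 j T hT).1.measurableSet, (h𝒯 j T hT).2⟩
  · intro x hx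
    obtain ⟨j, hj⟩ := mem_iUnion.1 hx
    obtain ⟨T, hT, hxT⟩ := hcov j hj
    exact ⟨P j ∩ T, mem_iUnion.2 ⟨j, T, hT, rfl⟩, hj, hxT⟩

/-- A bounded graph sum is finite. -/
lemma IsGraphSum.measure_isBounded_lt_top {n : ℕ} {σ : Measure (EuclideanSpace ℝ (Fin (n + 1)))}
    (hσ : IsGraphSum n σ) (R : ℝ) : σ (Metric.closedBall 0 R) < ⊤ := by
  induction hσ with
  | zero => simp
  | @add ν ρ hν _ ih =>
    obtain ⟨e, C, hC⟩ := hν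
    rw [Measure.add_apply]
    refine ENNReal.add_lt_top.2 ⟨?_, ih⟩
    calc ν (Metric.closedBall 0 R)
        ≤ ν ((fun x => (e x).fst) ⁻¹' Metric.closedBall 0 R) := by
          apply measure_mono
          intro x hx
          simp only [Metric.mem_closedBall, dist_zero_right, mem_preimage] at hx ⊢
          exact (e.norm_fst_le x).trans hx
      _ = ν.map (fun x => (e x).fst) (Metric.closedBall 0 R) := by
          rw [Measure.map_apply e.continuous_fst.measurable Metric.isClosed_closedBall.measurableSet]
      _ ≤ (C • volume) (Metric.closedBall 0 R) := hC _
      _ < ⊤ := by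
          rw [Measure.smul_apply, ENNReal.smul_def, smul_eq_mul]
          exact ENNReal.mul_lt_top (by simp) measure_closedBall_lt_top

lemma IsFiniteUnionOfCompactC11Pieces.isFiniteMeasure {n : ℕ}
    {Γ : Set (EuclideanSpace ℝ (Fin (n + 1)))} (hΓ : IsFiniteUnionOfCompactC11Pieces n Γ) :
    IsFiniteMeasure (surfaceMeasure n Γ) := by
  obtain ⟨R, hR⟩ := hΓ.isCompact.isBounded.subset_closedBall 0
  refine ⟨?_⟩
  have h := hΓ.isGraphSum.measure_isBounded_lt_top R
  have h2 : surfaceMeasure n Γ univ = surfaceMeasure n Γ (Metric.closedBall 0 R) := by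
    rw [surfaceMeasure, Measure.restrict_apply_univ, Measure.restrict_apply
      Metric.isClosed_closedBall.measurableSet, inter_eq_self_of_subset_right hR]
  rwa [h2]

/-! ### Bessel inequality for Fourier transforms of measures. -/

section Oscillatory

variable {α V : Type*} [MeasurableSpace α]
  [NormedAddCommGroup V] [InnerProductSpace ℝ V]

/-- The Fourier transform (with the sign `e^{2πi⟨p(x), η⟩}`) of the image of `f ν` under `p`. -/
noncomputable def oscInt (ν : Measure α) (p : α → V) (f : α → ℂ) (η : V) : ℂ :=
  ∫ x, cexp (2 * Real.pi * I * inner ℝ (p x) η) * f x ∂ν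

lemma norm_cexp_two_pi_mul (r : ℝ) : ‖cexp (2 * Real.pi * I * r)‖ = 1 := by
  rw [show (2 * Real.pi * I * r : ℂ) = ((2 * Real.pi * r : ℝ) : ℂ) * I by push_cast; ring,
    norm_exp_ofReal_mul_I]

lemma enorm_cexp_two_pi_mul (r : ℝ) : ‖cexp (2 * Real.pi * I * r)‖ₑ = 1 := by
  rw [← ofReal_norm, norm_cexp_two_pi_mul, ENNReal.ofReal_one]

lemma enorm_ofReal (r : ℝ) : ‖(r : ℂ)‖ₑ = ‖r‖ₑ := by
  rw [← ofReal_norm, norm_real, ofReal_norm]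

lemma conj_cexp_two_pi_mul (r : ℝ) :
    (starRingEnd ℂ) (cexp (2 * Real.pi * I * r)) = cexp (2 * Real.pi * I * (-r : ℝ)) := by
  rw [← exp_conj]
  congr 1
  simp [conj_ofReal, Complex.conj_ofNat]

lemma conj_oscInt (ν : Measure α) (p : α → V) (f : α → ℂ) (η : V) :
    (starRingEnd ℂ) (oscInt ν p f η) = oscInt ν p (fun x => (starRingEnd ℂ) (f x)) (-η) := by
  rw [oscInt, oscInt, ← integral_conj]
  congr with x
  rw [map_mul, conj_cexp_two_pi_mul, inner_neg_right]

variable [FiniteDimensional ℝ V] [MeasurableSpace V] [BorelSpace V]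

/-- Gaussian-weighted product of two oscillatory integrals, as a double integral. -/
lemma integral_gaussian_mul_oscInt {ν : Measure α} [SFinite ν] {p : α → V} (hp : Measurable p)
    {f g : α → ℂ} (hf : Integrable f ν) (hg : Integrable g ν) {b : ℂ} (hb : 0 < b.re) :
    ∫ η, cexp (-b * ‖η‖ ^ 2) * (oscInt ν p g η * oscInt ν p f (-η)) =
      ∫ z : α × α, (Real.pi / b) ^ (Module.finrank ℝ V / 2 : ℂ) *
        cexp (-Real.pi ^ 2 * ‖p z.1 - p z.2‖ ^ 2 / b) * (g z.1 * f z.2) ∂(ν.prod ν) := by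
  have hG : Integrable (fun η : V => cexp (-b * ‖η‖ ^ 2)) := by
    simpa using GaussianFourier.integrable_cexp_neg_mul_sq_norm_add (V := V) hb 0 0
  have hI : Integrable (fun q : V × (α × α) => cexp (-b * ‖q.1‖ ^ 2) *
      ((cexp (2 * Real.pi * I * inner ℝ (p q.2.1) q.1) *
        cexp (2 * Real.pi * I * inner ℝ (p q.2.2) (-q.1))) * (g q.2.1 * f q.2.2)))
      ((volume : Measure V).prod (ν.prod ν)) := by
    have h := hG.mul_prod (hg.mul_prod hf)
    refine h.norm.mono' ?_ (Filter.Eventually.of_forall fun q => ?_)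
    · have hfg := (hg.mul_prod hf).aestronglyMeasurable
      refine AEStronglyMeasurable.mul (by fun_prop) (AEStronglyMeasurable.mul ?_ ?_)
      · apply Measurable.aestronglyMeasurable
        have h2 : Measurable fun q : V × (α × α) => inner ℝ (p q.2.2) (-q.1) :=
          (hp.comp (by fun_prop)).inner (by fun_prop)
        fun_prop
      · exact hfg.comp_quasiMeasurePreserving Measure.quasiMeasurePreserving_snd
    · simp only [norm_mul, norm_cexp_two_pi_mul, one_mul, mul_one]
      exact le_rfl
  calc _ = ∫ η, ∫ z : α × α, cexp (-b * ‖η‖ ^ 2) *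
        ((cexp (2 * Real.pi * I * inner ℝ (p z.1) η) *
        cexp (2 * Real.pi * I * inner ℝ (p z.2) (-η))) * (g z.1 * f z.2)) ∂(ν.prod ν) := by
        congr with η
        rw [integral_const_mul, oscInt, oscInt, ← integral_prod_mul]
        congr with z
        ring
    _ = ∫ z : α × α, (∫ η, cexp (-b * ‖η‖ ^ 2) *
        ((cexp (2 * Real.pi * I * inner ℝ (p z.1) η) *
        cexp (2 * Real.pi * I * inner ℝ (p z.2) (-η))) * (g z.1 * f z.2))) ∂(ν.prod ν) :=
        integral_integral_swap hI
    _ = _ := by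
        congr with z
        have h := GaussianFourier.integral_cexp_neg_mul_sq_norm_add hb (2 * Real.pi * I)
          (p z.1 - p z.2)
        have h2 : ((2 * Real.pi * I) ^ 2 * ‖p z.1 - p z.2‖ ^ 2 / (4 * b) : ℂ) =
            -Real.pi ^ 2 * ‖p z.1 - p z.2‖ ^ 2 / b := by
          rw [mul_pow, mul_pow, I_sq]
          have : b ≠ 0 := by rintro rfl; simp at hb
          field_simp
          ring
        rw [h2] at h
        rw [← h, ← integral_mul_const]
        congr with η
        rw [← mul_assoc, ← Complex.exp_add, ← Complex.exp_add, inner_sub_left, inner_neg_right]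
        congr 2
        push_cast
        ring

/-- Schur's test, in quadratic form. -/
lemma lintegral_schur {ν : Measure α} [SFinite ν] {k : α → α → ℝ≥0∞}
    (hk : Measurable (Function.uncurry k)) {S : ℝ≥0∞} (h1 : ∀ x, ∫⁻ y, k x y ∂ν ≤ S)
    (h2 : ∀ y, ∫⁻ x, k x y ∂ν ≤ S) {f g : α → ℝ≥0∞} (hf : AEMeasurable f ν)
    (hg : AEMeasurable g ν) :
    ∫⁻ z : α × α, k z.1 z.2 * (g z.1 * f z.2) ∂(ν.prod ν) ≤
      S * (∫⁻ x, f x ^ 2 ∂ν + ∫⁻ x, g x ^ 2 ∂ν) := by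
  -- A cruder form of the arithmetic-geometric inequality; it loses only a constant factor and
  -- avoids division in `ℝ≥0∞`.
  have hab : ∀ a b : ℝ≥0∞, a * b ≤ a ^ 2 + b ^ 2 := by
    intro a b
    rcases le_total a b with h | h
    · calc a * b ≤ b * b := by gcongr
        _ = b ^ 2 := (sq b).symm
        _ ≤ _ := le_add_self
    · calc a * b ≤ a * a := by gcongr
        _ = a ^ 2 := (sq a).symm
        _ ≤ _ := le_self_add
  have hk' : Measurable fun z : α × α => k z.1 z.2 := hk
  have hg1 : AEMeasurable (fun z : α × α => g z.1) (ν.prod ν) :=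
    hg.comp_quasiMeasurePreserving Measure.quasiMeasurePreserving_fst
  have hf1 : AEMeasurable (fun z : α × α => f z.2) (ν.prod ν) :=
    hf.comp_quasiMeasurePreserving Measure.quasiMeasurePreserving_snd
  calc _ ≤ ∫⁻ z : α × α, (k z.1 z.2 * g z.1 ^ 2 + k z.1 z.2 * f z.2 ^ 2) ∂(ν.prod ν) := by
        refine lintegral_mono fun z => ?_
        simp only
        rw [← mul_add]
        gcongr
        exact hab _ _
    _ = ∫⁻ x, ∫⁻ y, k x y * g x ^ 2 ∂ν ∂ν + ∫⁻ y, ∫⁻ x, k x y * f y ^ 2 ∂ν ∂ν := by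
        have m1 : AEMeasurable (fun z : α × α => k z.1 z.2 * g z.1 ^ 2) (ν.prod ν) :=
          hk'.aemeasurable.mul (hg1.pow_const 2)
        have m2 : AEMeasurable (fun z : α × α => k z.1 z.2 * f z.2 ^ 2) (ν.prod ν) :=
          hk'.aemeasurable.mul (hf1.pow_const 2)
        rw [lintegral_add_left' m1, lintegral_prod _ m1, lintegral_prod_symm _ m2]
    _ ≤ ∫⁻ x, S * g x ^ 2 ∂ν + ∫⁻ y, S * f y ^ 2 ∂ν := by
        gcongr with x y
        · rw [lintegral_mul_const _ (show Measurable (k x) from hk.comp measurable_prodMk_left)]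
          gcongr
          exact h1 x
        · rw [lintegral_mul_const _
            (show Measurable (fun x => k x y) from hk.comp measurable_prodMk_right)]
          gcongr
          exact h2 y
    _ = _ := by
        rw [lintegral_const_mul'' _ (hg.pow_const 2), lintegral_const_mul'' _ (hf.pow_const 2),
          mul_add, add_comm]

/-- Supplies the row and column bounds of Schur's test for convolution kernels: against an image
measure of density at most `C`, the translate of `k` integrates to at most `C` times its total mass.
-/
lemma lintegral_comp_sub_le {ν : Measure α} {p : α → V} (hp : Measurable p) {C : ℝ≥0}
    (hC : ν.map p ≤ C • volume) {k : V → ℝ≥0∞} (hk : Measurable k) (v : V) :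
    ∫⁻ y, k (v - p y) ∂ν ≤ C * ∫⁻ w, k w := by
  calc ∫⁻ y, k (v - p y) ∂ν = ∫⁻ w, k (v - w) ∂(ν.map p) := by
        rw [lintegral_map (by fun_prop) hp]
    _ ≤ ∫⁻ w, k (v - w) ∂(C • volume) := lintegral_mono' hC le_rfl
    _ = C * ∫⁻ w, k w := by
        rw [lintegral_smul_measure, lintegral_sub_left_eq_self]
        rfl

lemma lintegral_gaussian {b : ℝ} (hb : 0 < b) :
    ∫⁻ v : V, ENNReal.ofReal (Real.exp (-b * ‖v‖ ^ 2)) =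
      ENNReal.ofReal ((Real.pi / b) ^ (Module.finrank ℝ V / 2 : ℝ)) := by
  have h := GaussianFourier.integral_rexp_neg_mul_sq_norm (V := V) hb
  rw [← ofReal_integral_eq_lintegral_ofReal _ (Filter.Eventually.of_forall fun v =>
    (Real.exp_pos _).le), h]
  refine Integrable.of_integral_ne_zero ?_
  rw [h]; positivity

lemma aestronglyMeasurable_oscInt {ν : Measure α} [SFinite ν] {p : α → V} (hp : Measurable p)
    {f : α → ℂ} (hf : AEStronglyMeasurable f ν) {μ : Measure V} [SFinite μ] :
    AEStronglyMeasurable (oscInt ν p f) μ := by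
  have h : AEStronglyMeasurable (fun q : V × α =>
      cexp (2 * Real.pi * I * inner ℝ (p q.2) q.1) * f q.2) (μ.prod ν) := by
    refine AEStronglyMeasurable.mul ?_
      (hf.comp_quasiMeasurePreserving Measure.quasiMeasurePreserving_snd)
    apply Measurable.aestronglyMeasurable
    fun_prop
  exact h.integral_prod_right'

/-- Bessel's inequality for measures whose image has a bounded density. -/
lemma lintegral_oscInt_sq_le {ν : Measure α} [IsFiniteMeasure ν] {p : α → V} (hp : Measurable p)
    {C : ℝ≥0} (hC : ν.map p ≤ C • volume) {f : α → ℂ} (hf : MemLp f 2 ν) :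
    ∫⁻ η, ‖oscInt ν p f η‖ₑ ^ 2 ≤ 2 * C * ∫⁻ x, ‖f x‖ₑ ^ 2 ∂ν := by
  have hfi : Integrable f ν := hf.integrable (by norm_num)
  have hfc : Integrable (fun x => (starRingEnd ℂ) (f x)) ν :=
    (LinearIsometryEquiv.integrable_comp_iff conjLIE).2 hfi
  have hO := aestronglyMeasurable_oscInt (μ := (volume : Measure V)) hp hf.aestronglyMeasurable
  -- The Gaussian weight makes Fubini legitimate; the bound does not depend on `b`, so the weight
  -- can be removed afterwards.
  have key : ∀ b : ℝ, 0 < b → ∫⁻ η, ENNReal.ofReal (Real.exp (-b * ‖η‖ ^ 2)) *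
      ‖oscInt ν p f η‖ₑ ^ 2 ≤ 2 * C * ∫⁻ x, ‖f x‖ₑ ^ 2 ∂ν := by
    intro b hb
    have e1 : ∀ η : V, cexp (-b * ‖η‖ ^ 2) *
        (oscInt ν p f η * oscInt ν p (fun x => (starRingEnd ℂ) (f x)) (-η)) =
        ((Real.exp (-b * ‖η‖ ^ 2) * ‖oscInt ν p f η‖ ^ 2 : ℝ) : ℂ) := by
      intro η
      rw [← conj_oscInt, mul_conj, normSq_eq_norm_sq]
      push_cast
      rfl
    have h := integral_gaussian_mul_oscInt hp hfc hfi (b := b) (by simpa using hb)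
    simp only [e1] at h
    rw [integral_complex_ofReal] at h
    have hbd : ∀ η, ‖oscInt ν p f η‖ ≤ ∫ x, ‖f x‖ ∂ν := by
      intro η
      refine (norm_integral_le_integral_norm _).trans (le_of_eq ?_)
      congr with x
      rw [norm_mul, norm_cexp_two_pi_mul, one_mul]
    have hint : Integrable fun η : V => Real.exp (-b * ‖η‖ ^ 2) * ‖oscInt ν p f η‖ ^ 2 := by
      have hg : Integrable (fun η : V => Real.exp (-b * ‖η‖ ^ 2)) := by
        refine Integrable.of_integral_ne_zero ?_
        rw [GaussianFourier.integral_rexp_neg_mul_sq_norm hb]; positivity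
      refine (hg.mul_const ((∫ x, ‖f x‖ ∂ν) ^ 2)).mono' (by fun_prop)
        (Filter.Eventually.of_forall fun η => ?_)
      rw [Real.norm_of_nonneg (by positivity)]
      gcongr
      exact hbd η
    have e2 : ∫⁻ η, ENNReal.ofReal (Real.exp (-b * ‖η‖ ^ 2)) * ‖oscInt ν p f η‖ₑ ^ 2 =
        ENNReal.ofReal (∫ η, Real.exp (-b * ‖η‖ ^ 2) * ‖oscInt ν p f η‖ ^ 2) := by
      rw [ofReal_integral_eq_lintegral_ofReal hint
        (Filter.Eventually.of_forall fun η => by positivity)]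
      congr with η
      rw [ENNReal.ofReal_mul (Real.exp_pos _).le, ENNReal.ofReal_pow (norm_nonneg _),
        ofReal_norm]
    rw [e2, ← Real.enorm_of_nonneg (integral_nonneg fun η => by positivity), ← enorm_ofReal, h]
    refine (enorm_integral_le_lintegral_enorm _).trans ?_
    -- The Fourier transform of the Gaussian weight, an approximate identity of mass one for every
    -- `b`. This is why the Schur constant is exactly `C`.
    set κ : V → ℝ≥0∞ := fun v => ENNReal.ofReal ((Real.pi / b) ^ (Module.finrank ℝ V / 2 : ℝ)) *
      ENNReal.ofReal (Real.exp (-(Real.pi ^ 2 / b) * ‖v‖ ^ 2)) with hκ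
    have hκm : Measurable κ := by fun_prop
    have hκi : ∫⁻ v, κ v = 1 := by
      rw [hκ, lintegral_const_mul _ (by fun_prop), lintegral_gaussian (by positivity),
        ← ENNReal.ofReal_mul (by positivity), ← Real.mul_rpow (by positivity) (by positivity)]
      rw [show Real.pi / b * (Real.pi / (Real.pi ^ 2 / b)) = 1 by field_simp]
      simp
    have hκs : ∀ v, κ (-v) = κ v := fun v => by simp [hκ]
    have e3 : ∀ z : α × α, ‖((Real.pi / (b : ℂ)) ^ (Module.finrank ℝ V / 2 : ℂ) *
        cexp (-Real.pi ^ 2 * ‖p z.1 - p z.2‖ ^ 2 / b) * (f z.1 * (starRingEnd ℂ) (f z.2)))‖ₑ =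
        κ (p z.1 - p z.2) * (‖f z.1‖ₑ * ‖f z.2‖ₑ) := by
      intro z
      rw [enorm_mul, enorm_mul, enorm_mul]
      congr 2
      · rw [← ofReal_norm, show ((Real.pi / (b : ℂ)) ^ (Module.finrank ℝ V / 2 : ℂ)) =
          (((Real.pi / b) ^ (Module.finrank ℝ V / 2 : ℝ) : ℝ) : ℂ) by
            rw [ofReal_cpow (by positivity)]; push_cast; rfl]
        rw [norm_real, Real.norm_of_nonneg (by positivity)]
      · rw [← ofReal_norm, show (-Real.pi ^ 2 * ‖p z.1 - p z.2‖ ^ 2 / b : ℂ) =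
          ((-(Real.pi ^ 2 / b) * ‖p z.1 - p z.2‖ ^ 2 : ℝ) : ℂ) by push_cast; ring, norm_exp_ofReal]
      · rw [← ofReal_norm, RCLike.norm_conj, ofReal_norm]
    simp only [e3]
    refine (lintegral_schur (k := fun x y => κ (p x - p y)) (S := C) ?_ ?_ ?_
      hf.aestronglyMeasurable.enorm hf.aestronglyMeasurable.enorm).trans (le_of_eq ?_)
    · exact hκm.comp ((hp.comp measurable_fst).sub (hp.comp measurable_snd))
    · intro x
      simpa [hκi] using lintegral_comp_sub_le hp hC hκm (p x)
    · intro y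
      simp_rw [← hκs (p _ - p y), neg_sub]
      simpa [hκi] using lintegral_comp_sub_le hp hC hκm (p y)
    · ring
  have hlim : ∀ η : V, Filter.Tendsto (fun k : ℕ =>
      ENNReal.ofReal (Real.exp (-(1 / ((k : ℝ) + 1)) * ‖η‖ ^ 2)) * ‖oscInt ν p f η‖ₑ ^ 2)
      Filter.atTop (𝓝 (‖oscInt ν p f η‖ₑ ^ 2)) := by
    intro η
    have h1 : Filter.Tendsto (fun k : ℕ => Real.exp (-(1 / ((k : ℝ) + 1)) * ‖η‖ ^ 2))
        Filter.atTop (𝓝 (Real.exp (-0 * ‖η‖ ^ 2))) :=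
      (Real.continuous_exp.tendsto _).comp
        (tendsto_one_div_add_atTop_nhds_zero_nat.neg.mul_const _)
    have h2 := (ENNReal.tendsto_ofReal h1)
    have h3 := ENNReal.Tendsto.mul_const (b := ‖oscInt ν p f η‖ₑ ^ 2) h2 (Or.inl (by simp))
    simpa using h3
  -- Fatou's lemma as `b = 1/(k+1)` tends to zero.
  calc ∫⁻ η, ‖oscInt ν p f η‖ₑ ^ 2 = ∫⁻ η, Filter.liminf (fun k : ℕ =>
        ENNReal.ofReal (Real.exp (-(1 / ((k : ℝ) + 1)) * ‖η‖ ^ 2)) * ‖oscInt ν p f η‖ₑ ^ 2)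
        Filter.atTop := by
        congr with η
        exact (hlim η).liminf_eq.symm
    _ ≤ _ := lintegral_liminf_le' fun k => by fun_prop
    _ ≤ Filter.liminf (fun _ : ℕ => 2 * C * ∫⁻ x, ‖f x‖ₑ ^ 2 ∂ν) Filter.atTop :=
        Filter.liminf_le_liminf (Filter.Eventually.of_forall fun k => key _ (by positivity))
    _ = _ := by simp

end Oscillatory

/-! ### Weighted restriction estimate by slicing in the vertical dual variable. -/

/-- At fixed height `s` the vertical phase depends on the integration point alone, so it can be
absorbed into the density without changing its modulus. -/
lemma oscInt_frame_symm {n : ℕ} (e : GraphFrame n)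
    (ν : Measure (EuclideanSpace ℝ (Fin (n + 1)))) (f : EuclideanSpace ℝ (Fin (n + 1)) → ℂ)
    (η : EuclideanSpace ℝ (Fin n)) (s : ℝ) :
    oscInt ν id f (e.symm (WithLp.toLp 2 (η, s))) = oscInt ν (fun x => (e x).fst)
      (fun x => cexp (2 * Real.pi * I * ((e x).snd * s : ℝ)) * f x) η := by
  rw [oscInt, oscInt]
  congr with x
  rw [← mul_assoc, ← Complex.exp_add]
  congr 2
  have h : inner ℝ x (e.symm (WithLp.toLp 2 (η, s))) =
      inner ℝ (e x).fst η + (e x).snd * s := by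
    rw [← e.inner_map_map, e.apply_symm_apply, WithLp.prod_inner_apply]
    simp [mul_comm]
  rw [id, h]
  push_cast
  ring

/-- The Bessel inequality applies on each slice with a constant independent of the height. Since the
vertical coordinate of `ξ` is at most `‖ξ‖`, the weight is dominated by a function of the height,
which comes out of the slice integral. -/
lemma HasBoundedProjection.exists_lintegral_oscInt_le {n : ℕ}
    {ν : Measure (EuclideanSpace ℝ (Fin (n + 1)))} [IsFiniteMeasure ν]
    (hν : HasBoundedProjection n ν) :
    ∃ K : ℝ≥0, ∀ f, MemLp f 2 ν → ∀ (w : EuclideanSpace ℝ (Fin (n + 1)) → ℝ≥0∞) (W : ℝ → ℝ≥0∞),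
      Measurable W → (∀ ξ s, |s| ≤ ‖ξ‖ → w ξ ≤ W s) →
      ∫⁻ ξ, ‖oscInt ν id f ξ‖ₑ ^ 2 * w ξ ≤ K * (∫⁻ s, W s) * ∫⁻ x, ‖f x‖ₑ ^ 2 ∂ν := by
  obtain ⟨e, C, hC⟩ := hν
  refine ⟨2 * C, fun f hf w W hW hw => ?_⟩
  set Φ : EuclideanSpace ℝ (Fin n) × ℝ → EuclideanSpace ℝ (Fin (n + 1)) :=
    fun q => e.symm (WithLp.toLp 2 q)
  have hΦ : MeasurePreserving Φ :=
    e.symm.measurePreserving.comp (WithLp.volume_preserving_toLp (EuclideanSpace ℝ (Fin n)) ℝ)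
  have hΦe : MeasurableEmbedding Φ :=
    e.symm.toHomeomorph.measurableEmbedding.comp
      (MeasurableEquiv.toLp 2 (EuclideanSpace ℝ (Fin n) × ℝ)).measurableEmbedding
  have hO := aestronglyMeasurable_oscInt
    (μ := (volume : Measure (EuclideanSpace ℝ (Fin (n + 1))))) measurable_id hf.aestronglyMeasurable
  have hslice : ∀ s : ℝ, ∫⁻ η, ‖oscInt ν id f (Φ (η, s))‖ₑ ^ 2 ≤
      2 * C * ∫⁻ x, ‖f x‖ₑ ^ 2 ∂ν := by
    intro s
    have hm : Measurable fun x => cexp (2 * Real.pi * I * ((e x).snd * s : ℝ)) := by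
      have := e.continuous_snd.measurable
      fun_prop
    have hfs : MemLp (fun x => cexp (2 * Real.pi * I * ((e x).snd * s : ℝ)) * f x) 2 ν :=
      hf.of_le (hm.aestronglyMeasurable.mul hf.aestronglyMeasurable)
        (Filter.Eventually.of_forall fun x => by rw [norm_mul, norm_cexp_two_pi_mul, one_mul])
    have h := lintegral_oscInt_sq_le e.continuous_fst.measurable hC hfs
    simp only [enorm_mul, enorm_cexp_two_pi_mul, one_mul] at h
    simpa only [Φ, oscInt_frame_symm] using h
  calc ∫⁻ ξ, ‖oscInt ν id f ξ‖ₑ ^ 2 * w ξ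
      ≤ ∫⁻ ξ, ‖oscInt ν id f ξ‖ₑ ^ 2 * W (e ξ).snd := by
        gcongr with ξ
        exact hw ξ _ (e.abs_snd_le ξ)
    _ = ∫⁻ q : EuclideanSpace ℝ (Fin n) × ℝ, ‖oscInt ν id f (Φ q)‖ₑ ^ 2 * W q.2 := by
        rw [← hΦ.lintegral_comp_emb hΦe]
        simp only [Φ, LinearIsometryEquiv.apply_symm_apply, WithLp.toLp_snd]
    _ = ∫⁻ s, (∫⁻ η, ‖oscInt ν id f (Φ (η, s))‖ₑ ^ 2) * W s := by
        rw [Measure.volume_eq_prod, lintegral_prod_symm]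
        · refine lintegral_congr_ae ?_
          filter_upwards [] with s
          refine lintegral_mul_const'' _ ?_
          simp only [Φ, oscInt_frame_symm]
          refine (AEStronglyMeasurable.enorm (aestronglyMeasurable_oscInt
            e.continuous_fst.measurable ?_)).pow_const 2
          have := e.continuous_snd.measurable
          exact AEStronglyMeasurable.mul (by fun_prop) hf.aestronglyMeasurable
        · have h1 : AEStronglyMeasurable (fun q => oscInt ν id f (Φ q))
              ((volume : Measure (EuclideanSpace ℝ (Fin n))).prod (volume : Measure ℝ)) :=
            hO.comp_measurePreserving hΦ
          exact (h1.enorm.pow_const 2).mul (hW.comp measurable_snd).aemeasurable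
    _ ≤ ∫⁻ s, (2 * C * ∫⁻ x, ‖f x‖ₑ ^ 2 ∂ν) * W s := by
        gcongr with s
        exact hslice s
    _ = _ := by
        rw [lintegral_const_mul _ hW]
        push_cast
        ring

/-- The pieces have different vertical directions, but the condition linking `w` and `W` mentions
only `‖ξ‖`, so it serves every frame and the pieces can be added. -/
lemma IsGraphSum.exists_lintegral_oscInt_le {n : ℕ}
    {σ : Measure (EuclideanSpace ℝ (Fin (n + 1)))} [IsFiniteMeasure σ] (hσ : IsGraphSum n σ) :
    ∃ K : ℝ≥0, ∀ f, MemLp f 2 σ → ∀ (w : EuclideanSpace ℝ (Fin (n + 1)) → ℝ≥0∞) (W : ℝ → ℝ≥0∞),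
      Measurable w → Measurable W → (∀ ξ s, |s| ≤ ‖ξ‖ → w ξ ≤ W s) →
      ∫⁻ ξ, ‖oscInt σ id f ξ‖ₑ ^ 2 * w ξ ≤ K * (∫⁻ s, W s) * ∫⁻ x, ‖f x‖ₑ ^ 2 ∂σ := by
  -- Finiteness of the measure must vary with the induction, as it is needed for each summand.
  rename_i hfin
  revert hfin
  induction hσ with
  | zero =>
    intro _
    exact ⟨0, fun f _ w W _ _ _ => by simp [oscInt]⟩
  | @add ν ρ hν _ ih =>
    intro hfin
    have hν1 : IsFiniteMeasure ν := isFiniteMeasure_of_le (ν + ρ) (Measure.le_add_right le_rfl)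
    have hρ1 : IsFiniteMeasure ρ := isFiniteMeasure_of_le (ν + ρ) (Measure.le_add_left le_rfl)
    obtain ⟨K₁, h₁⟩ := hν.exists_lintegral_oscInt_le
    obtain ⟨K₂, h₂⟩ := ih
    refine ⟨2 * (K₁ + K₂), fun f hf w W hwm hW hw => ?_⟩
    have hfν : MemLp f 2 ν := hf.mono_measure (Measure.le_add_right le_rfl)
    have hfρ : MemLp f 2 ρ := hf.mono_measure (Measure.le_add_left le_rfl)
    have hint : ∀ {τ : Measure (EuclideanSpace ℝ (Fin (n + 1)))} [IsFiniteMeasure τ],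
        MemLp f 2 τ → ∀ ξ, Integrable (fun x => cexp (2 * Real.pi * I * inner ℝ (id x) ξ) * f x) τ :=
      fun hfτ ξ => (hfτ.integrable (by norm_num)).bdd_mul (c := 1)
        (by apply Measurable.aestronglyMeasurable; fun_prop)
        (Filter.Eventually.of_forall fun x => (norm_cexp_two_pi_mul _).le)
    have hadd : ∀ ξ, oscInt (ν + ρ) id f ξ = oscInt ν id f ξ + oscInt ρ id f ξ := fun ξ =>
      integral_add_measure (hint hfν ξ) (hint hfρ ξ)
    have hOν := aestronglyMeasurable_oscInt
      (μ := (volume : Measure (EuclideanSpace ℝ (Fin (n + 1))))) measurable_id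
      hfν.aestronglyMeasurable
    calc _ ≤ ∫⁻ ξ, 2 * (‖oscInt ν id f ξ‖ₑ ^ 2 * w ξ + ‖oscInt ρ id f ξ‖ₑ ^ 2 * w ξ) := by
          refine lintegral_mono fun ξ => ?_
          simp only
          rw [hadd, ← add_mul, ← mul_assoc]
          gcongr
          calc ‖oscInt ν id f ξ + oscInt ρ id f ξ‖ₑ ^ 2
              ≤ (‖oscInt ν id f ξ‖ₑ + ‖oscInt ρ id f ξ‖ₑ) ^ 2 := by gcongr; exact enorm_add_le _ _
            _ ≤ _ := by
              have h := ENNReal.rpow_add_le_mul_rpow_add_rpow ‖oscInt ν id f ξ‖ₑ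
                ‖oscInt ρ id f ξ‖ₑ (p := 2) (by norm_num)
              norm_num at h
              exact_mod_cast h
      _ = 2 * ((∫⁻ ξ, ‖oscInt ν id f ξ‖ₑ ^ 2 * w ξ) +
          ∫⁻ ξ, ‖oscInt ρ id f ξ‖ₑ ^ 2 * w ξ) := by
          have hm : AEMeasurable fun ξ => ‖oscInt ν id f ξ‖ₑ ^ 2 * w ξ :=
            (hOν.enorm.pow_const 2).mul hwm.aemeasurable
          rw [lintegral_const_mul' _ _ (by simp), lintegral_add_left' hm]
      _ ≤ 2 * (K₁ * (∫⁻ s, W s) * (∫⁻ x, ‖f x‖ₑ ^ 2 ∂(ν + ρ)) +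
            K₂ * (∫⁻ s, W s) * (∫⁻ x, ‖f x‖ₑ ^ 2 ∂(ν + ρ))) := by
          gcongr 2 * (?_ + ?_)
          · refine (h₁ f hfν w W hW hw).trans ?_
            gcongr
            exact (Measure.le_add_right le_rfl)
          · refine (h₂ f hfρ w W hwm hW hw).trans ?_
            gcongr
            exact (Measure.le_add_left le_rfl)
      _ = _ := by push_cast; ring

/-- Projection shortens distances, so a Gaussian on the surface is dominated by its horizontal
version, whose integral over `ℝ^n` is explicit. -/
lemma IsGraphSum.exists_lintegral_gaussian_le {n : ℕ}
    {σ : Measure (EuclideanSpace ℝ (Fin (n + 1)))} (hσ : IsGraphSum n σ) :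
    ∃ K : ℝ≥0, ∀ b : ℝ, 0 < b → ∀ x, ∫⁻ y, ENNReal.ofReal (Real.exp (-b * ‖x - y‖ ^ 2)) ∂σ ≤
      K * ENNReal.ofReal ((Real.pi / b) ^ (n / 2 : ℝ)) := by
  induction hσ with
  | zero => exact ⟨0, by simp⟩
  | @add ν ρ hν _ ih =>
    obtain ⟨e, C, hC⟩ := hν
    obtain ⟨K, hK⟩ := ih
    refine ⟨C + K, fun b hb x => ?_⟩
    rw [lintegral_add_measure]
    push_cast
    rw [add_mul]
    gcongr
    · have h := lintegral_comp_sub_le e.continuous_fst.measurable hC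
        (k := fun v => ENNReal.ofReal (Real.exp (-b * ‖v‖ ^ 2))) (by fun_prop) (e x).fst
      rw [lintegral_gaussian hb, finrank_euclideanSpace, Fintype.card_fin] at h
      refine le_trans (lintegral_mono fun y =>
        ENNReal.ofReal_le_ofReal (Real.exp_le_exp.2 ?_)) h
      have h2 := e.norm_fst_le (x - y)
      rw [map_sub, WithLp.sub_fst] at h2
      have h3 : ‖(e x).fst - (e y).fst‖ ^ 2 ≤ ‖x - y‖ ^ 2 := by gcongr
      nlinarith
    · exact hK b hb x

/-! ### Estimates of the damped heat multiplier and its time integrals. -/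

/-- The amplitude `(1+ωa)^{-d/2} exp(-x² ωa/(1+ωa))`: the Fourier multiplier, at frequency `x`, of
the heat flow at complex time `ωa` damped by a Gaussian weight. -/
noncomputable def dampedHeat (d : ℕ) (ω : ℂ) (x a : ℝ) : ℂ :=
  (1 + ω * a) ^ (((-(d / 2 : ℝ)) : ℝ) : ℂ) * cexp (-(x : ℂ) ^ 2 * (ω * a / (1 + ω * a)))

section DampedHeat

variable {ω : ℂ} {a : ℝ}

lemma one_le_re_one_add_mul (hω : 0 ≤ ω.re) (ha : 0 ≤ a) : 1 ≤ (1 + ω * a).re := by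
  simp; positivity

lemma one_le_norm_one_add_mul (hω : 0 ≤ ω.re) (ha : 0 ≤ a) : 1 ≤ ‖1 + ω * a‖ :=
  (one_le_re_one_add_mul hω ha).trans (re_le_norm _)

lemma one_add_mul_ne_zero (hω : 0 ≤ ω.re) (ha : 0 ≤ a) : (1 + ω * a) ≠ 0 := by
  have := one_le_norm_one_add_mul hω ha
  rw [← norm_pos_iff]; linarith

lemma normSq_one_add_mul (h1 : ‖ω‖ = 1) :
    ‖1 + ω * a‖ ^ 2 = 1 + 2 * a * ω.re + a ^ 2 := by
  have h : ω.re ^ 2 + ω.im ^ 2 = 1 := by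
    have := Complex.sq_norm ω
    rw [h1, normSq_apply] at this
    linarith
  rw [Complex.sq_norm, normSq_apply]
  simp
  linear_combination a ^ 2 * h

lemma le_norm_one_add_mul (h1 : ‖ω‖ = 1) (hω : 0 ≤ ω.re) (ha : 0 ≤ a) : a ≤ ‖1 + ω * a‖ := by
  refine (sq_le_sq₀ ha (norm_nonneg _)).1 ?_
  rw [normSq_one_add_mul h1]
  nlinarith [mul_nonneg ha hω]

lemma norm_one_add_mul_le (h1 : ‖ω‖ = 1) (ha : 0 ≤ a) : ‖1 + ω * a‖ ≤ 1 + a := by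
  refine (norm_add_le _ _).trans ?_
  rw [norm_mul, h1, norm_one, norm_real, Real.norm_of_nonneg ha, one_mul]

lemma re_mul_div_one_add (h1 : ‖ω‖ = 1) :
    (ω * a / (1 + ω * a)).re = (a * ω.re + a ^ 2) / ‖1 + ω * a‖ ^ 2 := by
  have h : ω.re ^ 2 + ω.im ^ 2 = 1 := by
    have := Complex.sq_norm ω
    rw [h1, normSq_apply] at this
    linarith
  rw [Complex.sq_norm, div_re, ← add_div]
  congr 1
  simp
  linear_combination a ^ 2 * h

/-- The gain from damping: the lower bound persists as `Re ω → 0`, where the undamped real part `a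
Re ω` vanishes. It yields estimates uniform up to the real axis in `λ`. -/
lemma sq_div_le_re_mul_div_one_add (h1 : ‖ω‖ = 1) (hω : 0 ≤ ω.re) (ha : 0 ≤ a) :
    a ^ 2 / (1 + a) ^ 2 ≤ (ω * a / (1 + ω * a)).re := by
  rw [re_mul_div_one_add h1]
  have h2 := norm_one_add_mul_le h1 ha
  have h3 := one_le_norm_one_add_mul hω ha
  have h4 : 0 ≤ a * ω.re := by positivity
  gcongr
  linarith

lemma norm_dampedHeat (d : ℕ) (x : ℝ) :
    ‖dampedHeat d ω x a‖ =
      ‖1 + ω * a‖ ^ (-(d / 2 : ℝ)) * Real.exp (-x ^ 2 * (ω * a / (1 + ω * a)).re) := by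
  rw [dampedHeat, norm_mul, norm_cpow_real, norm_exp]
  congr 2
  rw [show (-(x : ℂ) ^ 2) = ((-x ^ 2 : ℝ) : ℂ) by push_cast; rfl, re_ofReal_mul]

lemma norm_dampedHeat_le_of_le_one (h1 : ‖ω‖ = 1) (hω : 0 ≤ ω.re) (ha : 0 ≤ a) (ha1 : a ≤ 1)
    (d : ℕ) (x : ℝ) : ‖dampedHeat d ω x a‖ ≤ Real.exp (-(x ^ 2 / 4) * a ^ 2) := by
  rw [norm_dampedHeat]
  have h2 := one_le_norm_one_add_mul hω ha
  have h3 : ‖1 + ω * a‖ ^ (-(d / 2 : ℝ)) ≤ 1 :=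
    Real.rpow_le_one_of_one_le_of_nonpos h2 (by simp; positivity)
  refine (mul_le_of_le_one_left (Real.exp_pos _).le h3).trans (Real.exp_le_exp.2 ?_)
  have h4 := sq_div_le_re_mul_div_one_add h1 hω ha
  have h5 : a ^ 2 / 4 ≤ a ^ 2 / (1 + a) ^ 2 := by
    gcongr
    nlinarith
  nlinarith [sq_nonneg x]

lemma norm_dampedHeat_le_of_one_le (h1 : ‖ω‖ = 1) (hω : 0 ≤ ω.re) (ha : 1 ≤ a) (d : ℕ) (x : ℝ) :
    ‖dampedHeat d ω x a‖ ≤ a ^ (-(d / 2 : ℝ)) * Real.exp (-(x ^ 2 / 4)) := by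
  rw [norm_dampedHeat]
  have h2 := le_norm_one_add_mul h1 hω (by linarith : 0 ≤ a)
  have h4 := sq_div_le_re_mul_div_one_add h1 hω (by linarith : 0 ≤ a)
  have h5 : 1 / 4 ≤ a ^ 2 / (1 + a) ^ 2 := by
    rw [div_le_div_iff₀ (by norm_num) (by positivity)]
    nlinarith
  gcongr ?_ * Real.exp ?_
  · exact Real.rpow_le_rpow_of_nonpos (by linarith) h2 (by simp; positivity)
  · nlinarith [sq_nonneg x]

lemma norm_dampedHeat_le_one (h1 : ‖ω‖ = 1) (hω : 0 ≤ ω.re) (ha : 0 ≤ a) (d : ℕ) (x : ℝ) :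
    ‖dampedHeat d ω x a‖ ≤ 1 := by
  rw [norm_dampedHeat]
  have h2 := one_le_norm_one_add_mul hω ha
  have h3 : ‖1 + ω * a‖ ^ (-(d / 2 : ℝ)) ≤ 1 :=
    Real.rpow_le_one_of_one_le_of_nonpos h2 (by simp; positivity)
  refine mul_le_one₀ h3 (Real.exp_pos _).le (Real.exp_le_one_iff.2 ?_)
  have h4 := sq_div_le_re_mul_div_one_add h1 hω ha
  have h5 : 0 ≤ a ^ 2 / (1 + a) ^ 2 := by positivity
  nlinarith [mul_nonneg (sq_nonneg x) (h5.trans h4)]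

lemma hasDerivAt_dampedHeat (hω : 0 ≤ ω.re) (ha : 0 ≤ a) (d : ℕ) (x : ℝ) :
    HasDerivAt (dampedHeat d ω x) (dampedHeat d ω x a *
      (-(x : ℂ) ^ 2 * (ω / (1 + ω * a) ^ 2) - d / 2 * (ω / (1 + ω * a)))) a := by
  have hz := one_add_mul_ne_zero hω ha
  have h0 : HasDerivAt (fun a : ℝ => 1 + ω * (a : ℂ)) ω a := by
    simpa using ((hasDerivAt_id a).ofReal_comp.const_mul ω).const_add 1
  have h1 : HasDerivAt (fun a : ℝ => (1 + ω * (a : ℂ)) ^ (((-(d / 2 : ℝ)) : ℝ) : ℂ))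
      ((((-(d / 2 : ℝ)) : ℝ) : ℂ) * (1 + ω * a) ^ ((((-(d / 2 : ℝ)) : ℝ) : ℂ) - 1) * ω) a := by
    have hs : (1 + ω * (a : ℂ)) ∈ slitPlane := by
      have := one_le_re_one_add_mul hω ha
      exact Or.inl (by linarith)
    have h4 := ((hasDerivAt_id (1 + ω * (a : ℂ))).cpow_const (c := (((-(d / 2 : ℝ)) : ℝ) : ℂ))
      hs).comp a h0
    exact h4.congr_deriv (by simp)
  have h2 : HasDerivAt (fun a : ℝ => cexp (-(x : ℂ) ^ 2 * (ω * a / (1 + ω * a))))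
      (cexp (-(x : ℂ) ^ 2 * (ω * a / (1 + ω * a))) * (-(x : ℂ) ^ 2 *
        ((ω * (1 + ω * a) - ω * a * ω) / (1 + ω * a) ^ 2))) a := by
    have h3 : HasDerivAt (fun a : ℝ => ω * (a : ℂ)) ω a := by
      simpa using ((hasDerivAt_id a).ofReal_comp.const_mul ω)
    exact ((h3.div h0 hz).const_mul _).cexp
  refine (h1.mul h2).congr_deriv ?_
  rw [dampedHeat, cpow_sub _ _ hz, cpow_one]
  push_cast
  field_simp
  ring

lemma continuousOn_dampedHeat (hω : 0 ≤ ω.re) (d : ℕ) (x : ℝ) :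
    ContinuousOn (dampedHeat d ω x) (Ici 0) := fun _ ha =>
  (hasDerivAt_dampedHeat hω ha d x).continuousAt.continuousWithinAt

variable {κ : ℂ}

lemma norm_exp_mul_ofReal_le (hκ : κ.re ≤ 0) (ha : 0 ≤ a) : ‖cexp (κ * a)‖ ≤ 1 := by
  rw [norm_exp, re_mul_ofReal]
  exact Real.exp_le_one_iff.2 (by nlinarith)

lemma integrableOn_exp_mul_dampedHeat (h1 : ‖ω‖ = 1) (hω : 0 ≤ ω.re) (hκ : κ.re < 0) (d : ℕ)
    (x : ℝ) {c : ℝ} (hc : 0 ≤ c) :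
    IntegrableOn (fun a : ℝ => cexp (κ * a) * dampedHeat d ω x a) (Ioi c) := by
  have h := (integrableOn_exp_mul_Ioi hκ c)
  refine h.mono' ?_ ?_
  · refine ContinuousOn.aestronglyMeasurable (ContinuousOn.mul (by fun_prop) ?_) measurableSet_Ioi
    exact (continuousOn_dampedHeat hω d x).mono fun a ha => hc.trans (le_of_lt ha)
  · filter_upwards [ae_restrict_mem measurableSet_Ioi] with a ha
    rw [norm_mul, norm_exp, re_mul_ofReal]
    exact mul_le_of_le_one_right (Real.exp_pos _).le
      (norm_dampedHeat_le_one h1 hω (hc.trans (le_of_lt ha)) d x)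

lemma norm_head_le_one (h1 : ‖ω‖ = 1) (hω : 0 ≤ ω.re) (hκ : κ.re ≤ 0) (d : ℕ) (x : ℝ) :
    ‖∫ a in (0 : ℝ)..1, cexp (κ * a) * dampedHeat d ω x a‖ ≤ 1 := by
  have h := intervalIntegral.norm_integral_le_of_norm_le_const (a := (0 : ℝ)) (b := 1) (C := 1)
    (f := fun a : ℝ => cexp (κ * a) * dampedHeat d ω x a) fun a ha => ?_
  · simpa using h
  · rw [uIoc_of_le zero_le_one] at ha
    rw [norm_mul]
    exact mul_le_one₀ (norm_exp_mul_ofReal_le hκ ha.1.le) (norm_nonneg _)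
      (norm_dampedHeat_le_one h1 hω ha.1.le d x)

lemma norm_exp_mul_dampedHeat_le (h1 : ‖ω‖ = 1) (hω : 0 ≤ ω.re) (hκ : κ.re ≤ 0) (ha : 0 ≤ a)
    (ha1 : a ≤ 1) (d : ℕ) (x : ℝ) :
    ‖cexp (κ * a) * dampedHeat d ω x a‖ ≤ Real.exp (-(x ^ 2 / 4) * a ^ 2) := by
  rw [norm_mul]
  exact (mul_le_of_le_one_left (norm_nonneg _) (norm_exp_mul_ofReal_le hκ ha)).trans
    (norm_dampedHeat_le_of_le_one h1 hω ha ha1 d x)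

/-- For `a ≤ 1` the integrand is dominated by a Gaussian in `a` of width of order `1/x`. -/
lemma norm_head_le_div (h1 : ‖ω‖ = 1) (hω : 0 ≤ ω.re) (hκ : κ.re ≤ 0) (d : ℕ) {x : ℝ}
    (hx : 0 < x) : ‖∫ a in (0 : ℝ)..1, cexp (κ * a) * dampedHeat d ω x a‖ ≤ 2 / x := by
  have hb : 0 < x ^ 2 / 4 := by positivity
  have hg : IntegrableOn (fun a : ℝ => Real.exp (-(x ^ 2 / 4) * a ^ 2)) (Ioi 0) :=
    (integrable_exp_neg_mul_sq hb).integrableOn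
  calc _ ≤ ∫ a in (0 : ℝ)..1, Real.exp (-(x ^ 2 / 4) * a ^ 2) := by
        refine intervalIntegral.norm_integral_le_of_norm_le zero_le_one ?_ ?_
        · filter_upwards with a ha
          exact norm_exp_mul_dampedHeat_le h1 hω hκ ha.1.le ha.2 d x
        · exact (by fun_prop : Continuous fun a : ℝ =>
            Real.exp (-(x ^ 2 / 4) * a ^ 2)).intervalIntegrable _ _
    _ ≤ ∫ a in Ioi (0 : ℝ), Real.exp (-(x ^ 2 / 4) * a ^ 2) := by
        rw [intervalIntegral.integral_of_le zero_le_one]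
        exact setIntegral_mono_set hg (Filter.Eventually.of_forall fun a => (Real.exp_pos _).le)
          (Filter.Eventually.of_forall fun a ha => ha.1)
    _ = Real.sqrt (Real.pi / (x ^ 2 / 4)) / 2 := integral_gaussian_Ioi _
    _ ≤ 2 / x := by
        rw [div_le_iff₀ (by norm_num : (0 : ℝ) < 2)]
        refine Real.sqrt_le_iff.2 ⟨by positivity, ?_⟩
        rw [div_mul_eq_mul_div, div_pow, div_le_div_iff₀ hb (by positivity)]
        nlinarith [Real.pi_le_four, sq_nonneg x]

/-- Integration by parts in time. Without damping the integrand would be an exact exponential with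
rate `ω(l² - x²)`; damping perturbs the rate by `O(x² a) + O(d)`, and the Gaussian bound on the
amplitude makes `x² a` integrable uniformly in `x`. -/
lemma norm_sq_sub_mul_head_le (h1 : ‖ω‖ = 1) (hω : 0 ≤ ω.re) {l : ℂ} (hκ : (l ^ 2 * ω).re ≤ 0)
    (d : ℕ) (x : ℝ) :
    ‖(x : ℂ) ^ 2 - l ^ 2‖ * ‖∫ a in (0 : ℝ)..1, cexp (l ^ 2 * ω * a) * dampedHeat d ω x a‖ ≤
      8 + d := by
  set Φ : ℝ → ℂ := fun a => cexp (l ^ 2 * ω * a) * dampedHeat d ω x a with hΦ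
  have hd : ∀ a ∈ uIcc (0 : ℝ) 1, HasDerivAt Φ (Φ a * (l ^ 2 * ω +
      (-(x : ℂ) ^ 2 * (ω / (1 + ω * a) ^ 2) - d / 2 * (ω / (1 + ω * a))))) a := by
    intro a ha
    rw [uIcc_of_le zero_le_one] at ha
    have h2 : HasDerivAt (fun a : ℝ => cexp (l ^ 2 * ω * a)) (cexp (l ^ 2 * ω * a) *
        (l ^ 2 * ω)) a := by
      have h3 : HasDerivAt (fun a : ℝ => l ^ 2 * ω * (a : ℂ)) (l ^ 2 * ω) a := by
        simpa using ((hasDerivAt_id a).ofReal_comp.const_mul (l ^ 2 * ω))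
      exact h3.cexp
    refine (h2.mul (hasDerivAt_dampedHeat hω ha.1 d x)).congr_deriv ?_
    simp only [hΦ]
    ring
  have hcΦ : ContinuousOn Φ (uIcc 0 1) := fun a ha => (hd a ha).continuousAt.continuousWithinAt
  have hz : ∀ a ∈ uIcc (0 : ℝ) 1, (1 + ω * (a : ℂ)) ≠ 0 := fun a ha => by
    rw [uIcc_of_le zero_le_one] at ha
    exact one_add_mul_ne_zero hω ha.1
  have hq2 : ContinuousOn (fun a : ℝ => ω / (1 + ω * (a : ℂ)) ^ 2) (uIcc 0 1) :=
    ContinuousOn.div (by fun_prop) (by fun_prop) fun a ha => pow_ne_zero 2 (hz a ha)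
  have hR : ContinuousOn (fun a : ℝ => Φ a * ((x : ℂ) ^ 2 * (ω - ω / (1 + ω * a) ^ 2) -
      d / 2 * (ω / (1 + ω * a)))) (uIcc 0 1) := hcΦ.mul (by fun_prop)
  have hR' : ContinuousOn (fun a : ℝ => Φ a * (l ^ 2 * ω +
      (-(x : ℂ) ^ 2 * (ω / (1 + ω * a) ^ 2) - d / 2 * (ω / (1 + ω * a))))) (uIcc 0 1) :=
    hcΦ.mul (by fun_prop)
  have hFTC := intervalIntegral.integral_eq_sub_of_hasDerivAt hd hR'.intervalIntegrable
  -- Adding the derivative of `Φ` to `ω(x² - l²)Φ` cancels the leading terms and leaves only the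
  -- perturbation of the rate.
  have hkey : ω * ((x : ℂ) ^ 2 - l ^ 2) * ∫ a in (0 : ℝ)..1, Φ a =
      (∫ a in (0 : ℝ)..1, Φ a * ((x : ℂ) ^ 2 * (ω - ω / (1 + ω * a) ^ 2) -
        d / 2 * (ω / (1 + ω * a)))) - (Φ 1 - Φ 0) := by
    rw [← hFTC, ← intervalIntegral.integral_const_mul, ← intervalIntegral.integral_sub
      hR.intervalIntegrable hR'.intervalIntegrable]
    congr with a
    ring
  have hb : ∀ a ∈ Ioc (0 : ℝ) 1, ‖Φ a * ((x : ℂ) ^ 2 * (ω - ω / (1 + ω * a) ^ 2) -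
      d / 2 * (ω / (1 + ω * a)))‖ ≤
      3 * x ^ 2 * a * Real.exp (-(x ^ 2 / 4) * a ^ 2) + d / 2 := by
    intro a ha
    have hz0 := one_add_mul_ne_zero hω ha.1.le
    have hz1 := one_le_norm_one_add_mul hω ha.1.le
    have hΦa := norm_exp_mul_dampedHeat_le h1 hω hκ ha.1.le ha.2 d x
    have hΦ1 : ‖Φ a‖ ≤ 1 := hΦa.trans (Real.exp_le_one_iff.2 (by nlinarith [mul_nonneg (sq_nonneg x) (sq_nonneg a)]))
    have e1 : ω - ω / (1 + ω * a) ^ 2 = ω * (ω * a * (2 + ω * a)) / (1 + ω * a) ^ 2 := by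
      field_simp
      ring
    have n1 : ‖ω - ω / (1 + ω * a) ^ 2‖ ≤ 3 * a := by
      rw [e1, norm_div, norm_mul, norm_mul, norm_mul, h1, norm_pow, norm_real,
        Real.norm_of_nonneg ha.1.le]
      have n3 : ‖(2 + ω * a : ℂ)‖ ≤ 3 := by
        refine (norm_add_le _ _).trans ?_
        rw [norm_mul, h1, norm_real, Real.norm_of_nonneg ha.1.le]
        norm_num
        linarith [ha.2]
      rw [div_le_iff₀ (by positivity)]
      have : 1 ≤ ‖1 + ω * a‖ ^ 2 := one_le_pow₀ hz1
      calc 1 * (1 * a * ‖2 + ω * a‖) ≤ 3 * a * 1 := by nlinarith [ha.1]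
        _ ≤ _ := by gcongr; linarith [ha.1]
    have n2 : ‖ω / (1 + ω * a)‖ ≤ 1 := by
      rw [norm_div, h1]
      exact div_le_one_of_le₀ hz1 (norm_nonneg _)
    calc _ = ‖Φ a‖ * ‖(x : ℂ) ^ 2 * (ω - ω / (1 + ω * a) ^ 2) - d / 2 * (ω / (1 + ω * a))‖ :=
          norm_mul _ _
      _ ≤ ‖Φ a‖ * (x ^ 2 * (3 * a) + d / 2 * 1) := by
          gcongr
          refine (norm_sub_le _ _).trans ?_
          rw [norm_mul, norm_mul, norm_pow, norm_real, Real.norm_eq_abs, sq_abs, norm_div (d : ℂ),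
            Complex.norm_natCast, RCLike.norm_ofNat]
          gcongr
      _ = ‖Φ a‖ * (x ^ 2 * (3 * a)) + ‖Φ a‖ * (d / 2) := by ring
      _ ≤ Real.exp (-(x ^ 2 / 4) * a ^ 2) * (x ^ 2 * (3 * a)) + 1 * (d / 2) := by
          have := ha.1
          gcongr
      _ = _ := by ring
  have hint : ∫ a in (0 : ℝ)..1, (3 * x ^ 2 * a * Real.exp (-(x ^ 2 / 4) * a ^ 2) + (d : ℝ) / 2) ≤
      6 + (d : ℝ) / 2 := by
    -- The factor `a` makes the majorant explicitly integrable; the increment of this primitive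
    -- gives the bound `6 + d/2`. The two endpoint values of `Φ` add at most `2`.
    have hderiv : ∀ a ∈ uIcc (0 : ℝ) 1, HasDerivAt
        (fun a : ℝ => -6 * Real.exp (-(x ^ 2 / 4) * a ^ 2) + d / 2 * a)
        (3 * x ^ 2 * a * Real.exp (-(x ^ 2 / 4) * a ^ 2) + d / 2) a := by
      intro a _
      have h3 := ((((hasDerivAt_pow 2 a).const_mul (-(x ^ 2 / 4))).exp).const_mul (-6)).add
        ((hasDerivAt_id a).const_mul ((d : ℝ) / 2))
      refine h3.congr_deriv ?_
      simp
      ring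
    rw [intervalIntegral.integral_eq_sub_of_hasDerivAt hderiv
      ((by fun_prop : Continuous fun a : ℝ => 3 * x ^ 2 * a *
        Real.exp (-(x ^ 2 / 4) * a ^ 2) + (d : ℝ) / 2).intervalIntegrable _ _)]
    have := Real.exp_pos (-(x ^ 2 / 4))
    simp
    linarith
  have hbound : ∀ a, 0 ≤ a → a ≤ 1 → ‖Φ a‖ ≤ 1 := fun a ha ha1 =>
    (norm_exp_mul_dampedHeat_le h1 hω hκ ha ha1 d x).trans
      (Real.exp_le_one_iff.2 (by nlinarith [mul_nonneg (sq_nonneg x) (sq_nonneg a)]))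
  calc _ = ‖ω * ((x : ℂ) ^ 2 - l ^ 2) * ∫ a in (0 : ℝ)..1, Φ a‖ := by
        rw [norm_mul, norm_mul, h1, one_mul]
    _ ≤ (6 + (d : ℝ) / 2) + (1 + 1) := by
        rw [hkey]
        refine (norm_sub_le _ _).trans ?_
        gcongr
        · refine (intervalIntegral.norm_integral_le_of_norm_le zero_le_one
            (Filter.Eventually.of_forall fun a ha => hb a ha) ?_).trans hint
          exact (by fun_prop : Continuous fun a : ℝ => 3 * x ^ 2 * a *
            Real.exp (-(x ^ 2 / 4) * a ^ 2) + (d : ℝ) / 2).intervalIntegrable _ _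
        · exact (norm_sub_le _ _).trans (add_le_add (hbound 1 zero_le_one le_rfl)
            (hbound 0 le_rfl zero_le_one))
    _ ≤ 8 + d := by
        have : (0 : ℝ) ≤ d := Nat.cast_nonneg d
        linarith

lemma integral_rpow_neg_three_halves : ∫ a in Ioi (1 : ℝ), a ^ (-(3 / 2) : ℝ) = 2 := by
  rw [integral_Ioi_rpow_of_lt (by norm_num) one_pos]
  norm_num

lemma integrableOn_rpow_neg_three_halves :
    IntegrableOn (fun a : ℝ => a ^ (-(3 / 2) : ℝ)) (Ioi 1) :=
  integrableOn_Ioi_rpow_of_lt (by norm_num) one_pos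

/-- Large times contribute `a^{-d/2}`, at most `a^{-3/2}` when `d ≥ 3`, so no decay from `κ` is
needed and low energies are allowed. -/
lemma norm_tail_le (h1 : ‖ω‖ = 1) (hω : 0 ≤ ω.re) (hκ : κ.re ≤ 0) {d : ℕ} (hd : 3 ≤ d) (x : ℝ) :
    ‖∫ a in Ioi (1 : ℝ), cexp (κ * a) * dampedHeat d ω x a‖ ≤ 2 * Real.exp (-(x ^ 2 / 4)) := by
  rw [← integral_rpow_neg_three_halves, ← integral_mul_const]
  refine norm_integral_le_of_norm_le (integrableOn_rpow_neg_three_halves.mul_const _) ?_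
  filter_upwards [ae_restrict_mem measurableSet_Ioi] with a ha
  have ha : 1 < a := ha
  rw [norm_mul]
  refine (mul_le_of_le_one_left (norm_nonneg _) (norm_exp_mul_ofReal_le hκ (by linarith))).trans ?_
  refine (norm_dampedHeat_le_of_one_le h1 hω ha.le d x).trans ?_
  gcongr
  · exact ha.le
  · have : (3 : ℝ) ≤ d := by exact_mod_cast hd
    linarith

/-- Integrating `exp(κa)` by parts moves the derivative to the amplitude, which gains a factor
`1/a`. The power `a^{-d/2-1}` is then integrable in every dimension `d ≥ 1`, at the price of the
factor `‖κ‖`. -/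
lemma norm_mul_tail_le (h1 : ‖ω‖ = 1) (hω : 0 ≤ ω.re) (hκ : κ.re < 0) {d : ℕ} (hd : 1 ≤ d)
    (x : ℝ) :
    ‖κ‖ * ‖∫ a in Ioi (1 : ℝ), cexp (κ * a) * dampedHeat d ω x a‖ ≤
      (1 + 2 * x ^ 2 + d) * Real.exp (-(x ^ 2 / 4)) := by
  set D : ℝ → ℂ := fun a => -(x : ℂ) ^ 2 * (ω / (1 + ω * a) ^ 2) - d / 2 * (ω / (1 + ω * a)) with hD
  have hd' : (1 : ℝ) ≤ d := by exact_mod_cast hd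
  have hbD : ∀ a ∈ Ioi (1 : ℝ), ‖cexp (κ * a) * (dampedHeat d ω x a * D a)‖ ≤
      a ^ (-(3 / 2) : ℝ) * ((x ^ 2 + d / 2) * Real.exp (-(x ^ 2 / 4))) := by
    intro a ha
    have ha : 1 < a := ha
    have ha0 : 0 < a := by linarith
    have hz2 := le_norm_one_add_mul h1 hω ha0.le
    have n1 : ‖ω / (1 + ω * a)‖ ≤ a⁻¹ := by
      rw [norm_div, h1, one_div]
      gcongr
    have n2 : ‖ω / (1 + ω * a) ^ 2‖ ≤ a⁻¹ := by
      rw [norm_div, h1, one_div, norm_pow]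
      gcongr
      nlinarith
    have n3 : ‖D a‖ ≤ (x ^ 2 + d / 2) * a⁻¹ := by
      refine (norm_sub_le _ _).trans ?_
      rw [norm_mul, norm_mul, norm_neg, norm_pow, norm_real, Real.norm_eq_abs, sq_abs, norm_div (d : ℂ),
        Complex.norm_natCast, RCLike.norm_ofNat, add_mul]
      gcongr
    rw [norm_mul, norm_mul]
    calc _ ≤ 1 * ((a ^ (-(d / 2 : ℝ)) * Real.exp (-(x ^ 2 / 4))) * ((x ^ 2 + d / 2) * a⁻¹)) := by
          gcongr
          · exact norm_exp_mul_ofReal_le hκ.le ha0.le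
          · exact norm_dampedHeat_le_of_one_le h1 hω ha.le d x
      _ = a ^ (-(d / 2 : ℝ) - 1) * ((x ^ 2 + d / 2) * Real.exp (-(x ^ 2 / 4))) := by
          rw [Real.rpow_sub_one ha0.ne']
          ring
      _ ≤ _ := by
          gcongr
          · exact ha.le
          · linarith
  have hIb : IntegrableOn (fun a : ℝ => a ^ (-(3 / 2) : ℝ) *
      ((x ^ 2 + d / 2) * Real.exp (-(x ^ 2 / 4)))) (Ioi 1) :=
    integrableOn_rpow_neg_three_halves.mul_const _
  have hcD : ContinuousOn (fun a : ℝ => cexp (κ * a) * (dampedHeat d ω x a * D a)) (Ioi 1) := by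
    have hz : ∀ a ∈ Ioi (1 : ℝ), (1 + ω * (a : ℂ)) ≠ 0 := fun a ha =>
      one_add_mul_ne_zero hω (zero_le_one.trans (le_of_lt ha))
    have hq : ContinuousOn (fun a : ℝ => ω / (1 + ω * (a : ℂ))) (Ioi 1) :=
      ContinuousOn.div (by fun_prop) (by fun_prop) hz
    have hq2 : ContinuousOn (fun a : ℝ => ω / (1 + ω * (a : ℂ)) ^ 2) (Ioi 1) :=
      ContinuousOn.div (by fun_prop) (by fun_prop) fun a ha => pow_ne_zero 2 (hz a ha)
    have hc := (continuousOn_dampedHeat hω d x).mono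
      (fun a (ha : 1 < a) => (zero_le_one.trans ha.le : (0 : ℝ) ≤ a))
    exact ContinuousOn.mul (by fun_prop) (hc.mul (by fun_prop))
  have hID : IntegrableOn (fun a : ℝ => cexp (κ * a) * (dampedHeat d ω x a * D a)) (Ioi 1) := by
    refine hIb.mono' (hcD.aestronglyMeasurable measurableSet_Ioi) ?_
    filter_upwards [ae_restrict_mem measurableSet_Ioi] with a ha using hbD a ha
  have hI := integrableOn_exp_mul_dampedHeat h1 hω hκ d x zero_le_one
  have hder : ∀ a ∈ Ici (1 : ℝ), HasDerivAt (fun a : ℝ => cexp (κ * a) * dampedHeat d ω x a)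
      (κ * (cexp (κ * a) * dampedHeat d ω x a) + cexp (κ * a) * (dampedHeat d ω x a * D a)) a := by
    intro a ha
    have h2 : HasDerivAt (fun a : ℝ => cexp (κ * a)) (cexp (κ * a) * κ) a := by
      have h3 : HasDerivAt (fun a : ℝ => κ * (a : ℂ)) κ a := by
        simpa using ((hasDerivAt_id a).ofReal_comp.const_mul κ)
      exact h3.cexp
    refine (h2.mul (hasDerivAt_dampedHeat hω (zero_le_one.trans ha) d x)).congr_deriv ?_
    simp only [hD]
    ring
  have hlim : Filter.Tendsto (fun a : ℝ => cexp (κ * a) * dampedHeat d ω x a) Filter.atTop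
      (𝓝 0) := by
    have h3 : Filter.Tendsto (fun a : ℝ => Real.exp (κ.re * a)) Filter.atTop (𝓝 0) :=
      Real.tendsto_exp_atBot.comp (Filter.tendsto_id.const_mul_atTop_of_neg hκ)
    refine squeeze_zero_norm' ?_ h3
    filter_upwards [Filter.eventually_ge_atTop 0] with a ha
    rw [norm_mul, norm_exp, re_mul_ofReal]
    exact mul_le_of_le_one_right (Real.exp_pos _).le (norm_dampedHeat_le_one h1 hω ha d x)
  have hF := integral_Ioi_of_hasDerivAt_of_tendsto'
    (fun a ha => hder a ha) ((hI.const_mul κ).add hID) hlim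
  rw [integral_add (hI.const_mul κ) hID, integral_const_mul] at hF
  rw [← norm_mul, eq_sub_of_add_eq hF, zero_sub]
  refine (norm_sub_le _ _).trans ?_
  rw [norm_neg]
  have hE : ‖cexp (κ * (1 : ℝ)) * dampedHeat d ω x 1‖ ≤ Real.exp (-(x ^ 2 / 4)) := by
    rw [norm_mul]
    refine (mul_le_of_le_one_left (norm_nonneg _)
      (norm_exp_mul_ofReal_le hκ.le zero_le_one)).trans ?_
    simpa using norm_dampedHeat_le_of_one_le h1 hω le_rfl d x
  have hT : ‖∫ a in Ioi (1 : ℝ), cexp (κ * a) * (dampedHeat d ω x a * D a)‖ ≤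
      2 * ((x ^ 2 + d / 2) * Real.exp (-(x ^ 2 / 4))) := by
    have h2 := integral_mul_const (μ := volume.restrict (Ioi (1 : ℝ)))
      ((x ^ 2 + d / 2) * Real.exp (-(x ^ 2 / 4))) fun a : ℝ => a ^ (-(3 / 2) : ℝ)
    rw [integral_rpow_neg_three_halves] at h2
    rw [← h2]
    refine norm_integral_le_of_norm_le hIb ?_
    filter_upwards [ae_restrict_mem measurableSet_Ioi] with a ha using hbD a ha
  linarith

end DampedHeat

/-! ### Pointwise and integrated bounds of the damped symbol. -/

/-- The direction `i|λ|/λ` of the ray of complex times. -/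
noncomputable def rayDir (l : ℂ) : ℂ := I * ‖l‖ / l

section RayDir

variable {l : ℂ} (hl : 0 < l.im)

include hl

lemma norm_pos_of_im_pos : 0 < ‖l‖ := by
  rw [norm_pos_iff]
  rintro rfl
  simp at hl

lemma norm_rayDir : ‖rayDir l‖ = 1 := by
  have h := norm_pos_of_im_pos hl
  simp [rayDir, h.ne']

lemma rayDir_re : (rayDir l).re = l.im / ‖l‖ := by
  rw [rayDir, div_re, ← Complex.sq_norm]
  simp
  field_simp

lemma rayDir_re_pos : 0 < (rayDir l).re := by
  rw [rayDir_re hl]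
  exact div_pos hl (norm_pos_of_im_pos hl)

omit hl in
lemma sq_mul_rayDir : l ^ 2 * rayDir l = I * l * ‖l‖ := by
  rw [rayDir]
  field_simp

omit hl in
lemma sq_mul_rayDir_re : (l ^ 2 * rayDir l).re = -(l.im * ‖l‖) := by
  rw [sq_mul_rayDir, re_mul_ofReal]
  simp

lemma sq_mul_rayDir_re_neg : (l ^ 2 * rayDir l).re < 0 := by
  rw [sq_mul_rayDir_re]
  have := mul_pos hl (norm_pos_of_im_pos hl)
  linarith

lemma norm_sq_mul_rayDir : ‖l ^ 2 * rayDir l‖ = ‖l‖ ^ 2 := by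
  rw [norm_mul, norm_rayDir hl, norm_pow, mul_one]

end RayDir

/-- The Fourier multiplier, at frequency `x`, of the Gaussian-damped free resolvent kernel. -/
noncomputable def dampedSymbol (d : ℕ) (l : ℂ) (x : ℝ) : ℂ :=
  ∫ a in Ioi (0 : ℝ), rayDir l * (cexp (l ^ 2 * rayDir l * a) * dampedHeat d (rayDir l) x a)

/-- A majorant of the damped symbol. -/
noncomputable def symbolWeight (L μ x : ℝ) : ℝ :=
  (if x ≤ 2 * L then 1 / ((1 + L) * (1 + μ)) else 0) + 1 / ((1 + L) ^ 2 + x ^ 2)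

lemma symbolWeight_nonneg {L μ : ℝ} (hL : 0 ≤ L) (hμ : 0 ≤ μ) (x : ℝ) :
    0 ≤ symbolWeight L μ x := by
  rw [symbolWeight]
  split_ifs <;> positivity

lemma symbolWeight_abs_anti {L μ s x : ℝ} (hL : 0 ≤ L) (hμ : 0 ≤ μ) (h : |s| ≤ x) :
    symbolWeight L μ x ≤ symbolWeight L μ |s| := by
  rw [symbolWeight, symbolWeight]
  gcongr ?_ + 1 / (_ + ?_)
  · split_ifs with h1 h2
    · exact le_rfl
    · exact absurd (h.trans h1) h2
    · positivity
    · exact le_rfl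
  · gcongr

/-- Factor into `x - l` and `x + l`: both are at least `|Im l|` in modulus, and by the parallelogram
identity the larger is at least `‖l‖`. -/
lemma mul_im_le_norm_sq_sub (l : ℂ) {x : ℝ} : ‖l‖ * |l.im| ≤ ‖(x : ℂ) ^ 2 - l ^ 2‖ := by
  have h1 : |l.im| ≤ ‖(x : ℂ) - l‖ := by simpa using abs_im_le_norm ((x : ℂ) - l)
  have h2 : |l.im| ≤ ‖(x : ℂ) + l‖ := by simpa using abs_im_le_norm ((x : ℂ) + l)
  have h3 : ‖(x : ℂ) - l‖ ^ 2 + ‖(x : ℂ) + l‖ ^ 2 = 2 * (x ^ 2 + ‖l‖ ^ 2) := by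
    simp only [Complex.sq_norm, normSq_apply]
    simp
    ring
  rw [sq_sub_sq, norm_mul]
  rcases le_total ‖(x : ℂ) - l‖ ‖(x : ℂ) + l‖ with h | h
  · have : ‖l‖ ≤ ‖(x : ℂ) + l‖ := by
      refine (sq_le_sq₀ (norm_nonneg _) (norm_nonneg _)).1 ?_
      have : ‖(x : ℂ) - l‖ ^ 2 ≤ ‖(x : ℂ) + l‖ ^ 2 := by gcongr
      nlinarith [sq_nonneg x]
    gcongr
  · have : ‖l‖ ≤ ‖(x : ℂ) - l‖ := by
      refine (sq_le_sq₀ (norm_nonneg _) (norm_nonneg _)).1 ?_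
      have : ‖(x : ℂ) + l‖ ^ 2 ≤ ‖(x : ℂ) - l‖ ^ 2 := by gcongr
      nlinarith [sq_nonneg x]
    rw [mul_comm]
    gcongr

/-- Interpolates three bounds on the head: `1`, `2/x`, and `(8+d)/|x² - l²|`. The second handles the
resonant zone `x ~ ‖l‖`, the third everything away from it and the gain in `Im l`. -/
lemma head_le_symbolWeight {d : ℕ} {l : ℂ} (hl : 0 < l.im) {x : ℝ} (hx : 0 ≤ x) :
    ‖∫ a in (0 : ℝ)..1, cexp (l ^ 2 * rayDir l * a) * dampedHeat d (rayDir l) x a‖ ≤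
      (31 + 5 * d) * symbolWeight ‖l‖ l.im x := by
  have h1 := norm_rayDir hl
  have hω := (rayDir_re_pos hl).le
  have hκ := (sq_mul_rayDir_re_neg hl).le
  have hL := norm_pos_of_im_pos hl
  have b1 := norm_head_le_one h1 hω hκ d x
  have b2 := norm_sq_sub_mul_head_le h1 hω hκ d x
  have b3 := fun h => norm_head_le_div (x := x) h1 hω hκ d h
  set m := ‖∫ a in (0 : ℝ)..1, cexp (l ^ 2 * rayDir l * a) * dampedHeat d (rayDir l) x a‖
  have hm : 0 ≤ m := norm_nonneg _
  set L := ‖l‖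
  have hx2 : ‖(x : ℂ) ^ 2‖ = x ^ 2 := by rw [norm_pow, norm_real, Real.norm_eq_abs, sq_abs]
  have hl2 : ‖l ^ 2‖ = L ^ 2 := norm_pow _ _
  rw [symbolWeight]
  split_ifs with hxL
  · have c1 : m * L ≤ 11 + 2 * d := by
      rcases le_total x (L / 2) with h | h
      · have h2 : L ^ 2 - x ^ 2 ≤ ‖(x : ℂ) ^ 2 - l ^ 2‖ := by
          have := norm_sub_norm_le (l ^ 2) ((x : ℂ) ^ 2)
          rw [norm_sub_rev] at this
          linarith
        have h3 : x ^ 2 ≤ (L / 2) ^ 2 := by gcongr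
        have h4 : 3 / 4 * L ^ 2 * m ≤ 8 + d :=
          (mul_le_mul_of_nonneg_right (by nlinarith) hm).trans b2
        nlinarith [mul_nonneg hm (sq_nonneg (L - 1))]
      · have hx0 : 0 < x := by linarith
        have h2 := b3 hx0
        rw [le_div_iff₀ hx0] at h2
        nlinarith
    have c2 : m * (L * l.im) ≤ 8 + d := by
      have h2 := mul_im_le_norm_sq_sub l (x := x)
      rw [abs_of_pos hl] at h2
      calc m * (L * l.im) ≤ m * ‖(x : ℂ) ^ 2 - l ^ 2‖ := by gcongr
        _ ≤ _ := by linarith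
    have c3 : m * l.im ≤ m * L := by
      gcongr
      exact (le_abs_self _).trans (abs_im_le_norm l)
    -- Expanding `m(1+L)(1+Im l)` gives at most `1 + 2(11 + 2d) + (8 + d)`.
    have c4 : m ≤ (31 + 5 * d) * (1 / ((1 + L) * (1 + l.im))) := by
      rw [mul_one_div, le_div_iff₀ (by positivity)]
      nlinarith
    have c5 : 0 ≤ 1 / ((1 + L) ^ 2 + x ^ 2) := by positivity
    nlinarith
  · rw [zero_add, mul_one_div, le_div_iff₀ (by positivity)]
    have h2 : x ^ 2 - L ^ 2 ≤ ‖(x : ℂ) ^ 2 - l ^ 2‖ := by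
      have := norm_sub_norm_le ((x : ℂ) ^ 2) (l ^ 2)
      linarith
    have h3 : (2 * L) ^ 2 ≤ x ^ 2 := by gcongr; linarith
    nlinarith [mul_nonneg hm (sq_nonneg (L - 1)), mul_le_mul_of_nonneg_left h3 hm]

lemma one_add_sq_mul_exp_le (x : ℝ) : (1 + x ^ 2) ^ 2 * Real.exp (-(x ^ 2 / 4)) ≤ 32 := by
  have h := Real.quadratic_le_exp_of_nonneg (show 0 ≤ x ^ 2 / 4 by positivity)
  rw [Real.exp_neg, ← div_eq_mul_inv, div_le_iff₀ (Real.exp_pos _)]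
  nlinarith [sq_nonneg x, sq_nonneg (x ^ 2)]

/-- The Gaussian decay in `x` absorbs polynomial factors, so the tail fits under the second term of
the weight, provided it also decays like `1/(1+‖l‖²)`. That proviso is what depends on the dimension
or on a lower bound for `‖l‖`. -/
lemma tail_le_symbolWeight {d : ℕ} {l : ℂ} (hl : 0 < l.im) {x B : ℝ} (hB : 0 ≤ B)
    (h : ‖∫ a in Ioi (1 : ℝ), cexp (l ^ 2 * rayDir l * a) * dampedHeat d (rayDir l) x a‖ *
      (1 + ‖l‖ ^ 2) ≤ B * (1 + x ^ 2) * Real.exp (-(x ^ 2 / 4))) :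
    ‖∫ a in Ioi (1 : ℝ), cexp (l ^ 2 * rayDir l * a) * dampedHeat d (rayDir l) x a‖ ≤
      64 * B * symbolWeight ‖l‖ l.im x := by
  set m := ‖∫ a in Ioi (1 : ℝ), cexp (l ^ 2 * rayDir l * a) * dampedHeat d (rayDir l) x a‖
  have h1 : m ≤ 64 * B * (1 / ((1 + ‖l‖) ^ 2 + x ^ 2)) := by
    rw [mul_one_div, le_div_iff₀ (by positivity)]
    have h2 : (1 + ‖l‖) ^ 2 + x ^ 2 ≤ 2 * ((1 + ‖l‖ ^ 2) * (1 + x ^ 2)) := by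
      nlinarith [sq_nonneg (‖l‖ - 1), mul_nonneg (sq_nonneg ‖l‖) (sq_nonneg x), sq_nonneg x]
    calc m * ((1 + ‖l‖) ^ 2 + x ^ 2) ≤ m * (2 * ((1 + ‖l‖ ^ 2) * (1 + x ^ 2))) := by gcongr
      _ = 2 * (1 + x ^ 2) * (m * (1 + ‖l‖ ^ 2)) := by ring
      _ ≤ 2 * (1 + x ^ 2) * (B * (1 + x ^ 2) * Real.exp (-(x ^ 2 / 4))) := by gcongr
      _ = 2 * B * ((1 + x ^ 2) ^ 2 * Real.exp (-(x ^ 2 / 4))) := by ring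
      _ ≤ 2 * B * 32 := by gcongr; exact one_add_sq_mul_exp_le x
      _ = 64 * B := by ring
  refine h1.trans ?_
  rw [symbolWeight]
  gcongr
  refine le_add_of_nonneg_left ?_
  split_ifs <;> positivity

lemma norm_dampedSymbol_le {d : ℕ} {l : ℂ} (hl : 0 < l.im) {x B : ℝ} (hx : 0 ≤ x) (hB : 0 ≤ B)
    (h : ‖∫ a in Ioi (1 : ℝ), cexp (l ^ 2 * rayDir l * a) * dampedHeat d (rayDir l) x a‖ *
      (1 + ‖l‖ ^ 2) ≤ B * (1 + x ^ 2) * Real.exp (-(x ^ 2 / 4))) :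
    ‖dampedSymbol d l x‖ ≤ (31 + 5 * d + 64 * B) * symbolWeight ‖l‖ l.im x := by
  have h1 := norm_rayDir hl
  have hω := (rayDir_re_pos hl).le
  have hI := integrableOn_exp_mul_dampedHeat h1 hω (sq_mul_rayDir_re_neg hl) d x le_rfl
  rw [dampedSymbol, integral_const_mul, norm_mul, h1, one_mul,
    ← intervalIntegral.integral_interval_add_Ioi hI
      (integrableOn_exp_mul_dampedHeat h1 hω (sq_mul_rayDir_re_neg hl) d x zero_le_one), add_mul]
  exact (norm_add_le _ _).trans
    (add_le_add (head_le_symbolWeight hl hx) (tail_le_symbolWeight hl hB h))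

lemma tail_mul_norm_sq_le {d : ℕ} (hd : 1 ≤ d) {l : ℂ} (hl : 0 < l.im) (x : ℝ) :
    ‖∫ a in Ioi (1 : ℝ), cexp (l ^ 2 * rayDir l * a) * dampedHeat d (rayDir l) x a‖ * ‖l‖ ^ 2 ≤
      (2 + d) * (1 + x ^ 2) * Real.exp (-(x ^ 2 / 4)) := by
  have h := norm_mul_tail_le (norm_rayDir hl) (rayDir_re_pos hl).le (sq_mul_rayDir_re_neg hl) hd x
  rw [norm_sq_mul_rayDir hl] at h
  rw [mul_comm]
  refine h.trans ?_
  gcongr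
  nlinarith [sq_nonneg x, mul_nonneg (Nat.cast_nonneg (α := ℝ) d) (sq_nonneg x)]

/-- Uniform bound of the damped symbol in dimension at least three. -/
lemma exists_norm_dampedSymbol_le {d : ℕ} (hd : 3 ≤ d) : ∃ C : ℝ, 0 < C ∧ ∀ l : ℂ, 0 < l.im →
    ∀ x, 0 ≤ x → ‖dampedSymbol d l x‖ ≤ C * symbolWeight ‖l‖ l.im x := by
  refine ⟨31 + 5 * d + 64 * (4 + d), by positivity, fun l hl x hx => ?_⟩
  refine norm_dampedSymbol_le hl hx (by positivity) ?_
  rw [mul_add, mul_one]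
  have h1 := norm_tail_le (norm_rayDir hl) (rayDir_re_pos hl).le (sq_mul_rayDir_re_neg hl).le hd x
  have h2 := tail_mul_norm_sq_le (by linarith : 1 ≤ d) hl x
  have := mul_nonneg (sq_nonneg x) (Real.exp_pos (-(x ^ 2 / 4))).le
  linarith

/-- Uniform bound of the damped symbol away from zero energy. -/
lemma exists_norm_dampedSymbol_le_of_le {d : ℕ} (hd : 1 ≤ d) {r : ℝ} (hr : 0 < r) :
    ∃ C : ℝ, 0 < C ∧ ∀ l : ℂ, 0 < l.im → r ≤ ‖l‖ →
    ∀ x, 0 ≤ x → ‖dampedSymbol d l x‖ ≤ C * symbolWeight ‖l‖ l.im x := by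
  refine ⟨31 + 5 * d + 64 * ((1 + 1 / r ^ 2) * (2 + d)), by positivity, fun l hl hrl x hx => ?_⟩
  refine norm_dampedSymbol_le hl hx (by positivity) ?_
  have h2 := tail_mul_norm_sq_le hd hl x
  set m := ‖∫ a in Ioi (1 : ℝ), cexp (l ^ 2 * rayDir l * a) * dampedHeat d (rayDir l) x a‖
  -- Away from zero energy, `‖l‖²` controls `1 + ‖l‖²`; the constant blows up as `r → 0`.
  have h3 : 1 + ‖l‖ ^ 2 ≤ (1 + 1 / r ^ 2) * ‖l‖ ^ 2 := by
    have : 1 ≤ 1 / r ^ 2 * ‖l‖ ^ 2 := by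
      rw [one_div_mul_eq_div, one_le_div (by positivity)]
      gcongr
    linarith
  calc m * (1 + ‖l‖ ^ 2) ≤ m * ((1 + 1 / r ^ 2) * ‖l‖ ^ 2) := by gcongr
    _ = (1 + 1 / r ^ 2) * (m * ‖l‖ ^ 2) := by ring
    _ ≤ (1 + 1 / r ^ 2) * ((2 + d) * (1 + x ^ 2) * Real.exp (-(x ^ 2 / 4))) := by gcongr
    _ = _ := by ring

lemma measurable_symbolWeight (L μ : ℝ) : Measurable (symbolWeight L μ) := by
  unfold symbolWeight
  refine Measurable.add (Measurable.ite (measurableSet_le measurable_id measurable_const)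
    measurable_const measurable_const) ?_
  fun_prop

/-- The source of the decay in `Im l`: an interval of length `4L` at height `1/((1+L)(1+μ))`, plus a
Lorentzian of integral `π/(1+L)`, each at most `4/(1+μ)` because `μ ≤ L`. -/
lemma lintegral_symbolWeight_le {L μ : ℝ} (hL : 0 ≤ L) (hμ : 0 ≤ μ) (hμL : μ ≤ L) :
    ∫⁻ s : ℝ, ENNReal.ofReal (symbolWeight L μ |s|) ≤ ENNReal.ofReal (8 / (1 + μ)) := by
  have h1 : Integrable (Set.indicator (Icc (-(2 * L)) (2 * L))
      fun _ : ℝ => 1 / ((1 + L) * (1 + μ))) :=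
    (integrable_indicator_iff measurableSet_Icc).2 (integrableOn_const (by simp))
  have h2 : Integrable fun s : ℝ => ((1 + L) ^ 2)⁻¹ * (1 + ((1 + L)⁻¹ * s) ^ 2)⁻¹ :=
    (integrable_inv_one_add_sq.comp_mul_left' (by positivity)).const_mul _
  have e : ∀ s : ℝ, symbolWeight L μ |s| = Set.indicator (Icc (-(2 * L)) (2 * L))
      (fun _ : ℝ => 1 / ((1 + L) * (1 + μ))) s +
      ((1 + L) ^ 2)⁻¹ * (1 + ((1 + L)⁻¹ * s) ^ 2)⁻¹ := by
    intro s
    simp only [symbolWeight, Set.indicator_apply, mem_Icc, ← abs_le, sq_abs]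
    congr 1
    field_simp
  have h3 := h1.add h2
  rw [show (_ + _) = fun s : ℝ => symbolWeight L μ |s| from funext fun s => (e s).symm] at h3
  rw [← ofReal_integral_eq_lintegral_ofReal h3
    (Filter.Eventually.of_forall fun s => symbolWeight_nonneg hL hμ _)]
  refine ENNReal.ofReal_le_ofReal ?_
  simp only [e]
  rw [integral_add h1 h2, integral_const_mul, integral_indicator measurableSet_Icc,
    setIntegral_const, Measure.integral_comp_mul_left (fun s => (1 + s ^ 2)⁻¹),
    integral_univ_inv_one_add_sq]
  have hv : volume.real (Icc (-(2 * L)) (2 * L)) = 4 * L := by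
    rw [Real.volume_real_Icc_of_le (by linarith)]
    ring
  rw [hv, inv_inv, abs_of_nonneg (by linarith), smul_eq_mul, smul_eq_mul]
  have t1 : 4 * L * (1 / ((1 + L) * (1 + μ))) ≤ 4 / (1 + μ) := by
    rw [mul_one_div, div_le_div_iff₀ (by positivity) (by positivity)]
    nlinarith
  have t2 : ((1 + L) ^ 2)⁻¹ * ((1 + L) * Real.pi) ≤ 4 / (1 + μ) := by
    rw [inv_mul_eq_div, div_le_div_iff₀ (by positivity) (by positivity)]
    have h3 : (1 + L) * Real.pi * (1 + μ) ≤ (1 + L) * 4 * (1 + L) := by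
      gcongr
      exact Real.pi_le_four
    linarith
  calc _ ≤ 4 / (1 + μ) + 4 / (1 + μ) := add_le_add t1 t2
    _ = 8 / (1 + μ) := by ring

/-! ### Absolute convergence of the Green kernel and the weighted Fourier pairing. -/

/-- The integrand of the Green function, in the parameter `a = s/|λ|`. -/
noncomputable def greenIntegrand (d : ℕ) (l : ℂ) (r a : ℝ) : ℂ :=
  rayDir l * (cexp (l ^ 2 * rayDir l * a) * heatKernel d (rayDir l * a) r)

lemma greenFunction_eq_integral {d : ℕ} {l : ℂ} (hl : 0 < l.im) (x y : EuclideanSpace ℝ (Fin d)) :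
    greenFunction d l x y = ∫ a in Ioi (0 : ℝ), greenIntegrand d l ‖x - y‖ a := by
  have hL := norm_pos_of_im_pos hl
  have h := integral_comp_mul_left_Ioi (fun s : ℝ => (I / l) * cexp (I * l * s) *
    heatKernel d (I * s / l) ‖x - y‖) 0 hL
  rw [mul_zero] at h
  rw [greenFunction, ← inv_smul_eq_iff₀ (inv_ne_zero hL.ne')] at *
  rw [← h, inv_inv, ← integral_smul]
  refine integral_congr_ae (Filter.Eventually.of_forall fun a => ?_)
  simp only [greenIntegrand]
  rw [sq_mul_rayDir, real_smul, rayDir]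
  push_cast
  rw [show I * l * ((‖l‖ : ℂ) * a) = I * l * ‖l‖ * a by ring,
    show I * ((‖l‖ : ℂ) * a) / l = I * ‖l‖ / l * a by ring]
  ring

lemma measurable_greenIntegrand (d : ℕ) (l : ℂ) :
    Measurable fun q : ℝ × ℝ => greenIntegrand d l q.1 q.2 := by
  unfold greenIntegrand heatKernel
  fun_prop

lemma norm_greenIntegrand {d : ℕ} {l : ℂ} (hl : 0 < l.im) (r : ℝ) {a : ℝ} (ha : 0 < a) :
    ‖greenIntegrand d l r a‖ = Real.exp (-(l.im * ‖l‖) * a) *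
      ((4 * Real.pi * a) ^ (-(d / 2 : ℝ)) *
        Real.exp (-((rayDir l).re / (4 * a)) * r ^ 2)) := by
  have h1 := norm_rayDir hl
  have hinv : (rayDir l)⁻¹ = (starRingEnd ℂ) (rayDir l) := by
    rw [inv_def, normSq_eq_norm_sq, h1]
    simp
  rw [greenIntegrand, heatKernel, norm_mul, norm_mul, norm_mul, h1, one_mul, norm_exp,
    re_mul_ofReal, sq_mul_rayDir_re, norm_exp]
  congr 2
  · rw [show ((d : ℂ) / 2) = ((d / 2 : ℝ) : ℂ) by push_cast; rfl, norm_cpow_real, norm_div,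
      norm_mul, norm_mul, norm_mul, h1, norm_one, norm_real, norm_real,
      Real.norm_of_nonneg Real.pi_pos.le, Real.norm_of_nonneg ha.le, one_mul, one_div,
      Real.inv_rpow (by positivity), ← Real.rpow_neg (by positivity)]
    norm_num
  · have e : (-(r : ℂ) ^ 2 / (4 * (rayDir l * a))) =
        ((-(r ^ 2 / (4 * a)) : ℝ) : ℂ) * (starRingEnd ℂ) (rayDir l) := by
      rw [← hinv]
      push_cast
      field_simp
    rw [e, re_ofReal_mul, conj_re]
    congr 1
    ring

lemma lintegral_rpow_neg_half_mul_exp_lt_top {b : ℝ} (hb : 0 < b) :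
    ∫⁻ a in Ioi (0 : ℝ), ENNReal.ofReal (a ^ (-(1 / 2) : ℝ) * Real.exp (-b * a)) < ⊤ := by
  have h := integrableOn_rpow_mul_exp_neg_mul_rpow (s := -(1 / 2)) (p := 1) (b := b)
    (by norm_num) one_pos hb
  simp only [Real.rpow_one] at h
  exact h.lintegral_lt_top

/-- The heat kernel of `ℝ^{n+1}` integrated over an `n`-dimensional surface keeps one uncompensated
half power of time, integrable at zero: this is codimension one. -/
lemma rpow_neg_mul_rpow_div (n : ℕ) {a c : ℝ} (ha : 0 < a) (hc : 0 < c) :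
    (4 * Real.pi * a) ^ (-((n + 1 : ℕ) / 2 : ℝ)) * (Real.pi / (c / (4 * a))) ^ (n / 2 : ℝ) =
      (4 * Real.pi) ^ (-(1 / 2) : ℝ) * c ^ (-(n / 2 : ℝ)) * a ^ (-(1 / 2) : ℝ) := by
  have hb : 0 < 4 * Real.pi * a := by positivity
  have h1 : (4 * Real.pi * a) ^ (-((n + 1 : ℕ) / 2 : ℝ)) =
      (4 * Real.pi * a) ^ (-(1 / 2) : ℝ) * ((4 * Real.pi * a) ^ (n / 2 : ℝ))⁻¹ := by
    rw [← Real.rpow_neg hb.le, ← Real.rpow_add hb]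
    congr 1
    push_cast
    ring
  have h2 : Real.pi / (c / (4 * a)) = (4 * Real.pi * a) / c := by
    field_simp
  have h3 : (4 * Real.pi * a) ^ (-(1 / 2) : ℝ) =
      (4 * Real.pi) ^ (-(1 / 2) : ℝ) * a ^ (-(1 / 2) : ℝ) :=
    Real.mul_rpow (by positivity) ha.le
  rw [h1, h2, Real.div_rpow hb.le hc.le, Real.rpow_neg hc.le,
    mul_right_comm ((4 * Real.pi) ^ (-(1 / 2) : ℝ)), ← h3]
  have h4 : (4 * Real.pi * a) ^ (n / 2 : ℝ) ≠ 0 := (Real.rpow_pos_of_pos hb _).ne'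
  generalize (4 * Real.pi * a) ^ (n / 2 : ℝ) = p at *
  generalize (4 * Real.pi * a) ^ (-(1 / 2) : ℝ) = q at *
  generalize c ^ (n / 2 : ℝ) = u at *
  rw [mul_assoc, ← mul_div_assoc, inv_mul_cancel₀ h4, one_div]

/-- Schur bound for the absolute Green kernel. -/
lemma IsGraphSum.exists_lintegral_greenIntegrand_le {n : ℕ}
    {σ : Measure (EuclideanSpace ℝ (Fin (n + 1)))} [SFinite σ] (hσ : IsGraphSum n σ) {l : ℂ}
    (hl : 0 < l.im) : ∃ S : ℝ≥0∞, S < ⊤ ∧ ∀ x,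
      ∫⁻ y, (∫⁻ a in Ioi (0 : ℝ), ‖greenIntegrand (n + 1) l ‖x - y‖ a‖ₑ) ∂σ ≤ S := by
  obtain ⟨K, hK⟩ := hσ.exists_lintegral_gaussian_le
  have hc := rayDir_re_pos hl
  set c := (rayDir l).re
  have hb : 0 < l.im * ‖l‖ := mul_pos hl (norm_pos_of_im_pos hl)
  set A : ℝ := (4 * Real.pi) ^ (-(1 / 2) : ℝ) * c ^ (-(n / 2 : ℝ)) with hA
  -- This constant may degenerate as `l` approaches the real axis; it serves only for
  -- well-definedness and Fubini.
  refine ⟨K * ENNReal.ofReal A * ∫⁻ a in Ioi (0 : ℝ),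
    ENNReal.ofReal (a ^ (-(1 / 2) : ℝ) * Real.exp (-(l.im * ‖l‖) * a)),
    ENNReal.mul_lt_top (ENNReal.mul_lt_top (by simp) (by simp))
      (lintegral_rpow_neg_half_mul_exp_lt_top hb), fun x => ?_⟩
  have hm := measurable_greenIntegrand (n + 1) l
  rw [lintegral_lintegral_swap]
  · rw [← lintegral_const_mul _ (by fun_prop)]
    refine setLIntegral_mono' measurableSet_Ioi fun a ha => ?_
    have ha : 0 < a := ha
    have h1 := hK (c / (4 * a)) (by positivity) x
    calc ∫⁻ y, ‖greenIntegrand (n + 1) l ‖x - y‖ a‖ₑ ∂σ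
        = ∫⁻ y, ENNReal.ofReal (Real.exp (-(l.im * ‖l‖) * a) *
          (4 * Real.pi * a) ^ (-((n + 1 : ℕ) / 2 : ℝ))) *
          ENNReal.ofReal (Real.exp (-(c / (4 * a)) * ‖x - y‖ ^ 2)) ∂σ := by
          congr with y
          rw [← ofReal_norm, norm_greenIntegrand hl _ ha, ← mul_assoc,
            ENNReal.ofReal_mul (by positivity)]
      _ ≤ ENNReal.ofReal (Real.exp (-(l.im * ‖l‖) * a) *
          (4 * Real.pi * a) ^ (-((n + 1 : ℕ) / 2 : ℝ))) *
          (K * ENNReal.ofReal ((Real.pi / (c / (4 * a))) ^ (n / 2 : ℝ))) := by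
          rw [lintegral_const_mul _ (by fun_prop)]
          gcongr
      _ = K * ENNReal.ofReal (Real.exp (-(l.im * ‖l‖) * a) *
          ((4 * Real.pi * a) ^ (-((n + 1 : ℕ) / 2 : ℝ)) *
          (Real.pi / (c / (4 * a))) ^ (n / 2 : ℝ))) := by
          rw [mul_left_comm, ← ENNReal.ofReal_mul (by positivity), mul_assoc (Real.exp _)]
      _ = K * ENNReal.ofReal A *
          ENNReal.ofReal (a ^ (-(1 / 2) : ℝ) * Real.exp (-(l.im * ‖l‖) * a)) := by
          rw [mul_assoc (K : ℝ≥0∞), ← ENNReal.ofReal_mul (by positivity)]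
          congr 2
          rw [rpow_neg_mul_rpow_div n ha hc, hA]
          ring
  · apply Measurable.aemeasurable
    have : Measurable fun q : EuclideanSpace ℝ (Fin (n + 1)) × ℝ =>
        greenIntegrand (n + 1) l ‖x - q.1‖ q.2 := hm.comp (f := fun q :
          EuclideanSpace ℝ (Fin (n + 1)) × ℝ => (‖x - q.1‖, q.2)) (by fun_prop)
    exact this.enorm

section Bilinear

variable {n : ℕ} {σ : Measure (EuclideanSpace ℝ (Fin (n + 1)))} [IsFiniteMeasure σ]

/-- The bilinear form of the Green kernel is absolutely convergent. -/
lemma IsGraphSum.integrable_greenIntegrand (hσ : IsGraphSum n σ) {l : ℂ} (hl : 0 < l.im)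
    {f g : EuclideanSpace ℝ (Fin (n + 1)) → ℂ} (hf : MemLp f 2 σ) (hg : MemLp g 2 σ) :
    Integrable (fun q : (EuclideanSpace ℝ (Fin (n + 1)) × EuclideanSpace ℝ (Fin (n + 1))) × ℝ =>
      greenIntegrand (n + 1) l ‖q.1.1 - q.1.2‖ q.2 * (g q.1.1 * f q.1.2))
      ((σ.prod σ).prod (volume.restrict (Ioi 0))) := by
  obtain ⟨S, hS, hSx⟩ := hσ.exists_lintegral_greenIntegrand_le hl
  have hm := measurable_greenIntegrand (n + 1) l
  have hmk : Measurable fun q : (EuclideanSpace ℝ (Fin (n + 1)) ×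
      EuclideanSpace ℝ (Fin (n + 1))) × ℝ => greenIntegrand (n + 1) l ‖q.1.1 - q.1.2‖ q.2 :=
    hm.comp (f := fun q : (EuclideanSpace ℝ (Fin (n + 1)) ×
      EuclideanSpace ℝ (Fin (n + 1))) × ℝ => (‖q.1.1 - q.1.2‖, q.2)) (by fun_prop)
  have hgf : AEStronglyMeasurable (fun z : EuclideanSpace ℝ (Fin (n + 1)) ×
      EuclideanSpace ℝ (Fin (n + 1)) => g z.1 * f z.2) (σ.prod σ) :=
    (hg.aestronglyMeasurable.comp_quasiMeasurePreserving Measure.quasiMeasurePreserving_fst).mul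
      (hf.aestronglyMeasurable.comp_quasiMeasurePreserving Measure.quasiMeasurePreserving_snd)
  have hms : AEStronglyMeasurable (fun q : (EuclideanSpace ℝ (Fin (n + 1)) ×
      EuclideanSpace ℝ (Fin (n + 1))) × ℝ =>
      greenIntegrand (n + 1) l ‖q.1.1 - q.1.2‖ q.2 * (g q.1.1 * f q.1.2))
      ((σ.prod σ).prod (volume.restrict (Ioi (0 : ℝ)))) := hmk.aestronglyMeasurable.mul
    (hgf.comp_quasiMeasurePreserving (Measure.quasiMeasurePreserving_fst
      (ν := volume.restrict (Ioi (0 : ℝ)))))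
  refine ⟨hms, ?_⟩
  rw [HasFiniteIntegral, lintegral_prod _ hms.enorm]
  set k : EuclideanSpace ℝ (Fin (n + 1)) → EuclideanSpace ℝ (Fin (n + 1)) → ℝ≥0∞ :=
    fun x y => ∫⁻ a in Ioi (0 : ℝ), ‖greenIntegrand (n + 1) l ‖x - y‖ a‖ₑ with hk
  have hkm : Measurable (Function.uncurry k) := by
    exact Measurable.lintegral_prod_right' hmk.enorm
  calc _ = ∫⁻ z : EuclideanSpace ℝ (Fin (n + 1)) × EuclideanSpace ℝ (Fin (n + 1)),
        k z.1 z.2 * (‖g z.1‖ₑ * ‖f z.2‖ₑ) ∂(σ.prod σ) := by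
        congr with z
        simp only [hk]
        rw [← lintegral_mul_const _ (by
          exact (hmk.comp (measurable_prodMk_left (x := z))).enorm)]
        congr with a
        simp [enorm_mul]
    _ ≤ S * (∫⁻ x, ‖f x‖ₑ ^ 2 ∂σ + ∫⁻ x, ‖g x‖ₑ ^ 2 ∂σ) := by
        refine lintegral_schur hkm hSx (fun y => ?_) hf.aestronglyMeasurable.enorm
          hg.aestronglyMeasurable.enorm
        simp only [hk, norm_sub_rev _ y]
        exact hSx y
    _ < ⊤ := by
        have h2 : ∀ {h : EuclideanSpace ℝ (Fin (n + 1)) → ℂ}, MemLp h 2 σ →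
            ∫⁻ x, ‖h x‖ₑ ^ 2 ∂σ < ⊤ := fun hh => by
          have := lintegral_rpow_enorm_lt_top_of_eLpNorm_lt_top (by norm_num) (by norm_num) hh.2
          simpa using this
        exact ENNReal.mul_lt_top hS (ENNReal.add_lt_top.2 ⟨h2 hf, h2 hg⟩)

/-- Weighted product of two Fourier transforms of densities on a graph sum. -/
lemma IsGraphSum.exists_lintegral_mul_oscInt_le (hσ : IsGraphSum n σ) :
    ∃ K : ℝ≥0, ∀ f g, MemLp f 2 σ → MemLp g 2 σ → ∀ (w W : ℝ → ℝ≥0∞),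
      Measurable w → Measurable W → (∀ x s, |s| ≤ x → w x ≤ W s) →
      ∫⁻ ξ, ‖oscInt σ id g ξ * oscInt σ id f (-ξ)‖ₑ * w ‖ξ‖ ≤
        K * (∫⁻ s, W s) * (∫⁻ x, ‖f x‖ₑ ^ 2 ∂σ + ∫⁻ x, ‖g x‖ₑ ^ 2 ∂σ) := by
  obtain ⟨K, hK⟩ := hσ.exists_lintegral_oscInt_le
  refine ⟨K, fun f g hf hg w W hw hW hwW => ?_⟩
  have hab : ∀ a b : ℝ≥0∞, a * b ≤ a ^ 2 + b ^ 2 := by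
    intro a b
    rcases le_total a b with h | h
    · calc a * b ≤ b * b := by gcongr
        _ = b ^ 2 := (sq b).symm
        _ ≤ _ := le_add_self
    · calc a * b ≤ a * a := by gcongr
        _ = a ^ 2 := (sq a).symm
        _ ≤ _ := le_self_add
  have hwn : Measurable fun ξ : EuclideanSpace ℝ (Fin (n + 1)) => w ‖ξ‖ := by fun_prop
  have hg' := hK g hg (fun ξ => w ‖ξ‖) W hwn hW fun ξ s hs => hwW _ _ hs
  have hf' := hK f hf (fun ξ => w ‖ξ‖) W hwn hW fun ξ s hs => hwW _ _ hs
  have hOg := aestronglyMeasurable_oscInt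
    (μ := (volume : Measure (EuclideanSpace ℝ (Fin (n + 1))))) measurable_id
    hg.aestronglyMeasurable
  calc _ ≤ ∫⁻ ξ, (‖oscInt σ id g ξ‖ₑ ^ 2 * w ‖ξ‖ + ‖oscInt σ id f (-ξ)‖ₑ ^ 2 * w ‖-ξ‖) := by
        refine lintegral_mono fun ξ => ?_
        simp only
        rw [norm_neg, ← add_mul, enorm_mul]
        gcongr
        exact hab _ _
    _ = (∫⁻ ξ, ‖oscInt σ id g ξ‖ₑ ^ 2 * w ‖ξ‖) + ∫⁻ ξ, ‖oscInt σ id f ξ‖ₑ ^ 2 * w ‖ξ‖ := by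
        have hm : AEMeasurable fun ξ => ‖oscInt σ id g ξ‖ₑ ^ 2 * w ‖ξ‖ :=
          (hOg.enorm.pow_const 2).mul hwn.aemeasurable
        rw [lintegral_add_left' hm]
        congr 1
        exact lintegral_neg_eq_self (fun ξ => ‖oscInt σ id f ξ‖ₑ ^ 2 * w ‖ξ‖)
    _ ≤ _ := by
        rw [mul_add, add_comm]
        exact add_le_add hf' hg'

end Bilinear

/-! ### The damped bilinear form in Fourier variables. -/

/-- Arguments in the open right half-plane add up to less than `π` in modulus, so the principal
logarithm is additive. -/
lemma mul_cpow_of_re_pos {u v : ℂ} (hu : 0 < u.re) (hv : 0 < v.re) (s : ℂ) :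
    (u * v) ^ s = u ^ s * v ^ s := by
  have hu0 : u ≠ 0 := by rintro rfl; simp at hu
  have hv0 : v ≠ 0 := by rintro rfl; simp at hv
  have h1 := abs_lt.1 (abs_arg_lt_pi_div_two_iff.2 (Or.inl hu))
  have h2 := abs_lt.1 (abs_arg_lt_pi_div_two_iff.2 (Or.inl hv))
  rw [cpow_def_of_ne_zero (mul_ne_zero hu0 hv0), cpow_def_of_ne_zero hu0, cpow_def_of_ne_zero hv0,
    (Complex.log_mul_eq_add_log_iff hu0 hv0).2 ⟨by linarith, by linarith⟩, add_mul,
    Complex.exp_add]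

lemma inv_re_pos {z : ℂ} (hz : 0 < z.re) : 0 < z⁻¹.re := by
  have h0 : z ≠ 0 := by rintro rfl; simp at hz
  rw [inv_re]
  exact div_pos hz (normSq_pos.2 h0)

/-- Damping the heat kernel by a Gaussian amounts to changing the time. -/
lemma exp_mul_greenIntegrand {d : ℕ} {l : ℂ} (hl : 0 < l.im) (r : ℝ) {a : ℝ} (ha : 0 < a) :
    cexp (-(r : ℂ) ^ 2 / 4) * greenIntegrand d l r a =
      rayDir l * cexp (l ^ 2 * rayDir l * a) *
        (1 + rayDir l * a) ^ (((-(d / 2 : ℝ)) : ℝ) : ℂ) *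
        ((Real.pi / (4 * Real.pi ^ 2 * (rayDir l * a / (1 + rayDir l * a)))) ^ (d / 2 : ℂ) *
          cexp (-Real.pi ^ 2 * (r : ℂ) ^ 2 /
            (4 * Real.pi ^ 2 * (rayDir l * a / (1 + rayDir l * a))))) := by
  set ω := rayDir l
  have hω := rayDir_re_pos hl
  have hω0 : ω ≠ 0 := by rw [← norm_pos_iff, norm_rayDir hl]; exact one_pos
  have ha0 : (a : ℂ) ≠ 0 := by exact_mod_cast ha.ne'
  have hz : 1 + ω * a ≠ 0 := one_add_mul_ne_zero hω.le ha.le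
  have hz1 : 1 ≤ (1 + ω * a).re := one_le_re_one_add_mul hω.le ha.le
  have e1 : (1 / (4 * Real.pi * (ω * a)) : ℂ) ^ (d / 2 : ℂ) =
      (1 + ω * a) ^ (((-(d / 2 : ℝ)) : ℝ) : ℂ) *
        (Real.pi / (4 * Real.pi ^ 2 * (ω * a / (1 + ω * a)))) ^ (d / 2 : ℂ) := by
    have e2 : (1 / (4 * Real.pi * (ω * a)) : ℂ) =
        (1 + ω * a)⁻¹ * (Real.pi / (4 * Real.pi ^ 2 * (ω * a / (1 + ω * a)))) := by
      field_simp
    -- The reciprocal of `t/(1+t)` is `1/t + 1`, visibly in the right half-plane, so the complex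
    -- power splits.
    have e3 : (Real.pi / (4 * Real.pi ^ 2 * (ω * a / (1 + ω * a))) : ℂ) =
        ((1 / (4 * Real.pi) : ℝ) : ℂ) * ((ω * a)⁻¹ + 1) := by
      push_cast
      field_simp
    have h3 : 0 < (ω * (a : ℂ)).re := by
      rw [re_mul_ofReal]
      exact mul_pos hω ha
    rw [e2, mul_cpow_of_re_pos (inv_re_pos (by linarith)), inv_cpow]
    · congr 1
      rw [← cpow_neg]
      push_cast
      rfl
    · intro h
      have := abs_lt.1 (abs_arg_lt_pi_div_two_iff.2 (Or.inl (by linarith : 0 < (1 + ω * a).re)))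
      rw [h] at this
      linarith [Real.pi_pos]
    · rw [e3, re_ofReal_mul]
      have := inv_re_pos h3
      have h4 : 0 < ((ω * (a : ℂ))⁻¹ + 1).re := by
        rw [add_re, one_re]
        linarith
      positivity
  have e4 : cexp (-(r : ℂ) ^ 2 / 4) * cexp (-(r : ℂ) ^ 2 / (4 * (ω * a))) =
      cexp (-Real.pi ^ 2 * (r : ℂ) ^ 2 / (4 * Real.pi ^ 2 * (ω * a / (1 + ω * a)))) := by
    rw [← Complex.exp_add]
    congr 1
    field_simp
    ring
  rw [← e4, greenIntegrand, heatKernel]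
  rw [e1]
  ring

lemma four_pi_sq_mul_re_pos {l : ℂ} (hl : 0 < l.im) {a : ℝ} (ha : 0 < a) :
    0 < (4 * Real.pi ^ 2 * (rayDir l * a / (1 + rayDir l * a))).re := by
  rw [show (4 * Real.pi ^ 2 : ℂ) = ((4 * Real.pi ^ 2 : ℝ) : ℂ) by push_cast; ring, re_ofReal_mul]
  have h := sq_div_le_re_mul_div_one_add (norm_rayDir hl) (rayDir_re_pos hl).le ha.le
  have h2 : 0 < a ^ 2 / (1 + a) ^ 2 := by positivity
  have h3 := h2.trans_le h
  positivity

section DampedBilinear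

variable {n : ℕ} {σ : Measure (EuclideanSpace ℝ (Fin (n + 1)))} [IsFiniteMeasure σ]

/-- The damped bilinear form at a fixed complex time, in Fourier variables. -/
lemma integral_exp_mul_greenIntegrand {l : ℂ} (hl : 0 < l.im)
    {f g : EuclideanSpace ℝ (Fin (n + 1)) → ℂ} (hf : MemLp f 2 σ) (hg : MemLp g 2 σ)
    {a : ℝ} (ha : 0 < a) :
    ∫ z : EuclideanSpace ℝ (Fin (n + 1)) × EuclideanSpace ℝ (Fin (n + 1)),
      cexp (-(‖z.1 - z.2‖ : ℂ) ^ 2 / 4) *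
        (greenIntegrand (n + 1) l ‖z.1 - z.2‖ a * (g z.1 * f z.2)) ∂(σ.prod σ) =
    ∫ η, rayDir l * (cexp (l ^ 2 * rayDir l * a) *
      dampedHeat (n + 1) (rayDir l) (2 * Real.pi * ‖η‖) a) *
        (oscInt σ id g η * oscInt σ id f (-η)) := by
  have h := integral_gaussian_mul_oscInt (p := id) measurable_id (hf.integrable (by norm_num))
    (hg.integrable (by norm_num)) (four_pi_sq_mul_re_pos hl ha)
  have hfr : (Module.finrank ℝ (EuclideanSpace ℝ (Fin (n + 1))) : ℂ) = ((n + 1 : ℕ) : ℂ) := by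
    rw [finrank_euclideanSpace, Fintype.card_fin]
  rw [hfr] at h
  have e1 : ∀ z : EuclideanSpace ℝ (Fin (n + 1)) × EuclideanSpace ℝ (Fin (n + 1)),
      cexp (-(‖z.1 - z.2‖ : ℂ) ^ 2 / 4) *
        (greenIntegrand (n + 1) l ‖z.1 - z.2‖ a * (g z.1 * f z.2)) =
      (rayDir l * cexp (l ^ 2 * rayDir l * a) *
        (1 + rayDir l * a) ^ (((-((n + 1 : ℕ) / 2 : ℝ)) : ℝ) : ℂ)) * ((Real.pi /
        (4 * Real.pi ^ 2 * (rayDir l * a / (1 + rayDir l * a)))) ^ (((n + 1 : ℕ) : ℂ) / 2) *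
          cexp (-Real.pi ^ 2 * (‖id z.1 - id z.2‖ : ℂ) ^ 2 /
            (4 * Real.pi ^ 2 * (rayDir l * a / (1 + rayDir l * a)))) * (g z.1 * f z.2)) := by
    intro z
    rw [← mul_assoc, exp_mul_greenIntegrand hl _ ha]
    simp only [id]
    ring
  simp only [e1]
  rw [integral_const_mul, ← h, ← integral_const_mul]
  congr with η
  rw [dampedHeat]
  have e2 : cexp (-(4 * Real.pi ^ 2 * (rayDir l * a / (1 + rayDir l * a))) * (‖η‖ : ℂ) ^ 2) =
      cexp (-((2 * Real.pi * ‖η‖ : ℝ) : ℂ) ^ 2 * (rayDir l * a / (1 + rayDir l * a))) := by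
    congr 1
    push_cast
    ring
  rw [e2]
  ring

/-- Linear rather than quadratic in small `a`, at the price of `Re ω`. It gives slice integrals of
order `a^{-1/2}`; the uniform quadratic rate would give the non-integrable `a⁻¹`. It is used only to
justify Fubini. -/
lemma norm_dampedHeat_le_exp {l : ℂ} (hl : 0 < l.im) {a : ℝ} (ha : 0 < a) (d : ℕ) (x : ℝ) :
    ‖dampedHeat d (rayDir l) x a‖ ≤ Real.exp (-((rayDir l).re * a / (1 + a)) * x ^ 2) := by
  have h1 := norm_rayDir hl
  have hω := rayDir_re_pos hl
  rw [norm_dampedHeat]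
  have h2 := one_le_norm_one_add_mul hω.le ha.le
  have h3 : ‖1 + rayDir l * a‖ ^ (-(d / 2 : ℝ)) ≤ 1 :=
    Real.rpow_le_one_of_one_le_of_nonpos h2 (by simp; positivity)
  refine (mul_le_of_le_one_left (Real.exp_pos _).le h3).trans (Real.exp_le_exp.2 ?_)
  have h4 : (rayDir l).re * a / (1 + a) ≤ (rayDir l * a / (1 + rayDir l * a)).re := by
    rw [re_mul_div_one_add h1]
    have h5 := norm_one_add_mul_le h1 ha.le
    have hc : (rayDir l).re ≤ 1 := (re_le_norm _).trans h1.le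
    calc (rayDir l).re * a / (1 + a) ≤ (a * (rayDir l).re + a ^ 2) / (1 + a) ^ 2 := by
          rw [div_le_div_iff₀ (by positivity) (by positivity)]
          nlinarith [mul_pos ha ha, mul_pos (mul_pos ha ha) (by positivity : 0 < 1 + a)]
      _ ≤ _ := by
          gcongr
  nlinarith [sq_nonneg x]

lemma lintegral_gaussian_real {b : ℝ} (hb : 0 < b) :
    ∫⁻ s : ℝ, ENNReal.ofReal (Real.exp (-b * s ^ 2)) = ENNReal.ofReal (Real.sqrt (Real.pi / b)) := by
  rw [← ofReal_integral_eq_lintegral_ofReal (integrable_exp_neg_mul_sq hb)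
    (Filter.Eventually.of_forall fun v => (Real.exp_pos _).le), integral_gaussian]

lemma measurable_dampedHeat (d : ℕ) (ω : ℂ) :
    Measurable fun q : ℝ × ℝ => dampedHeat d ω q.1 q.2 := by
  unfold dampedHeat
  fun_prop

lemma MeasureTheory.MemLp.lintegral_enorm_sq_lt_top {α : Type*} [MeasurableSpace α] {ν : Measure α}
    {f : α → ℂ} (hf : MemLp f 2 ν) : ∫⁻ x, ‖f x‖ₑ ^ 2 ∂ν < ⊤ := by
  have := lintegral_rpow_enorm_lt_top_of_eLpNorm_lt_top (by norm_num) (by norm_num) hf.2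
  simpa using this

/-- Absolute convergence of the damped bilinear form in Fourier variables. -/
lemma IsGraphSum.integrable_dampedHeat_mul_oscInt (hσ : IsGraphSum n σ) {l : ℂ} (hl : 0 < l.im)
    {f g : EuclideanSpace ℝ (Fin (n + 1)) → ℂ} (hf : MemLp f 2 σ) (hg : MemLp g 2 σ) :
    Integrable (fun q : ℝ × EuclideanSpace ℝ (Fin (n + 1)) =>
      rayDir l * (cexp (l ^ 2 * rayDir l * q.1) *
      dampedHeat (n + 1) (rayDir l) (2 * Real.pi * ‖q.2‖) q.1) *
        (oscInt σ id g q.2 * oscInt σ id f (-q.2))) ((volume.restrict (Ioi 0)).prod volume) := by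
  obtain ⟨K, hK⟩ := hσ.exists_lintegral_mul_oscInt_le
  have hb : 0 < l.im * ‖l‖ := mul_pos hl (norm_pos_of_im_pos hl)
  have hc := rayDir_re_pos hl
  set c := (rayDir l).re with hcdef
  set N := ∫⁻ x, ‖f x‖ₑ ^ 2 ∂σ + ∫⁻ x, ‖g x‖ₑ ^ 2 ∂σ with hN
  have hNt : N < ⊤ :=
    ENNReal.add_lt_top.2 ⟨hf.lintegral_enorm_sq_lt_top, hg.lintegral_enorm_sq_lt_top⟩
  have hOg := aestronglyMeasurable_oscInt
    (μ := (volume : Measure (EuclideanSpace ℝ (Fin (n + 1))))) measurable_id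
    hg.aestronglyMeasurable
  have hOf := aestronglyMeasurable_oscInt
    (μ := (volume : Measure (EuclideanSpace ℝ (Fin (n + 1))))) measurable_id
    hf.aestronglyMeasurable
  have hO : AEStronglyMeasurable (fun η => oscInt σ id g η * oscInt σ id f (-η)) volume :=
    hOg.mul (hOf.comp_quasiMeasurePreserving
      (Measure.measurePreserving_neg volume).quasiMeasurePreserving)
  have hD : Measurable fun q : ℝ × EuclideanSpace ℝ (Fin (n + 1)) =>
      dampedHeat (n + 1) (rayDir l) (2 * Real.pi * ‖q.2‖) q.1 :=
    (measurable_dampedHeat (n + 1) (rayDir l)).comp (f := fun q : ℝ ×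
      EuclideanSpace ℝ (Fin (n + 1)) => (2 * Real.pi * ‖q.2‖, q.1)) (by fun_prop)
  have hms : AEStronglyMeasurable (fun q : ℝ × EuclideanSpace ℝ (Fin (n + 1)) =>
      rayDir l * (cexp (l ^ 2 * rayDir l * q.1) *
      dampedHeat (n + 1) (rayDir l) (2 * Real.pi * ‖q.2‖) q.1) *
        (oscInt σ id g q.2 * oscInt σ id f (-q.2))) ((volume.restrict (Ioi 0)).prod volume) :=
    (Measurable.aestronglyMeasurable (by fun_prop)).mul
      (hO.comp_quasiMeasurePreserving Measure.quasiMeasurePreserving_snd)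
  refine ⟨hms, ?_⟩
  rw [HasFiniteIntegral, lintegral_prod _ hms.enorm]
  have hslice : ∀ a ∈ Ioi (0 : ℝ), ∫⁻ η, ‖rayDir l * (cexp (l ^ 2 * rayDir l * a) *
      dampedHeat (n + 1) (rayDir l) (2 * Real.pi * ‖η‖) a) *
        (oscInt σ id g η * oscInt σ id f (-η))‖ₑ ≤
      K * N * ENNReal.ofReal (Real.sqrt (Real.pi / c)) *
        (ENNReal.ofReal (a ^ (-(1 / 2) : ℝ) * Real.exp (-(l.im * ‖l‖) * a)) +
          ENNReal.ofReal (Real.exp (-(l.im * ‖l‖) * a))) := by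
    intro a ha
    have ha : 0 < a := ha
    set β := c * a / (1 + a) with hβ
    have hβ0 : 0 < β := by positivity
    have h1 := hK f g hf hg (fun x => ENNReal.ofReal (Real.exp (-β * x ^ 2)))
      (fun x => ENNReal.ofReal (Real.exp (-β * x ^ 2))) (by fun_prop) (by fun_prop) (by
        intro x s hs
        refine ENNReal.ofReal_le_ofReal (Real.exp_le_exp.2 ?_)
        have : s ^ 2 ≤ x ^ 2 := by rw [← sq_abs s]; gcongr
        nlinarith)
    rw [lintegral_gaussian_real hβ0] at h1
    -- From `1/β = (1/a + 1)/c` and subadditivity of the square root.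
    have hsq : Real.sqrt (Real.pi / β) ≤ Real.sqrt (Real.pi / c) * (a ^ (-(1 / 2) : ℝ) + 1) := by
      rw [Real.rpow_neg ha.le, ← Real.sqrt_eq_rpow]
      refine Real.sqrt_le_iff.2 ⟨by positivity, ?_⟩
      rw [mul_pow, Real.sq_sqrt (by positivity)]
      have e : Real.pi / β = Real.pi / c * (a⁻¹ + 1) := by rw [hβ]; field_simp
      rw [e]
      gcongr
      have h2 : (Real.sqrt a)⁻¹ ^ 2 = a⁻¹ := by rw [inv_pow, Real.sq_sqrt ha.le]
      have h3 : 0 < (Real.sqrt a)⁻¹ := by positivity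
      nlinarith
    calc _ ≤ ∫⁻ η, ENNReal.ofReal (Real.exp (-(l.im * ‖l‖) * a)) *
          (‖oscInt σ id g η * oscInt σ id f (-η)‖ₑ *
            ENNReal.ofReal (Real.exp (-β * ‖η‖ ^ 2))) := by
          refine lintegral_mono fun η => ?_
          simp only
          rw [enorm_mul, enorm_mul, enorm_mul (cexp _), ← ofReal_norm (rayDir l), norm_rayDir hl,
            ENNReal.ofReal_one, one_mul, ← ofReal_norm (cexp _), norm_exp, re_mul_ofReal,
            sq_mul_rayDir_re, mul_assoc, mul_comm ‖dampedHeat _ _ _ _‖ₑ]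
          gcongr
          rw [← ofReal_norm]
          refine ENNReal.ofReal_le_ofReal ((norm_dampedHeat_le_exp hl ha _ _).trans ?_)
          refine Real.exp_le_exp.2 ?_
          have h5 : ‖η‖ ^ 2 ≤ (2 * Real.pi * ‖η‖) ^ 2 := by
            rw [mul_pow]
            exact le_mul_of_one_le_left (sq_nonneg _)
              (one_le_pow₀ (by linarith [Real.pi_gt_three]))
          rw [← hcdef, ← hβ]
          nlinarith
      _ ≤ ENNReal.ofReal (Real.exp (-(l.im * ‖l‖) * a)) *
          (K * ENNReal.ofReal (Real.sqrt (Real.pi / β)) * N) := by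
          rw [lintegral_const_mul' _ _ ENNReal.ofReal_ne_top]
          gcongr
      _ ≤ ENNReal.ofReal (Real.exp (-(l.im * ‖l‖) * a)) *
          (K * ENNReal.ofReal (Real.sqrt (Real.pi / c) * (a ^ (-(1 / 2) : ℝ) + 1)) * N) := by
          gcongr
      _ = _ := by
          rw [← ENNReal.ofReal_add (by positivity) (by positivity),
            show a ^ (-(1 / 2) : ℝ) * Real.exp (-(l.im * ‖l‖) * a) +
              Real.exp (-(l.im * ‖l‖) * a) = (a ^ (-(1 / 2) : ℝ) + 1) *
              Real.exp (-(l.im * ‖l‖) * a) by ring,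
            ENNReal.ofReal_mul (by positivity), ENNReal.ofReal_mul (by positivity)]
          ring
  refine (setLIntegral_mono' measurableSet_Ioi hslice).trans_lt ?_
  rw [lintegral_const_mul _ (by fun_prop), lintegral_add_left (by fun_prop)]
  refine ENNReal.mul_lt_top (ENNReal.mul_lt_top (ENNReal.mul_lt_top (by simp) hNt) (by simp))
    (ENNReal.add_lt_top.2 ⟨lintegral_rpow_neg_half_mul_exp_lt_top hb, ?_⟩)
  exact (integrableOn_exp_mul_Ioi (by linarith : -(l.im * ‖l‖) < 0) 0).lintegral_lt_top

/-- The damped bilinear form in Fourier variables. -/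
lemma IsGraphSum.integral_exp_mul_greenFunction (hσ : IsGraphSum n σ) {l : ℂ} (hl : 0 < l.im)
    {f g : EuclideanSpace ℝ (Fin (n + 1)) → ℂ} (hf : MemLp f 2 σ) (hg : MemLp g 2 σ) :
    ∫ z : EuclideanSpace ℝ (Fin (n + 1)) × EuclideanSpace ℝ (Fin (n + 1)),
      cexp (-(‖z.1 - z.2‖ : ℂ) ^ 2 / 4) *
        (greenFunction (n + 1) l z.1 z.2 * (g z.1 * f z.2)) ∂(σ.prod σ) =
    ∫ η, dampedSymbol (n + 1) l (2 * Real.pi * ‖η‖) *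
        (oscInt σ id g η * oscInt σ id f (-η)) := by
  have hI := hσ.integrable_greenIntegrand hl hf hg
  have hI2 : Integrable (fun q : (EuclideanSpace ℝ (Fin (n + 1)) ×
      EuclideanSpace ℝ (Fin (n + 1))) × ℝ => cexp (-(‖q.1.1 - q.1.2‖ : ℂ) ^ 2 / 4) *
      (greenIntegrand (n + 1) l ‖q.1.1 - q.1.2‖ q.2 * (g q.1.1 * f q.1.2)))
      ((σ.prod σ).prod (volume.restrict (Ioi 0))) := by
    refine hI.bdd_mul (c := 1) (Measurable.aestronglyMeasurable (by fun_prop))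
      (Filter.Eventually.of_forall fun q => ?_)
    rw [norm_exp, show (-(‖q.1.1 - q.1.2‖ : ℂ) ^ 2 / 4) = ((-(‖q.1.1 - q.1.2‖ ^ 2 / 4) : ℝ) : ℂ) by
      push_cast; ring, ofReal_re]
    refine Real.exp_le_one_iff.2 ?_
    have : 0 ≤ ‖q.1.1 - q.1.2‖ ^ 2 / 4 := by positivity
    linarith
  calc _ = ∫ z : EuclideanSpace ℝ (Fin (n + 1)) × EuclideanSpace ℝ (Fin (n + 1)),
        (∫ a in Ioi (0 : ℝ), cexp (-(‖z.1 - z.2‖ : ℂ) ^ 2 / 4) *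
        (greenIntegrand (n + 1) l ‖z.1 - z.2‖ a * (g z.1 * f z.2))) ∂(σ.prod σ) := by
        congr with z
        rw [integral_const_mul, integral_mul_const, greenFunction_eq_integral hl]
    _ = ∫ a in Ioi (0 : ℝ), (∫ z : EuclideanSpace ℝ (Fin (n + 1)) ×
        EuclideanSpace ℝ (Fin (n + 1)), cexp (-(‖z.1 - z.2‖ : ℂ) ^ 2 / 4) *
        (greenIntegrand (n + 1) l ‖z.1 - z.2‖ a * (g z.1 * f z.2)) ∂(σ.prod σ)) :=
        integral_integral_swap hI2
    _ = ∫ a in Ioi (0 : ℝ), (∫ η, rayDir l * (cexp (l ^ 2 * rayDir l * a) *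
        dampedHeat (n + 1) (rayDir l) (2 * Real.pi * ‖η‖) a) *
        (oscInt σ id g η * oscInt σ id f (-η))) :=
        setIntegral_congr_fun measurableSet_Ioi fun a ha =>
          integral_exp_mul_greenIntegrand hl hf hg ha
    _ = ∫ η, (∫ a in Ioi (0 : ℝ), rayDir l * (cexp (l ^ 2 * rayDir l * a) *
        dampedHeat (n + 1) (rayDir l) (2 * Real.pi * ‖η‖) a) *
        (oscInt σ id g η * oscInt σ id f (-η))) :=
        integral_integral_swap (hσ.integrable_dampedHeat_mul_oscInt hl hf hg)
    _ = _ := by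
        congr with η
        rw [dampedSymbol, ← integral_mul_const]

/-- A symbol bound gives a bound of the damped bilinear form. -/
lemma IsGraphSum.exists_enorm_damped_le (hσ : IsGraphSum n σ) : ∃ K : ℝ≥0, ∀ (l : ℂ) (C : ℝ),
    0 < l.im → 0 < C →
    (∀ x, 0 ≤ x → ‖dampedSymbol (n + 1) l x‖ ≤ C * symbolWeight ‖l‖ l.im x) →
    ∀ f g : EuclideanSpace ℝ (Fin (n + 1)) → ℂ, MemLp f 2 σ → MemLp g 2 σ →
    ‖∫ z : EuclideanSpace ℝ (Fin (n + 1)) × EuclideanSpace ℝ (Fin (n + 1)),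
      cexp (-(‖z.1 - z.2‖ : ℂ) ^ 2 / 4) *
        (greenFunction (n + 1) l z.1 z.2 * (g z.1 * f z.2)) ∂(σ.prod σ)‖ₑ ≤
      K * ENNReal.ofReal (C * (8 / (1 + l.im))) *
        (∫⁻ x, ‖f x‖ₑ ^ 2 ∂σ + ∫⁻ x, ‖g x‖ₑ ^ 2 ∂σ) := by
  obtain ⟨K, hK⟩ := hσ.exists_lintegral_mul_oscInt_le
  refine ⟨K, fun l C hl hC hsym f g hf hg => ?_⟩
  have hL := norm_nonneg l
  have hmw := measurable_symbolWeight ‖l‖ l.im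
  rw [hσ.integral_exp_mul_greenFunction hl hf hg]
  refine (enorm_integral_le_lintegral_enorm _).trans ?_
  have h1 := hK f g hf hg (fun x => ENNReal.ofReal (C * symbolWeight ‖l‖ l.im x))
    (fun s => ENNReal.ofReal (C * symbolWeight ‖l‖ l.im |s|)) (by fun_prop) (by fun_prop) (by
      intro x s hs
      refine ENNReal.ofReal_le_ofReal ?_
      gcongr
      exact symbolWeight_abs_anti hL hl.le hs)
  calc _ ≤ ∫⁻ η, ‖oscInt σ id g η * oscInt σ id f (-η)‖ₑ *
        ENNReal.ofReal (C * symbolWeight ‖l‖ l.im ‖η‖) := by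
        refine lintegral_mono fun η => ?_
        simp only
        rw [enorm_mul, mul_comm, ← ofReal_norm (dampedSymbol _ _ _)]
        gcongr
        refine (hsym _ (by positivity)).trans ?_
        gcongr
        -- The weight is decreasing, so the factor `2π` of the Fourier normalization can be dropped.
        have h2 := symbolWeight_abs_anti (s := ‖η‖) (x := 2 * Real.pi * ‖η‖) hL hl.le (by
          rw [abs_norm]
          exact le_mul_of_one_le_left (norm_nonneg _) (by linarith [Real.pi_gt_three]))
        rwa [abs_norm] at h2
    _ ≤ _ := h1
    _ ≤ _ := by
        gcongr
        simp only [ENNReal.ofReal_mul hC.le]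
        rw [lintegral_const_mul' _ _ ENNReal.ofReal_ne_top]
        gcongr
        exact lintegral_symbolWeight_le hL hl.le ((le_abs_self _).trans (abs_im_le_norm l))

end DampedBilinear

/-! ### Removing the Gaussian damping. -/

section Undamping

variable {n : ℕ} {σ : Measure (EuclideanSpace ℝ (Fin (n + 1)))} [IsFiniteMeasure σ]

lemma IsGraphSum.integrable_greenFunction_mul (hσ : IsGraphSum n σ) {l : ℂ} (hl : 0 < l.im)
    {f g : EuclideanSpace ℝ (Fin (n + 1)) → ℂ} (hf : MemLp f 2 σ) (hg : MemLp g 2 σ) :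
    Integrable (fun z : EuclideanSpace ℝ (Fin (n + 1)) × EuclideanSpace ℝ (Fin (n + 1)) =>
      greenFunction (n + 1) l z.1 z.2 * (g z.1 * f z.2)) (σ.prod σ) := by
  refine (hσ.integrable_greenIntegrand hl hf hg).integral_prod_left.congr
    (Filter.Eventually.of_forall fun z => ?_)
  simp only
  rw [integral_mul_const, greenFunction_eq_integral hl]

/-- `e^{|v|²/4}` on a ball is the restriction of a Schwartz function. -/
lemma exists_schwartzMap_eq_exp (R : ℝ) :
    ∃ ψ : SchwartzMap (EuclideanSpace ℝ (Fin (n + 1))) ℂ,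
      ∀ v, ‖v‖ ≤ R → ψ v = cexp ((‖v‖ : ℂ) ^ 2 / 4) := by
  -- The absolute value lets the bump function be built for every real `R`.
  have hR : 0 < |R| + 1 := by positivity
  set χ : ContDiffBump (0 : EuclideanSpace ℝ (Fin (n + 1))) := ⟨|R| + 1, |R| + 2, hR, by linarith⟩
  have h1 : HasCompactSupport fun v : EuclideanSpace ℝ (Fin (n + 1)) =>
      ((χ v : ℝ) : ℂ) * cexp ((‖v‖ : ℂ) ^ 2 / 4) :=
    HasCompactSupport.mul_right (χ.hasCompactSupport.comp_left (g := fun r : ℝ => (r : ℂ)) ofReal_zero)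
  have h2 : ContDiff ℝ (⊤ : ℕ∞) fun v : EuclideanSpace ℝ (Fin (n + 1)) =>
      ((χ v : ℝ) : ℂ) * cexp ((‖v‖ : ℂ) ^ 2 / 4) := by
    refine ContDiff.mul (ofRealCLM.contDiff.comp χ.contDiff) (ContDiff.cexp (ContDiff.div_const ?_ _))
    have h3 := ofRealCLM.contDiff.comp (contDiff_norm_sq ℝ (E := EuclideanSpace ℝ (Fin (n + 1)))
      (n := (⊤ : ℕ∞)))
    have h4 : (fun v : EuclideanSpace ℝ (Fin (n + 1)) => (‖v‖ : ℂ) ^ 2) =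
        ofRealCLM ∘ fun v => ‖v‖ ^ 2 := by
      ext v
      simp
    rw [h4]
    exact h3
  refine ⟨h1.toSchwartzMap h2, fun v hv => ?_⟩
  have h4 : χ v = 1 := χ.one_of_mem_closedBall (by
    rw [mem_closedBall_zero_iff]
    exact hv.trans ((le_abs_self R).trans (by simp [χ])))
  change ((χ v : ℝ) : ℂ) * cexp ((‖v‖ : ℂ) ^ 2 / 4) = _
  rw [h4, ofReal_one, one_mul]

lemma schwartzMap_eq_integral (ψ : SchwartzMap (EuclideanSpace ℝ (Fin (n + 1))) ℂ)
    (v : EuclideanSpace ℝ (Fin (n + 1))) :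
    ψ v = ∫ η, 𝓕 ψ η * cexp (2 * Real.pi * I * inner ℝ v η) := by
  have h : (𝓕⁻ (𝓕 ψ : SchwartzMap (EuclideanSpace ℝ (Fin (n + 1))) ℂ) :
      SchwartzMap (EuclideanSpace ℝ (Fin (n + 1))) ℂ) v = ψ v := by
    rw [FourierTransform.fourierInv_fourier_eq]
  rw [← h, SchwartzMap.fourierInv_coe, Real.fourierInv_eq']
  congr with η
  rw [smul_eq_mul, mul_comm, real_inner_comm]
  congr 2
  push_cast
  ring

/-- Removing the Gaussian damping on a bounded set. -/
lemma IsGraphSum.exists_enorm_green_le (hσ : IsGraphSum n σ) {R : ℝ}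
    (hR : ∀ᵐ x ∂σ, ‖x‖ ≤ R) : ∃ K : ℝ≥0, ∀ (l : ℂ) (C : ℝ), 0 < l.im → 0 < C →
    (∀ x, 0 ≤ x → ‖dampedSymbol (n + 1) l x‖ ≤ C * symbolWeight ‖l‖ l.im x) →
    ∀ f g : EuclideanSpace ℝ (Fin (n + 1)) → ℂ, MemLp f 2 σ → MemLp g 2 σ →
    ‖∫ z : EuclideanSpace ℝ (Fin (n + 1)) × EuclideanSpace ℝ (Fin (n + 1)),
        greenFunction (n + 1) l z.1 z.2 * (g z.1 * f z.2) ∂(σ.prod σ)‖ₑ ≤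
      K * ENNReal.ofReal (C * (8 / (1 + l.im))) *
        (∫⁻ x, ‖f x‖ₑ ^ 2 ∂σ + ∫⁻ x, ‖g x‖ₑ ^ 2 ∂σ) := by
  obtain ⟨K, hK⟩ := hσ.exists_enorm_damped_le
  -- The radius is doubled because `ψ` is evaluated at differences of two points of norm at most
  -- `R`.
  obtain ⟨ψ, hψ⟩ := exists_schwartzMap_eq_exp (n := n) (R + R)
  have hΨ : Integrable (fun η => 𝓕 ψ η) := (𝓕 ψ).integrable
  refine ⟨K * (∫⁻ η, ‖𝓕 ψ η‖ₑ).toNNReal, fun l C hl hC hsym f g hf hg => ?_⟩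
  set H : EuclideanSpace ℝ (Fin (n + 1)) × EuclideanSpace ℝ (Fin (n + 1)) → ℂ := fun z =>
    cexp (-(‖z.1 - z.2‖ : ℂ) ^ 2 / 4) * (greenFunction (n + 1) l z.1 z.2 * (g z.1 * f z.2)) with hH
  have hHi : Integrable H (σ.prod σ) := by
    refine (hσ.integrable_greenFunction_mul hl hf hg).bdd_mul (c := 1)
      (Measurable.aestronglyMeasurable (by fun_prop)) (Filter.Eventually.of_forall fun q => ?_)
    rw [norm_exp, show (-(‖q.1 - q.2‖ : ℂ) ^ 2 / 4) = ((-(‖q.1 - q.2‖ ^ 2 / 4) : ℝ) : ℂ) by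
      push_cast; ring, ofReal_re]
    refine Real.exp_le_one_iff.2 ?_
    have : 0 ≤ ‖q.1 - q.2‖ ^ 2 / 4 := by positivity
    linarith
  have hI : Integrable (fun q : (EuclideanSpace ℝ (Fin (n + 1)) × EuclideanSpace ℝ (Fin (n + 1))) ×
      EuclideanSpace ℝ (Fin (n + 1)) => cexp (2 * Real.pi * I * inner ℝ (q.1.1 - q.1.2) q.2) *
      (H q.1 * 𝓕 ψ q.2)) ((σ.prod σ).prod volume) :=
    (hHi.mul_prod hΨ).bdd_mul (c := 1) (Measurable.aestronglyMeasurable (by fun_prop))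
      (Filter.Eventually.of_forall fun q => (norm_cexp_two_pi_mul _).le)
  have hmod : ∀ {h : EuclideanSpace ℝ (Fin (n + 1)) → ℂ} (_ : MemLp h 2 σ)
      (η : EuclideanSpace ℝ (Fin (n + 1))),
      MemLp (fun x => cexp (2 * Real.pi * I * inner ℝ x η) * h x) 2 σ := fun hh η =>
    hh.of_le ((Measurable.aestronglyMeasurable (by fun_prop)).mul hh.aestronglyMeasurable)
      (Filter.Eventually.of_forall fun x => by rw [norm_mul, norm_cexp_two_pi_mul, one_mul])
  have hae : ∀ᵐ z : EuclideanSpace ℝ (Fin (n + 1)) × EuclideanSpace ℝ (Fin (n + 1)) ∂(σ.prod σ),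
      greenFunction (n + 1) l z.1 z.2 * (g z.1 * f z.2) =
      ∫ η, cexp (2 * Real.pi * I * inner ℝ (z.1 - z.2) η) * (H z * 𝓕 ψ η) := by
    filter_upwards [Measure.quasiMeasurePreserving_fst.ae hR,
      Measure.quasiMeasurePreserving_snd.ae hR] with z h1 h2
    have h3 := hψ (z.1 - z.2) ((norm_sub_le _ _).trans (add_le_add h1 h2))
    rw [schwartzMap_eq_integral] at h3
    have h4 : ∫ η, cexp (2 * Real.pi * I * inner ℝ (z.1 - z.2) η) * (H z * 𝓕 ψ η) =
        H z * cexp ((‖z.1 - z.2‖ : ℂ) ^ 2 / 4) := by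
      rw [← h3, ← integral_const_mul]
      congr with η
      ring
    rw [h4, hH]
    simp only
    rw [mul_right_comm, ← Complex.exp_add]
    simp [neg_div]
  rw [integral_congr_ae hae, integral_integral_swap hI]
  refine (enorm_integral_le_lintegral_enorm _).trans ?_
  calc _ ≤ ∫⁻ η, ‖𝓕 ψ η‖ₑ * (K * ENNReal.ofReal (C * (8 / (1 + l.im))) *
        (∫⁻ x, ‖f x‖ₑ ^ 2 ∂σ + ∫⁻ x, ‖g x‖ₑ ^ 2 ∂σ)) := by
        refine lintegral_mono fun η => ?_
        simp only
        -- A plane wave in `x - y` splits into opposite unimodular modulations of `g` and `f`,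
        -- leaving their `L²` norms unchanged. The damped bound therefore holds for each `η`, and
        -- the total cost is `∫ |𝓕ψ|`.
        have h := hK l C hl hC hsym _ _ (hmod hf (-η)) (hmod hg η)
        simp only [enorm_mul, enorm_cexp_two_pi_mul, one_mul] at h
        refine le_trans (le_of_eq ?_) (mul_le_mul_right h ‖𝓕 ψ η‖ₑ)
        rw [← enorm_mul, ← integral_const_mul]
        congr with z
        rw [inner_sub_left, hH, inner_neg_right]
        push_cast
        rw [mul_sub, sub_eq_add_neg, Complex.exp_add, mul_neg]
        ring
    _ = _ := by
        rw [lintegral_mul_const'' _ hΨ.aestronglyMeasurable.enorm]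
        push_cast
        rw [ENNReal.coe_toNNReal hΨ.2.ne]
        ring

end Undamping

/-! ### Integral operators under Schur's condition. -/

section SchurOperator

variable {α : Type*} [MeasurableSpace α] {ν : Measure α}

lemma lintegral_enorm_sq_eq (f : Lp ℂ 2 ν) : ∫⁻ x, ‖f x‖ₑ ^ 2 ∂ν = ENNReal.ofReal (‖f‖ ^ 2) := by
  have h := eLpNorm_nnreal_pow_eq_lintegral (μ := ν) (f := f) (p := 2) (by norm_num)
  simp only [NNReal.coe_ofNat, ENNReal.rpow_ofNat, ENNReal.coe_ofNat] at h
  rw [← h, ENNReal.ofReal_pow (norm_nonneg _), ofReal_norm, Lp.enorm_def]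

variable [SFinite ν] {k : α → α → ℂ} (hk : Measurable (Function.uncurry k)) {S : ℝ≥0∞} (hS : S < ⊤)
  (h1 : ∀ x, ∫⁻ y, ‖k x y‖ₑ ∂ν ≤ S) (h2 : ∀ y, ∫⁻ x, ‖k x y‖ₑ ∂ν ≤ S)

include hk h2 in
lemma lintegral_schur_sq_le {f : α → ℂ} (hf : AEStronglyMeasurable f ν) :
    ∫⁻ x, ∫⁻ y, ‖k x y‖ₑ * ‖f y‖ₑ ^ 2 ∂ν ∂ν ≤ S * ∫⁻ y, ‖f y‖ₑ ^ 2 ∂ν := by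
  have hkm : Measurable fun z : α × α => ‖k z.1 z.2‖ₑ := hk.enorm
  have hfm : AEMeasurable (fun z : α × α => ‖f z.2‖ₑ ^ 2) (ν.prod ν) :=
    (hf.enorm.pow_const 2).comp_quasiMeasurePreserving Measure.quasiMeasurePreserving_snd
  rw [lintegral_lintegral_swap (hkm.aemeasurable.mul hfm),
    ← lintegral_const_mul'' _ (hf.enorm.pow_const 2)]
  refine lintegral_mono fun y => ?_
  simp only
  rw [lintegral_mul_const _ (show Measurable (fun x => ‖k x y‖ₑ) from
    (hk.comp measurable_prodMk_right).enorm)]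
  gcongr
  exact h2 y

-- Bounding `|f|` by `1 + |f|²` reduces convergence to the row bound on `k` and to the almost
-- everywhere finiteness of `∫ |k||f|²`.
include hk hS h1 h2 in
lemma ae_integrable_schur {f : α → ℂ} (hf : MemLp f 2 ν) :
    ∀ᵐ x ∂ν, Integrable (fun y => k x y * f y) ν := by
  have hkm : Measurable fun z : α × α => ‖k z.1 z.2‖ₑ := hk.enorm
  have hfm : AEMeasurable (fun z : α × α => ‖f z.2‖ₑ ^ 2) (ν.prod ν) :=
    (hf.aestronglyMeasurable.enorm.pow_const 2).comp_quasiMeasurePreserving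
      Measure.quasiMeasurePreserving_snd
  have hfin : ∫⁻ x, ∫⁻ y, ‖k x y‖ₑ * ‖f y‖ₑ ^ 2 ∂ν ∂ν ≠ ⊤ := by
    refine ((lintegral_schur_sq_le hk h2 hf.aestronglyMeasurable).trans_lt
      (ENNReal.mul_lt_top hS hf.lintegral_enorm_sq_lt_top)).ne
  filter_upwards [ae_lt_top' (hkm.aemeasurable.mul hfm).lintegral_prod_right' hfin] with x hx
  have hkx : Measurable (k x) := hk.comp measurable_prodMk_left
  refine ⟨hkx.aestronglyMeasurable.mul hf.aestronglyMeasurable, ?_⟩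
  calc ∫⁻ y, ‖k x y * f y‖ₑ ∂ν ≤ ∫⁻ y, (‖k x y‖ₑ + ‖k x y‖ₑ * ‖f y‖ₑ ^ 2) ∂ν := by
        refine lintegral_mono fun y => ?_
        simp only
        rw [enorm_mul]
        nth_rewrite 2 [← mul_one ‖k x y‖ₑ]
        rw [← mul_add]
        gcongr
        rcases le_total ‖f y‖ₑ 1 with h | h
        · exact h.trans le_self_add
        · calc ‖f y‖ₑ = ‖f y‖ₑ * 1 := (mul_one _).symm
            _ ≤ ‖f y‖ₑ * ‖f y‖ₑ := by gcongr
            _ = ‖f y‖ₑ ^ 2 := (sq _).symm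
            _ ≤ _ := le_add_self
    _ = ∫⁻ y, ‖k x y‖ₑ ∂ν + ∫⁻ y, ‖k x y‖ₑ * ‖f y‖ₑ ^ 2 ∂ν := lintegral_add_left hkx.enorm _
    _ < ⊤ := ENNReal.add_lt_top.2 ⟨(h1 x).trans_lt hS, hx⟩

-- Cauchy–Schwarz with `|k| = |k|^{1/2}|k|^{1/2}`: the row bound controls one factor, the column
-- bound the integral of the other.
include hk hS h1 h2 in
lemma memLp_schur {f : α → ℂ} (hf : MemLp f 2 ν) : MemLp (fun x => ∫ y, k x y * f y ∂ν) 2 ν := by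
  have hm : AEStronglyMeasurable (fun z : α × α => k z.1 z.2 * f z.2) (ν.prod ν) :=
    hk.aestronglyMeasurable.mul
      (hf.aestronglyMeasurable.comp_quasiMeasurePreserving Measure.quasiMeasurePreserving_snd)
  refine ⟨hm.integral_prod_right', ?_⟩
  rw [eLpNorm_lt_top_iff_lintegral_rpow_enorm_lt_top (by norm_num) (by norm_num)]
  simp only [ENNReal.toReal_ofNat, ENNReal.rpow_ofNat]
  have hpt : ∀ x, ‖∫ y, k x y * f y ∂ν‖ₑ ^ 2 ≤ S * ∫⁻ y, ‖k x y‖ₑ * ‖f y‖ₑ ^ 2 ∂ν := by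
    intro x
    have hkx : Measurable fun y => ‖k x y‖ₑ := (hk.comp measurable_prodMk_left).enorm
    have hCS := ENNReal.lintegral_mul_le_Lp_mul_Lq ν Real.HolderConjugate.two_two
      (f := fun y => ‖k x y‖ₑ ^ (1 / 2 : ℝ)) (g := fun y => ‖k x y‖ₑ ^ (1 / 2 : ℝ) * ‖f y‖ₑ)
      (hkx.pow_const _).aemeasurable
      ((hkx.pow_const _).aemeasurable.mul hf.aestronglyMeasurable.enorm)
    have e1 : ∀ a : ℝ≥0∞, a ^ (1 / 2 : ℝ) * a ^ (1 / 2 : ℝ) = a := by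
      intro a
      rw [← ENNReal.rpow_add_of_nonneg _ _ (by norm_num) (by norm_num)]
      norm_num
    have e2 : ∀ a : ℝ≥0∞, (a ^ (1 / 2 : ℝ)) ^ 2 = a := fun a => by rw [sq, e1]
    simp only [Pi.mul_apply, ← mul_assoc, e1, ENNReal.rpow_two, mul_pow, e2] at hCS
    calc ‖∫ y, k x y * f y ∂ν‖ₑ ^ 2 ≤ (∫⁻ y, ‖k x y‖ₑ * ‖f y‖ₑ ∂ν) ^ 2 := by
          gcongr
          refine (enorm_integral_le_lintegral_enorm _).trans (le_of_eq ?_)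
          simp only [enorm_mul]
      _ ≤ _ := pow_le_pow_left₀ (by positivity) hCS 2
      _ = (∫⁻ y, ‖k x y‖ₑ ∂ν) * ∫⁻ y, ‖k x y‖ₑ * ‖f y‖ₑ ^ 2 ∂ν := by
          rw [mul_pow, e2, e2]
      _ ≤ _ := by gcongr; exact h1 x
  calc _ ≤ ∫⁻ x, S * ∫⁻ y, ‖k x y‖ₑ * ‖f y‖ₑ ^ 2 ∂ν ∂ν := lintegral_mono hpt
    _ = S * ∫⁻ x, ∫⁻ y, ‖k x y‖ₑ * ‖f y‖ₑ ^ 2 ∂ν ∂ν := lintegral_const_mul' _ _ hS.ne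
    _ ≤ S * (S * ∫⁻ y, ‖f y‖ₑ ^ 2 ∂ν) := by
        gcongr
        exact lintegral_schur_sq_le hk h2 hf.aestronglyMeasurable
    _ < ⊤ := by
        refine ENNReal.mul_lt_top hS (ENNReal.mul_lt_top hS ?_)
        have := lintegral_rpow_enorm_lt_top_of_eLpNorm_lt_top (by norm_num) (by norm_num) hf.2
        simpa using this

include hk hS h1 h2 in
lemma integrable_schur_mul {f g : α → ℂ} (hf : MemLp f 2 ν) (hg : MemLp g 2 ν) :
    Integrable (fun z : α × α => k z.1 z.2 * (g z.1 * f z.2)) (ν.prod ν) := by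
  have hm : AEStronglyMeasurable (fun z : α × α => k z.1 z.2 * (g z.1 * f z.2)) (ν.prod ν) :=
    hk.aestronglyMeasurable.mul
      ((hg.aestronglyMeasurable.comp_quasiMeasurePreserving Measure.quasiMeasurePreserving_fst).mul
      (hf.aestronglyMeasurable.comp_quasiMeasurePreserving Measure.quasiMeasurePreserving_snd))
  refine ⟨hm, ?_⟩
  rw [HasFiniteIntegral]
  simp only [enorm_mul]
  refine (lintegral_schur (k := fun x y => ‖k x y‖ₑ) hk.enorm h1 h2
    hf.aestronglyMeasurable.enorm hg.aestronglyMeasurable.enorm).trans_lt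
    (ENNReal.mul_lt_top hS (ENNReal.add_lt_top.2 ⟨?_, ?_⟩))
  · have := lintegral_rpow_enorm_lt_top_of_eLpNorm_lt_top (by norm_num) (by norm_num) hf.2
    simpa using this
  · have := lintegral_rpow_enorm_lt_top_of_eLpNorm_lt_top (by norm_num) (by norm_num) hg.2
    simpa using this

include hk hS h1 h2 in
/-- The integral operator of a kernel satisfying Schur's condition, with operator norm controlled
by the bilinear form. -/
lemma exists_clm_of_schur {B : ℝ} (hB : 0 < B)
    (hbil : ∀ f g : α → ℂ, MemLp f 2 ν → MemLp g 2 ν →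
      ‖∫ z : α × α, k z.1 z.2 * (g z.1 * f z.2) ∂(ν.prod ν)‖ₑ ≤
        ENNReal.ofReal B * (∫⁻ x, ‖f x‖ₑ ^ 2 ∂ν + ∫⁻ x, ‖g x‖ₑ ^ 2 ∂ν)) :
    ∃ T : Lp ℂ 2 ν →L[ℂ] Lp ℂ 2 ν, (∀ f : Lp ℂ 2 ν, ∀ᵐ x ∂ν,
      Integrable (fun y => k x y * f y) ν ∧ T f x = ∫ y, k x y * f y ∂ν) ∧ ‖T‖ ≤ 2 * B := by
  have hmem := fun f : Lp ℂ 2 ν => memLp_schur hk hS h1 h2 (Lp.memLp f)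
  have hint := fun f : Lp ℂ 2 ν => ae_integrable_schur hk hS h1 h2 (Lp.memLp f)
  set T₀ : Lp ℂ 2 ν →ₗ[ℂ] Lp ℂ 2 ν :=
    { toFun := fun f => (hmem f).toLp
      map_add' := by
        intro f g
        rw [← MemLp.toLp_add]
        refine MemLp.toLp_congr _ _ ?_
        filter_upwards [hint f, hint g] with x hf hg
        rw [Pi.add_apply, ← integral_add hf hg]
        refine integral_congr_ae ?_
        filter_upwards [Lp.coeFn_add f g] with y hy
        rw [hy, Pi.add_apply, mul_add]
      map_smul' := by
        intro c f
        rw [RingHom.id_apply, ← MemLp.toLp_const_smul]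
        refine MemLp.toLp_congr _ _ (Filter.Eventually.of_forall fun x => ?_)
        rw [Pi.smul_apply, smul_eq_mul, ← integral_const_mul]
        refine integral_congr_ae ?_
        filter_upwards [Lp.coeFn_smul c f] with y hy
        rw [hy, Pi.smul_apply, smul_eq_mul]
        ring } with hT₀
  have hbound : ∀ f, ‖T₀ f‖ ≤ 2 * B * ‖f‖ := by
    intro f
    set u : α → ℂ := fun x => ∫ y, k x y * f y ∂ν with hu
    have hTu : T₀ f =ᵐ[ν] u := (hmem f).coeFn_toLp
    have hnorm : ∫⁻ x, ‖u x‖ₑ ^ 2 ∂ν = ENNReal.ofReal (‖T₀ f‖ ^ 2) := by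
      rw [← lintegral_enorm_sq_eq]
      refine lintegral_congr_ae ?_
      filter_upwards [hTu] with x hx
      rw [hx]
    -- The form is tested on `t f` and `t⁻¹` times the conjugate of `T₀ f`. With `t² = 2B` the bound
    -- reads `‖T₀f‖² ≤ 2B²‖f‖² + ‖T₀f‖²/2`, and the last term is absorbed.
    set t : ℝ := Real.sqrt (2 * B) with ht
    have ht2 : t ^ 2 = 2 * B := Real.sq_sqrt (by positivity)
    have ht0 : 0 < t := Real.sqrt_pos.2 (by positivity)
    have hgm : MemLp (fun x => (starRingEnd ℂ) (u x)) 2 ν :=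
      (hmem f).of_le (continuous_conj.comp_aestronglyMeasurable (hmem f).aestronglyMeasurable)
        (Filter.Eventually.of_forall fun x => (RCLike.norm_conj _).le)
    have h3 := hbil (fun y => (t : ℂ) * f y) (fun x => ((t⁻¹ : ℝ) : ℂ) * (starRingEnd ℂ) (u x))
      ((Lp.memLp f).const_mul _) (hgm.const_mul _)
    have h4 : ∫ z : α × α, k z.1 z.2 * (((t⁻¹ : ℝ) : ℂ) * (starRingEnd ℂ) (u z.1) *
        ((t : ℂ) * f z.2)) ∂(ν.prod ν) = ((‖T₀ f‖ ^ 2 : ℝ) : ℂ) := by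
      have e : ∀ z : α × α, k z.1 z.2 * (((t⁻¹ : ℝ) : ℂ) * (starRingEnd ℂ) (u z.1) *
          ((t : ℂ) * f z.2)) = k z.1 z.2 * ((starRingEnd ℂ) (u z.1) * f z.2) := by
        intro z
        have : (t : ℂ) ≠ 0 := by exact_mod_cast ht0.ne'
        push_cast
        field_simp
      simp only [e]
      rw [integral_prod _ (integrable_schur_mul hk hS h1 h2 (Lp.memLp f) hgm)]
      have e2 : ∀ x, ∫ y, k x y * ((starRingEnd ℂ) (u x) * f y) ∂ν = ((‖u x‖ ^ 2 : ℝ) : ℂ) := by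
        intro x
        rw [← normSq_eq_norm_sq, ← mul_conj, hu]
        simp only
        rw [← integral_mul_const]
        congr with y
        ring
      simp only [e2]
      rw [integral_complex_ofReal]
      congr 1
      have h5 := (hmem f).integrable_norm_pow (p := 2) (by norm_num)
      rw [← ENNReal.ofReal_eq_ofReal_iff (integral_nonneg fun x => by positivity) (by positivity),
        ← hnorm, ofReal_integral_eq_lintegral_ofReal h5
        (Filter.Eventually.of_forall fun x => by positivity)]
      congr with x
      rw [ENNReal.ofReal_pow (norm_nonneg _), ofReal_norm]
    rw [h4] at h3
    have e5 : ∫⁻ y, ‖(t : ℂ) * f y‖ₑ ^ 2 ∂ν = ENNReal.ofReal (t ^ 2 * ‖f‖ ^ 2) := by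
      simp only [enorm_mul, mul_pow]
      rw [lintegral_const_mul' _ _ (by simp), lintegral_enorm_sq_eq, ENNReal.ofReal_mul (by positivity),
        enorm_ofReal, Real.enorm_of_nonneg ht0.le, ENNReal.ofReal_pow ht0.le]
    have e6 : ∫⁻ x, ‖((t⁻¹ : ℝ) : ℂ) * (starRingEnd ℂ) (u x)‖ₑ ^ 2 ∂ν =
        ENNReal.ofReal (t⁻¹ ^ 2 * ‖T₀ f‖ ^ 2) := by
      have e7 : ∀ w : ℂ, ‖(starRingEnd ℂ) w‖ₑ = ‖w‖ₑ := fun w => by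
        rw [← ofReal_norm, RCLike.norm_conj, ofReal_norm]
      simp only [enorm_mul, mul_pow, e7]
      rw [lintegral_const_mul' _ _ (by simp), hnorm, ENNReal.ofReal_mul (by positivity),
        enorm_ofReal, Real.enorm_of_nonneg (by positivity), ENNReal.ofReal_pow (inv_nonneg.2 ht0.le)]
    rw [e5, e6, enorm_ofReal, Real.enorm_of_nonneg (by positivity),
      ← ENNReal.ofReal_add (by positivity) (by positivity), ← ENNReal.ofReal_mul hB.le,
      ENNReal.ofReal_le_ofReal_iff (by positivity), inv_pow, ht2] at h3
    have e8 : B * (2 * B * ‖f‖ ^ 2 + (2 * B)⁻¹ * ‖T₀ f‖ ^ 2) =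
        2 * B ^ 2 * ‖f‖ ^ 2 + ‖T₀ f‖ ^ 2 / 2 := by
      field_simp
    rw [e8] at h3
    refine (sq_le_sq₀ (norm_nonneg _) (by positivity)).1 ?_
    nlinarith
  refine ⟨T₀.mkContinuous _ hbound, fun f => ?_,
    LinearMap.mkContinuous_norm_le _ (by positivity) _⟩
  filter_upwards [hint f, (hmem f).coeFn_toLp] with x hx hx2
  exact ⟨hx, hx2⟩

end SchurOperator

/-! ### Conclusion for the restricted resolvent. -/

lemma measurable_greenFunction {d : ℕ} {l : ℂ} (hl : 0 < l.im) :
    Measurable (Function.uncurry (greenFunction d l)) := by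
  have h : Function.uncurry (greenFunction d l) =
      fun z : EuclideanSpace ℝ (Fin d) × EuclideanSpace ℝ (Fin d) =>
        ∫ a in Ioi (0 : ℝ), greenIntegrand d l ‖z.1 - z.2‖ a := by
    ext z
    exact greenFunction_eq_integral hl z.1 z.2
  rw [h]
  refine (StronglyMeasurable.integral_prod_right
    (f := fun (z : EuclideanSpace ℝ (Fin d) × EuclideanSpace ℝ (Fin d)) (a : ℝ) =>
      greenIntegrand d l ‖z.1 - z.2‖ a) ?_).measurable
  have h2 : Measurable fun q : (EuclideanSpace ℝ (Fin d) × EuclideanSpace ℝ (Fin d)) × ℝ =>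
      ((‖q.1.1 - q.1.2‖, q.2) : ℝ × ℝ) := by fun_prop
  exact ((measurable_greenIntegrand d l).comp h2).stronglyMeasurable

/-- Isolates the only input that differs between the two regimes, the symbol bound. The constant is
chosen before `l`, so uniformity in `l` is inherited from that bound. -/
lemma exists_restrictedResolvent_norm_le {n : ℕ} {Γ : Set (EuclideanSpace ℝ (Fin (n + 1)))}
    (hΓ : IsFiniteUnionOfCompactC11Pieces n Γ) {C : ℝ} (hC : 0 < C) :
    ∃ C' : ℝ, 0 < C' ∧ ∀ l : ℂ, 0 < l.im →
      (∀ x, 0 ≤ x → ‖dampedSymbol (n + 1) l x‖ ≤ C * symbolWeight ‖l‖ l.im x) →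
      ∃ T : Lp ℂ 2 (surfaceMeasure n Γ) →L[ℂ] Lp ℂ 2 (surfaceMeasure n Γ),
        IsRestrictedResolvent n Γ l T ∧ ‖T‖ ≤ C' * (japaneseBracket l.im)⁻¹ := by
  have hσ := hΓ.isGraphSum
  have := hΓ.isFiniteMeasure
  obtain ⟨R, hR⟩ := hΓ.isCompact.isBounded.subset_closedBall 0
  have hR' : ∀ᵐ x ∂surfaceMeasure n Γ, ‖x‖ ≤ R := by
    filter_upwards [ae_restrict_mem hΓ.isCompact.measurableSet] with x hx
    simpa using hR hx
  obtain ⟨K, hK⟩ := hσ.exists_enorm_green_le hR'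
  -- The factor `32` is `2` from passing to the operator norm, `8` from the integral of the weight,
  -- and `2` from `⟨t⟩ ≤ 2(1+t)`. Using `K + 1` keeps the constant positive when `K = 0`.
  refine ⟨32 * ((K + 1) * C), by positivity, fun l hl hsym => ?_⟩
  obtain ⟨S, hS, hSle⟩ := hσ.exists_lintegral_greenIntegrand_le hl
  have h1 : ∀ x, ∫⁻ y, ‖greenFunction (n + 1) l x y‖ₑ ∂surfaceMeasure n Γ ≤ S := fun x =>
    (lintegral_mono fun y => by
      rw [greenFunction_eq_integral hl]
      exact enorm_integral_le_lintegral_enorm _).trans (hSle x)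
  have h2 : ∀ y, ∫⁻ x, ‖greenFunction (n + 1) l x y‖ₑ ∂surfaceMeasure n Γ ≤ S := fun y =>
    (lintegral_mono fun x => by
      simp only [greenFunction, norm_sub_rev x y]
      rfl).trans (h1 y)
  have hB : 0 < ((K : ℝ) + 1) * (C * (8 / (1 + l.im))) := by positivity
  obtain ⟨T, hT, hTn⟩ := exists_clm_of_schur (measurable_greenFunction hl) hS h1 h2 hB
    fun f g hf hg => (hK l C hl hC hsym f g hf hg).trans (by
      refine mul_le_mul' ?_ le_rfl
      rw [ENNReal.ofReal_mul (p := (K : ℝ) + 1) (by positivity)]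
      refine mul_le_mul' ?_ le_rfl
      rw [← ENNReal.ofReal_coe_nnreal]
      exact ENNReal.ofReal_le_ofReal (by linarith))
  refine ⟨T, hT, hTn.trans ?_⟩
  have hj : 0 < japaneseBracket l.im := Real.sqrt_pos.2 (by positivity)
  have hj2 : japaneseBracket l.im ≤ 2 * (1 + l.im) :=
    Real.sqrt_le_iff.2 ⟨by positivity, by nlinarith⟩
  rw [← div_eq_mul_inv, le_div_iff₀ hj]
  calc 2 * ((K + 1) * (C * (8 / (1 + l.im)))) * japaneseBracket l.im
      ≤ 2 * ((K + 1) * (C * (8 / (1 + l.im)))) * (2 * (1 + l.im)) := by gcongr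
    _ = 32 * ((K + 1) * C) := by
        field_simp
        ring

/-- The ambient dimension is `d = n + 1`, so `2 ≤ n` means `d ≥ 3` and every natural `n` covers `d ≥
1`. -/
theorem theorem3 (n : ℕ) (Γ : Set (EuclideanSpace ℝ (Fin (n + 1))))
    (hΓ : IsFiniteUnionOfCompactC11Pieces n Γ) :
    (2 ≤ n → ∃ C : ℝ, 0 < C ∧ ∀ l : ℂ, 0 < l.im →
      ∃ T : Lp ℂ 2 (surfaceMeasure n Γ) →L[ℂ] Lp ℂ 2 (surfaceMeasure n Γ),
        IsRestrictedResolvent n Γ l T ∧ ‖T‖ ≤ C * (japaneseBracket l.im)⁻¹) ∧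
    (∀ r : ℝ, 0 < r → ∃ C : ℝ, 0 < C ∧ ∀ l : ℂ, 0 < l.im → r ≤ ‖l‖ →
      ∃ T : Lp ℂ 2 (surfaceMeasure n Γ) →L[ℂ] Lp ℂ 2 (surfaceMeasure n Γ),
        IsRestrictedResolvent n Γ l T ∧ ‖T‖ ≤ C * (japaneseBracket l.im)⁻¹) := by
  refine ⟨fun hn => ?_, fun r hr => ?_⟩
  · obtain ⟨C, hC, hsym⟩ := exists_norm_dampedSymbol_le (d := n + 1) (by omega)
    obtain ⟨C', hC', h⟩ := exists_restrictedResolvent_norm_le hΓ hC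
    exact ⟨C', hC', fun l hl => h l hl (hsym l hl)⟩
  · obtain ⟨C, hC, hsym⟩ := exists_norm_dampedSymbol_le_of_le (d := n + 1) (by omega) hr
    obtain ⟨C', hC', h⟩ := exists_restrictedResolvent_norm_le hΓ hC
    exact ⟨C', hC', fun l hl hrl => h l hl (hsym l hl hrl)⟩
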